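/- **Setting.** Let $b:\mathbb R\to\mathbb R$, $\phi^*>0$, a measure $\nu$ on $\mathbb R$ and a measurable $c\ge 0$ be such that $y\mapsto\exp\{(y\theta-b(\theta))/\phi^*\}c(y)$ is a probability density with respect to $\nu$ for every $\theta\in\mathbb R$. For each $n$ let $X=(x_1,\dots,x_n)'\in\mathbb R^{n\times p}$ be a fixed design with columns $X_j$, $\beta^*\in\mathbb R^p$, and let $y_1,\dots,y_n$ be independent, $y_i$ having the above density with $\theta=x_i'\beta^*$. Here $p$, $X$, $\beta^*$ and all quantities below not declared constant may depend on $n$; conditions on the $n$-th experiment are required for all large $n$; $p\ge 2$ and $\log p=O(n^\eta)$ for some $\eta\in(0,1)$. Let $M\subseteq\{1,\dots,p\}$, $m=|M|$, $C\in\mathbb R^{r\times m}$ of full row rank (columns indexed by $M$), $t\in\mathbb R^r$, $h_n=C\beta^*_M-t$, $A=\{j:\beta^*_j\ne0\}$, $\tilde s=|A|$, $S=A\setminus M$, $s=|S|$, $J=M\cup S$. Put $$\ell_n(\beta)=-\tfrac1n\sum_{i=1}^n\{y_ix_i'\beta-b(x_i'\beta)\},\qquad \nabla\ell_n(\beta)=-\tfrac1nX'\big(y-(b'(x_i'\beta))_i\big),\qquad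 \nabla^2\ell_n(\beta)=\tfrac1nX'\Sigma(X\beta)X,$$ $\Sigma(X\beta)=\mathrm{diag}(b''(x_i'\beta))$, $K_n=\nabla^2_J\ell_n(\beta^*)$, $\Psi=[C\ 0]K_n^{-1}[C\ 0]'$ and $P_n=K_n^{-1/2}[C\ 0]'\Psi^{-1}[C\ 0]K_n^{-1/2}$, the block $[C\ 0]$ having columns indexed by $J$ and being zero on $S$. The event "with probability tending to one" is understood with outer probability of its complement tending to zero. Let $p_\lambda$, $\lambda>0$, be penalties with constants $a_1,a_2>0$, $a>a_2$: on $[0,\infty)$ $p_\lambda$ is increasing (weakly) and concave, $p_\lambda(0)=0$; it is differentiable on $(0,\infty)$ with $p_\lambda'(0):=p_\lambda'(0^+)$ existing in $\mathbb R$ and $\ge a_1\lambda$; $p'_\lambda(u)\ge a_1\lambda$ for $0<u\le a_2\lambda$; $p_\lambda'(u)=0$ for $u\ge a\lambda$. Let $\lambda=\lambda_n>0$, $\lambda_{\rm lasso}=\lambda_{{\rm lasso},n}>0$. **Estimators.** "Argmin" means any minimiser whenever one exists (and an arbitrary point otherwise). Let $\hat\beta^{\rm lasso}=\arg\min_\beta\ell_n(\beta)+\lambda_{\rm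 lasso}\|\beta\|_1$. From $\hat\beta^{(0)}=\hat\beta^{\rm lasso}$, the LLA iterates are $\hat\beta^{(k)}=\arg\min_\beta \ell_n(\beta)+\sum_{j\notin M}p_\lambda'(|\hat\beta^{(k-1)}_j|)|\beta_j|$, $k=1,2$, minimised subject to $C\beta_M=t$ for the reduced model (solution $\hat\beta_0^{(2)}$) and over $\mathbb R^p$ for the full model (solution $\hat\beta_a^{(2)}$). **Assumptions.** 1. With probability tending to one, $\hat\beta_0^{\rm oracle}=\arg\min\{\ell_n(\beta):\beta_{J^c}=0,\ C\beta_M=t\}$ and $\hat\beta_a^{\rm oracle}=\arg\min\{\ell_n(\beta):\beta_{J^c}=0\}$ exist and are unique, $\nabla_J\ell_n(\hat\beta_0^{\rm oracle})=[C\ 0]'\nu$ for some $\nu\in\mathbb R^r$, and $\nabla_J\ell_n(\hat\beta_a^{\rm oracle})=0$. 2. $\min_{j\in S}|\beta_j^*|>(a+1)\lambda$. 3. $h_n\to0$, $\lambda_{\max}\{(CC')^{-1}\}=O(1)$, $\|h_n\|_2=O(\sqrt{\min\{s+m-r,r\}/n})$. 4. $\max\{\sqrt{s+m},\sqrt{\log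 p}\}/\sqrt n=o(\lambda)$. 5. With $\mathcal N_0=\{\beta:\|\beta_J-\beta^*_J\|_2\le\sqrt{(s+m)\log n/n},\ \beta_{J^c}=0\}$: for some constant $c_0>0$, $\inf_{\beta\in\mathcal N_0}\lambda_{\min}\{X_J'\Sigma(X\beta)X_J\}\ge c_0n$; $\sup_{\beta\in\mathcal N_0}\max_{1\le j\le p}\lambda_{\max}\{X_J'\,\mathrm{diag}(|X_{ij}||b'''(x_i'\beta)|)_i\,X_J\}=O(n)$; $\lambda_{\max}\{X_J'\Sigma(X\beta^*)X_J\}=O(n)$; and the maximal absolute row sum of $X_{J^c}'\Sigma(X\beta^*)X_J$ is $O(n)$. 6. For constants $B_1,B_2>0$: $\max_j\|X_j\|_2^2\le B_1n$ and $\max_j\|X_j\|_\infty\le B_2\sqrt{n/\log p}$. 7. For constants $M_0,v_0>0$: $\max_i E[\exp(|\varepsilon_i|/M_0)-1-|\varepsilon_i|/M_0]M_0^2\le v_0/2$, where $\varepsilon_i=y_i-b'(x_i'\beta^*)$. 8. $\kappa=\kappa_n>0$ satisfies $u'\nabla^2\ell_n(\beta^*)u\ge\kappa\,u'u$ for all $u\ne0$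 with $\|u_{A^c}\|_1\le3\|u_A\|_1$ (for instance the minimum of the Rayleigh quotient over this cone, if positive). 9. For a constant $K_0>0$: $|b'''(x)|\le K_0b''(x)$ for all $x\in\mathbb R$. 10. $20K_0\|X\|_{\max}\,\tilde s\,\lambda_{\rm lasso}\le\kappa$; $\;2p\exp\Big\{-\frac18\frac{n\lambda_{\rm lasso}^2}{B_1v_0+\frac12B_2M_0\sqrt{n/\log p}\,\lambda_{\rm lasso}}\Big\}\to0$ (this holds, for instance, if $p\to\infty$ and $\lambda_{\rm lasso}=L\sqrt{\log p/n}$ with a constant $L>0$, $L^2>16(B_1v_0+\frac12LB_2M_0)$); and $\lambda\ge 5\tilde s^{1/2}\lambda_{\rm lasso}/(\min\{1,a_2\}\,\kappa)$. **Theorem.** If $s+m=o(n^{1/2})$, then $$\|\hat\beta^{(2)}_{0,J}-\beta^*_J\|_2=O_p\big(\sqrt{(s+m-r)/n}\big),\qquad \|\hat\beta^{(2)}_{a,J}-\beta^*_J\|_2=O_p\big(\sqrt{(s+m)/n}\big),$$ and $\hat\beta^{(2)}_{0,J^c}=0$ and $\hat\beta^{(2)}_{a,J^c}=0$ with probability tending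 to one. If moreover $s+m=o(n^{1/3})$, then, with $o_p(1)$ in Euclidean norm, $$\sqrt n(\hat\beta^{(2)}_{0,J}-\beta^*_J)=\sqrt nK_n^{-1/2}(P_n-I)K_n^{-1/2}\nabla_J\ell_n(\beta^*)-\sqrt nK_n^{-1/2}P_nK_n^{1/2}\begin{bmatrix}C'(CC')^{-1}h_n\\0\end{bmatrix}+o_p(1),$$ $$\sqrt n(\hat\beta^{(2)}_{a,J}-\beta^*_J)=-\sqrt nK_n^{-1}\nabla_J\ell_n(\beta^*)+o_p(1).$$ -/

import Mathlib

open Filter Topology MeasureTheory ProbabilityTheory Asymptotics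
open scoped Matrix BigOperators

noncomputable section

namespace PPGLM

/-! ### Vectors, matrices, minimisers, stochastic orders -/

/-- The Euclidean norm of a real vector. -/
def l2norm {ι : Type*} [Fintype ι] (v : ι → ℝ) : ℝ := ‖WithLp.toLp 2 v‖

/-- Entrywise maximum `max |A i j|` of a matrix. -/
def entryMax {n p : ℕ} (A : Matrix (Fin n) (Fin p) ℝ) : ℝ :=
  ⨆ ij : Fin n × Fin p, |A ij.1 ij.2|

/-- All eigenvalues of `A` are at most `K`, that is, `λ_max(A) ≤ K`. -/
def EigLE {ι : Type*} [Fintype ι] [DecidableEq ι] (A : Matrix ι ι ℝ) (K : ℝ) : Prop :=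
  ∀ μ ∈ spectrum ℝ A, μ ≤ K

/-- All eigenvalues of `A` are at least `K`, that is, `K ≤ λ_min(A)`. -/
def EigGE {ι : Type*} [Fintype ι] [DecidableEq ι] (A : Matrix ι ι ℝ) (K : ℝ) : Prop :=
  ∀ μ ∈ spectrum ℝ A, K ≤ μ

/-- `A^{1/2}`, by the spectral calculus (used for positive semidefinite `A`). -/
def sqrtMat {ι : Type*} [Fintype ι] [DecidableEq ι] (A : Matrix ι ι ℝ) : Matrix ι ι ℝ :=
  cfc (fun x : ℝ => √x) A

/-- `A^{-1/2}`, by the spectral calculus (used for positive definite `A`). -/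
def invSqrtMat {ι : Type*} [Fintype ι] [DecidableEq ι] (A : Matrix ι ι ℝ) : Matrix ι ι ℝ :=
  cfc (fun x : ℝ => (√x)⁻¹) A

/-- The set of minimisers of `f` over `s`. -/
def argminOn {E : Type*} (f : E → ℝ) (s : Set E) : Set E :=
  {x | x ∈ s ∧ ∀ z ∈ s, f x ≤ f z}

/-- `x` is a computed solution of "minimise `f` over `s`": it is a minimiser (any one of them, if
there are several) whenever a minimiser exists. Nothing is required when there is none, as may
happen with positive probability, for instance in logistic regression with separated data. -/
def IsComputedArgmin {E : Type*} (f : E → ℝ) (s : Set E) (x : E) : Prop :=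
  (argminOn f s).Nonempty → x ∈ argminOn f s

/-- `x` is the unique minimiser of `f` over `s`. -/
def IsUniqueArgmin {E : Type*} (f : E → ℝ) (s : Set E) (x : E) : Prop :=
  argminOn f s = {x}

/-- The statement `E n` about the `n`-th experiment holds with probability converging to one
(the outer probability of its failure tends to zero). -/
def WithProbToOne {Ω : ℕ → Type*} [∀ n, MeasurableSpace (Ω n)] (P : ∀ n, Measure (Ω n))
    (E : ∀ n, Ω n → Prop) : Prop :=
  Tendsto (fun n => P n {ω | ¬ E n ω}) atTop (𝓝 0)

/-- `Z n = O_p(a n)`. -/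
def IsBigOp {Ω : ℕ → Type*} [∀ n, MeasurableSpace (Ω n)] (P : ∀ n, Measure (Ω n))
    (Z : ∀ n, Ω n → ℝ) (a : ℕ → ℝ) : Prop :=
  ∀ ε : ℝ, 0 < ε → ∃ K : ℝ, 0 < K ∧
    ∀ᶠ n in atTop, P n {ω | K * a n < |Z n ω|} ≤ ENNReal.ofReal ε

/-- `Z n = o_p(1)` for random vectors `Z n`, whose dimension may vary with `n`, in Euclidean
norm. -/
def IsLittleOpOne {Ω : ℕ → Type*} [∀ n, MeasurableSpace (Ω n)] (P : ∀ n, Measure (Ω n))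
    {ι : ℕ → Type*} [∀ n, Fintype (ι n)] (Z : ∀ n, Ω n → ι n → ℝ) : Prop :=
  ∀ δ : ℝ, 0 < δ → Tendsto (fun n => P n {ω | δ < l2norm (Z n ω)}) atTop (𝓝 0)

/-! ### The exponential family -/

/-- The law with density `exp ((y θ - b θ) / φ) c(y)` with respect to `ν`. -/
def expLaw (b : ℝ → ℝ) (φ : ℝ) (ν : Measure ℝ) (c : ℝ → ℝ) (θ : ℝ) : Measure ℝ :=
  ν.withDensity fun y => ENNReal.ofReal (Real.exp ((y * θ - b θ) / φ) * c y)

/-- `exp ((y θ - b θ) / φ) c(y)` is a family of probability densities with respect to `ν`, with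
canonical parameter `θ ∈ ℝ`. -/
structure IsExpFamily (b : ℝ → ℝ) (φ : ℝ) (ν : Measure ℝ) (c : ℝ → ℝ) : Prop where
  phi_pos : 0 < φ
  measurable_c : Measurable c
  c_nonneg : ∀ y, 0 ≤ c y
  isProb : ∀ θ, IsProbabilityMeasure (expLaw b φ ν c θ)

/-! ### The generalized linear model loss -/

/-- `ℓ_n(β) = -(1/n) ∑ i, (y_i x_i'β - b (x_i'β))`. -/
def loss {n p : ℕ} (b : ℝ → ℝ) (X : Matrix (Fin n) (Fin p) ℝ) (y : Fin n → ℝ)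
    (β : Fin p → ℝ) : ℝ :=
  -(1 / (n : ℝ)) * ∑ i, (y i * (X *ᵥ β) i - b ((X *ᵥ β) i))

/-- The gradient `∇ℓ_n(β) = -(1/n) X'(y - μ(Xβ))`, where `μ(v) = (b'(v_i))_i`. -/
def grad {n p : ℕ} (b : ℝ → ℝ) (X : Matrix (Fin n) (Fin p) ℝ) (y : Fin n → ℝ)
    (β : Fin p → ℝ) : Fin p → ℝ :=
  (-(1 / (n : ℝ))) • (Xᵀ *ᵥ fun i => y i - deriv b ((X *ᵥ β) i))

/-- `Σ(Xβ) = diag (b''(x_i'β))`. -/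
def Sig {n p : ℕ} (b : ℝ → ℝ) (X : Matrix (Fin n) (Fin p) ℝ) (β : Fin p → ℝ) :
    Matrix (Fin n) (Fin n) ℝ :=
  Matrix.diagonal fun i => iteratedDeriv 2 b ((X *ᵥ β) i)

/-- The Hessian `∇²ℓ_n(β) = (1/n) X'Σ(Xβ)X`; it does not depend on the responses. -/
def hess {n p : ℕ} (b : ℝ → ℝ) (X : Matrix (Fin n) (Fin p) ℝ) (β : Fin p → ℝ) :
    Matrix (Fin p) (Fin p) ℝ :=
  (1 / (n : ℝ)) • (Xᵀ * Sig b X β * X)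

theorem hasDerivAt_mulVec_update {n p : ℕ} (X : Matrix (Fin n) (Fin p) ℝ) (β : Fin p → ℝ)
    (j : Fin p) (i : Fin n) :
    HasDerivAt (fun u : ℝ => (X *ᵥ (Function.update β j u)) i) (X i j) (β j) := by
  have h : (fun u : ℝ => (X *ᵥ (Function.update β j u)) i)
      = fun u => (X *ᵥ β) i + X i j * (u - β j) := by
    funext u
    have : Function.update β j u = β + Pi.single j (u - β j) := by
      ext k
      by_cases hk : k = j
      · subst hk; simp
      · simp [hk]
    rw [this, Matrix.mulVec_add]
    simp [Matrix.mulVec_single]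
  rw [h]
  simpa using (((hasDerivAt_id (β j)).sub_const (β j)).const_mul (X i j)).const_add ((X *ᵥ β) i)

/-- `grad` consists of the partial derivatives of `loss`. -/
theorem hasDerivAt_loss {n p : ℕ} {b : ℝ → ℝ} (hb : Differentiable ℝ b)
    (X : Matrix (Fin n) (Fin p) ℝ) (y : Fin n → ℝ) (β : Fin p → ℝ) (j : Fin p) :
    HasDerivAt (fun u : ℝ => loss b X y (Function.update β j u)) (grad b X y β j) (β j) := by
  have key : ∀ i, HasDerivAt (fun u : ℝ => y i * (X *ᵥ (Function.update β j u)) i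
      - b ((X *ᵥ (Function.update β j u)) i))
      (y i * X i j - deriv b ((X *ᵥ β) i) * X i j) (β j) := by
    intro i
    have h1 := hasDerivAt_mulVec_update X β j i
    have h2 : HasDerivAt b (deriv b ((X *ᵥ β) i)) ((X *ᵥ (Function.update β j (β j))) i) := by
      rw [Function.update_eq_self]
      exact (hb _).hasDerivAt
    exact (h1.const_mul (y i)).sub (h2.comp (β j) h1)
  have h3 := (HasDerivAt.fun_sum (u := Finset.univ) fun i _ => key i).const_mul (-(1 / (n : ℝ)))
  refine h3.congr_deriv ?_
  simp only [grad, Pi.smul_apply, smul_eq_mul, Matrix.mulVec, dotProduct, Matrix.transpose_apply]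
  congr 1
  exact Finset.sum_congr rfl fun i _ => by ring

/-- `hess` consists of the partial derivatives of `grad`. -/
theorem hasDerivAt_grad {n p : ℕ} {b : ℝ → ℝ} (hb : Differentiable ℝ (deriv b))
    (X : Matrix (Fin n) (Fin p) ℝ) (y : Fin n → ℝ) (β : Fin p → ℝ) (j k : Fin p) :
    HasDerivAt (fun u : ℝ => grad b X y (Function.update β j u) k) (hess b X β k j) (β j) := by
  have key : ∀ i, HasDerivAt
      (fun u : ℝ => X i k * (y i - deriv b ((X *ᵥ (Function.update β j u)) i)))
      (X i k * (0 - iteratedDeriv 2 b ((X *ᵥ β) i) * X i j)) (β j) := by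
    intro i
    have h1 := hasDerivAt_mulVec_update X β j i
    have h2 : HasDerivAt (deriv b) (iteratedDeriv 2 b ((X *ᵥ β) i))
        ((X *ᵥ (Function.update β j (β j))) i) := by
      rw [Function.update_eq_self, iteratedDeriv_succ, iteratedDeriv_one]
      exact (hb _).hasDerivAt
    exact (((hasDerivAt_const (β j) (y i)).sub (h2.comp (β j) h1))).const_mul (X i k)
  have h3 := (HasDerivAt.fun_sum (u := Finset.univ) fun i _ => key i).const_mul (-(1 / (n : ℝ)))
  refine h3.congr_deriv ?_
  simp only [hess, Sig, Matrix.smul_apply, smul_eq_mul]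
  rw [Matrix.mul_apply]
  simp only [Matrix.mul_diagonal, Matrix.transpose_apply]
  rw [neg_mul, ← mul_neg, ← Finset.sum_neg_distrib]
  congr 1
  exact Finset.sum_congr rfl fun i _ => by ring

/-! ### The folded-concave penalty -/

/-- The derivative `q'(t)` of a penalty for `t > 0`, with `q'(0) := q'(0+) = lim_{t ↓ 0} q'(t)`. -/
def penDeriv (q : ℝ → ℝ) (t : ℝ) : ℝ :=
  if t = 0 then limUnder (𝓝[>] (0 : ℝ)) (deriv q) else deriv q t

/-- `q = p_lam` is a folded-concave penalty with constants `a`, `a₁`, `a₂`. -/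
structure IsFoldedConcave (q : ℝ → ℝ) (lam a a₁ a₂ : ℝ) : Prop where
  monotone : MonotoneOn q (Set.Ici 0)
  concave : ConcaveOn ℝ (Set.Ici 0) q
  zero : q 0 = 0
  differentiable : ∀ t, 0 < t → DifferentiableAt ℝ q t
  /-- `q'(0+)` exists as a real number -/
  deriv_zero_exists : ∃ L : ℝ, Tendsto (deriv q) (𝓝[>] (0 : ℝ)) (𝓝 L)
  deriv_zero : a₁ * lam ≤ penDeriv q 0
  deriv_small : ∀ t, 0 < t → t ≤ a₂ * lam → a₁ * lam ≤ penDeriv q t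
  deriv_large : ∀ t, a * lam ≤ t → penDeriv q t = 0

/-! ### The deterministic part of the `n`-th experiment -/

/-- Design, true coefficients, tested coordinates `M`, and constraint `C β_M = t` for sample
size `n`. -/
structure Model (n : ℕ) where
  /-- number of coefficients -/
  p : ℕ
  /-- the (fixed) design matrix -/
  X : Matrix (Fin n) (Fin p) ℝ
  /-- the true coefficient vector `β*` -/
  beta : Fin p → ℝ
  /-- the indices of the coefficients under test -/
  M : Finset (Fin p)
  /-- number of constraints -/
  r : ℕ
  C : Matrix (Fin r) {j // j ∈ M} ℝ
  t : Fin r → ℝ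

namespace Model

variable {n : ℕ} (D : Model n)

/-- The support `A` of `β*`. -/
def A : Finset (Fin D.p) := Finset.univ.filter fun j => D.beta j ≠ 0

/-- `S = A \ M`. -/
def S : Finset (Fin D.p) := D.A \ D.M

/-- `M ∪ S`. -/
def MS : Finset (Fin D.p) := D.M ∪ D.S

/-- `m = |M|`. -/
def m : ℕ := D.M.card

/-- `s = |S|`. -/
def s : ℕ := D.S.card

/-- The number `|A|` of nonzero true coefficients. -/
def suppSize : ℕ := D.A.card

/-- The subvector `β_M`. -/
def subM (β : Fin D.p → ℝ) : {j // j ∈ D.M} → ℝ := fun j => β j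

/-- The subvector `β_{M ∪ S}`. -/
def subMS (β : Fin D.p → ℝ) : {j // j ∈ D.MS} → ℝ := fun j => β j

/-- The submatrix `X_{M ∪ S}` of columns. -/
def XMS : Matrix (Fin n) {j // j ∈ D.MS} ℝ := D.X.submatrix id Subtype.val

/-- `h_n = C β*_M - t`. -/
def h : Fin D.r → ℝ := D.C *ᵥ D.subM D.beta - D.t

/-- The block matrix `[C 0]`, with columns indexed by `M ∪ S`. -/
def C0 : Matrix (Fin D.r) {j // j ∈ D.MS} ℝ :=
  Matrix.of fun i j => if hj : (j : Fin D.p) ∈ D.M then D.C i ⟨j, hj⟩ else 0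

/-- `K_n = ∇²_{M ∪ S} ℓ_n(β*)`. -/
def K (b : ℝ → ℝ) : Matrix {j // j ∈ D.MS} {j // j ∈ D.MS} ℝ :=
  (hess b D.X D.beta).submatrix Subtype.val Subtype.val

/-- `Ψ = [C 0] K_n⁻¹ [C 0]'`. -/
def Psi (b : ℝ → ℝ) : Matrix (Fin D.r) (Fin D.r) ℝ := D.C0 * (D.K b)⁻¹ * D.C0ᵀ

/-- `P_n = K_n^{-1/2} [C 0]' Ψ⁻¹ [C 0] K_n^{-1/2}`. -/
def Pn (b : ℝ → ℝ) : Matrix {j // j ∈ D.MS} {j // j ∈ D.MS} ℝ :=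
  invSqrtMat (D.K b) * D.C0ᵀ * (D.Psi b)⁻¹ * D.C0 * invSqrtMat (D.K b)

/-- The neighbourhood of `β*` of radius `√((s + m) log n / n)` among the vectors supported on
`M ∪ S`. -/
def N0 : Set (Fin D.p → ℝ) :=
  {β | l2norm (D.subMS β - D.subMS D.beta) ≤ √(((D.s : ℝ) + D.m) * Real.log n / n) ∧
    ∀ j, j ∉ D.MS → β j = 0}

/-! #### Estimators -/

/-- The vectors satisfying the constraint `C β_M = t`. -/
def constrained : Set (Fin D.p → ℝ) := {β | D.C *ᵥ D.subM β = D.t}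

/-- The vectors vanishing off `M ∪ A = M ∪ S`. -/
def oracleSet : Set (Fin D.p → ℝ) := {β | ∀ j, j ∉ D.MS → β j = 0}

/-- The reduced oracle estimator is the unique solution of its problem and satisfies the
stationarity condition `∇_{M ∪ S} ℓ_n = [C'ν; 0]` for some `ν`. -/
def ReducedOracle (b : ℝ → ℝ) (y : Fin n → ℝ) : Prop :=
  ∃ β, IsUniqueArgmin (loss b D.X y) (D.oracleSet ∩ D.constrained) β ∧
    ∃ ν : Fin D.r → ℝ, D.subMS (grad b D.X y β) = D.C0ᵀ *ᵥ ν

/-- The full oracle estimator is the unique solution of its problem and satisfies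
`∇_{M ∪ S} ℓ_n = 0`. -/
def FullOracle (b : ℝ → ℝ) (y : Fin n → ℝ) : Prop :=
  ∃ β, IsUniqueArgmin (loss b D.X y) D.oracleSet β ∧ D.subMS (grad b D.X y β) = 0

/-- The lasso objective `ℓ_n(β) + lamL ‖β‖₁`. -/
def lassoObj (b : ℝ → ℝ) (lamL : ℝ) (y : Fin n → ℝ) (β : Fin D.p → ℝ) : ℝ :=
  loss b D.X y β + lamL * ∑ j, |β j|

/-- The local linear approximation objective `ℓ_n(β) + ∑_{j ∉ M} q'(|β⁰_j|) |β_j|` at the current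
iterate `β⁰`, for the penalty `q`. -/
def llaObj (b : ℝ → ℝ) (q : ℝ → ℝ) (y : Fin n → ℝ) (β0 β : Fin D.p → ℝ) : ℝ :=
  loss b D.X y β + ∑ j ∈ D.Mᶜ, penDeriv q |β0 j| * |β j|

/-- `β2` is a two-step local linear approximation solution with initial value `β0`, where each
step minimises over `F` the objective at the preceding iterate. -/
def IsTwoStepLLA (b : ℝ → ℝ) (q : ℝ → ℝ) (y : Fin n → ℝ) (F : Set (Fin D.p → ℝ))
    (β0 β2 : Fin D.p → ℝ) : Prop :=
  ∃ β1 : Fin D.p → ℝ, IsComputedArgmin (D.llaObj b q y β0) F β1 ∧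
    IsComputedArgmin (D.llaObj b q y β1) F β2

/-! #### Conditions on the experiment -/

/-- Eigenvalue and norm conditions on the design, with lower constant `c` and upper
constant `K`. -/
structure DesignEig (b : ℝ → ℝ) (c K : ℝ) : Prop where
  min_hess : ∀ β ∈ D.N0, EigGE (D.XMSᵀ * Sig b D.X β * D.XMS) (c * n)
  third : ∀ β ∈ D.N0, ∀ j : Fin D.p,
    EigLE (D.XMSᵀ * Matrix.diagonal
      (fun i => |D.X i j| * |iteratedDeriv 3 b ((D.X *ᵥ β) i)|) * D.XMS) (K * n)
  max_hess : EigLE (D.XMSᵀ * Sig b D.X D.beta * D.XMS) (K * n)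
  /-- the matrix norm `max_j ∑_k |a_{jk}|` of `X_{(M ∪ S)ᶜ}' Σ(Xβ*) X_{M ∪ S}` is at most `K n` -/
  cross : ∀ j, j ∉ D.MS → ∑ k ∈ D.MS, |(D.Xᵀ * Sig b D.X D.beta * D.X) j k| ≤ K * n

/-- `‖X_j‖₂² ≤ B₁ n` and `‖X_j‖_∞ ≤ B₂ √(n / log p)` for every column `X_j`. -/
def DesignColumns (B₁ B₂ : ℝ) : Prop :=
  ∀ j, ∑ i, D.X i j ^ 2 ≤ B₁ * n ∧ ∀ i, |D.X i j| ≤ B₂ * √(n / Real.log D.p)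

/-- Restricted eigenvalue condition with constant `κ`:
`u' ∇²ℓ_n(β*) u ≥ κ u'u` for all `u` in the cone `‖u_{Aᶜ}‖₁ ≤ 3 ‖u_A‖₁`. -/
def RestrictedEig (b : ℝ → ℝ) (κ : ℝ) : Prop :=
  ∀ u : Fin D.p → ℝ, u ≠ 0 → ∑ j ∈ D.Aᶜ, |u j| ≤ 3 * ∑ j ∈ D.A, |u j| →
    κ * (u ⬝ᵥ u) ≤ u ⬝ᵥ (hess b D.X D.beta *ᵥ u)

end Model

end PPGLM

end

/-! The core claim is deterministic: on an event of probability tending to one, the two-step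
estimator equals the oracle estimator, so its rate, support and expansion are those of the oracle.
The lasso is within `min 1 a₂ * lam` of `β*` in every coordinate. By the signal condition the
penalty weights therefore vanish on `S`, while off `M ∪ S` they are at least `a₁ * lam`. The oracle
satisfies the Lagrange condition on `M ∪ S`, and off this set its gradient is below `a₁ * lam`.
Convexity then makes it the only minimiser of the weighted problem, and the same argument started
from the oracle shows that it is a fixed point (`lla_step`, `lla_two_step`).

The oracle is compared with the feasible point `β* + shift`. Differences of feasible points lie in
the kernel of `[C 0]`, of dimension `s + m - r`, and only the projection of the score to this kernel
matters. Since the variance of a response is `φ b''`, that projection has second moment `O((s + m -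
r) / n)`, and strong convexity of the loss on `N0` turns this into the rate
(`exists_projection_bound`, `l2norm_le_of_loss_le`, `oracle_near`). Expanding the oracle's gradient
at `β*` gives a perturbed linear Lagrange system whose unperturbed solution is the stated leading
term. The perturbation, multiplied by `√n`, is of order `√((s + m)³ / n)` (`l2norm_sub_leading_le`,
`expansion_of_nearOracle`).

Two probabilistic inputs remain: uniform bounds on the score, from Bernstein's inequality and a
union bound, and the lasso error, from the restricted eigenvalue and self-concordance
(`lasso_bound`). Smoothness of `b` and the moments of the responses come from identifying `b` with a
cumulant generating function. The full model is the case of no constraints, `r = 0`, so each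
argument is given once. -/

namespace PPGLM

/-! ### The exponential family: smoothness of `b`, mean and variance. -/

namespace IsExpFamily

variable {b : ℝ → ℝ} {φ : ℝ} {ν : Measure ℝ} {c : ℝ → ℝ}

/-- The exponential family consists of exponential tilts of its member at zero. -/
theorem expLaw_eq_withDensity (h : IsExpFamily b φ ν c) (θ : ℝ) :
    expLaw b φ ν c θ = (expLaw b φ ν c 0).withDensity
      fun y => ENNReal.ofReal (Real.exp (θ / φ * y - (b θ - b 0) / φ)) := by
  have hm0 : Measurable fun y => ENNReal.ofReal (Real.exp ((y * 0 - b 0) / φ) * c y) := by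
    have := h.measurable_c
    fun_prop
  have hm1 : Measurable fun y => ENNReal.ofReal (Real.exp (θ / φ * y - (b θ - b 0) / φ)) := by
    fun_prop
  rw [expLaw, expLaw, ← withDensity_mul _ hm0 hm1]
  congr 1
  funext y
  simp only [Pi.mul_apply]
  rw [← ENNReal.ofReal_mul (mul_nonneg (Real.exp_pos _).le (h.c_nonneg y)), mul_right_comm,
    ← Real.exp_add]
  congr 3
  ring_nf

/-- Total mass one of the tilted law at `θ`, multiplied through by its normalising constant. -/
theorem lintegral_exp (h : IsExpFamily b φ ν c) (θ : ℝ) :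
    ∫⁻ y, ENNReal.ofReal (Real.exp (θ / φ * y)) ∂(expLaw b φ ν c 0)
      = ENNReal.ofReal (Real.exp ((b θ - b 0) / φ)) := by
  have h1 := (h.isProb θ).measure_univ
  rw [h.expLaw_eq_withDensity θ, withDensity_apply _ MeasurableSet.univ,
    Measure.restrict_univ] at h1
  have h2 : ∀ y, ENNReal.ofReal (Real.exp (θ / φ * y))
      = ENNReal.ofReal (Real.exp ((b θ - b 0) / φ))
        * ENNReal.ofReal (Real.exp (θ / φ * y - (b θ - b 0) / φ)) := fun y => by
    rw [← ENNReal.ofReal_mul (Real.exp_pos _).le, ← Real.exp_add]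
    ring_nf
  simp_rw [h2]
  rw [lintegral_const_mul _ (by fun_prop), h1, mul_one]

theorem integrable_exp (h : IsExpFamily b φ ν c) (t : ℝ) :
    Integrable (fun y => Real.exp (t * id y)) (expLaw b φ ν c 0) := by
  refine ⟨by fun_prop, ?_⟩
  rw [hasFiniteIntegral_iff_ofReal (ae_of_all _ fun y => (Real.exp_pos _).le)]
  have := h.lintegral_exp (t * φ)
  rw [mul_div_assoc, div_self h.phi_pos.ne', mul_one] at this
  simp only [id]
  rw [this]
  exact ENNReal.ofReal_lt_top

theorem interior_integrableExpSet (h : IsExpFamily b φ ν c) :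
    interior (integrableExpSet id (expLaw b φ ν c 0)) = Set.univ := by
  have : integrableExpSet id (expLaw b φ ν c 0) = Set.univ :=
    Set.eq_univ_of_forall fun t => h.integrable_exp t
  rw [this, interior_univ]

theorem mgf_expLaw (h : IsExpFamily b φ ν c) (θ : ℝ) :
    mgf id (expLaw b φ ν c 0) (θ / φ) = Real.exp ((b θ - b 0) / φ) := by
  rw [mgf, integral_eq_lintegral_of_nonneg_ae (ae_of_all _ fun y => (Real.exp_pos _).le)
    (by fun_prop)]
  simp only [id]
  rw [h.lintegral_exp, ENNReal.toReal_ofReal (Real.exp_pos _).le]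

/-- No regularity of `b` is assumed. Because densities exist for every real `θ`, all exponential
moments of the law at zero are finite, so its cumulant generating function is analytic on the whole
line and `b` inherits this. -/
theorem eq_cgf (h : IsExpFamily b φ ν c) :
    b = fun θ => b 0 + φ * cgf id (expLaw b φ ν c 0) (θ / φ) := by
  funext θ
  rw [cgf, h.mgf_expLaw, Real.log_exp]
  field_simp [h.phi_pos.ne']
  ring

theorem expLaw_eq_tilted (h : IsExpFamily b φ ν c) (θ : ℝ) :
    expLaw b φ ν c θ = (expLaw b φ ν c 0).tilted fun y => θ / φ * id y := by
  have h1 : ∫ y, Real.exp (θ / φ * id y) ∂(expLaw b φ ν c 0) = Real.exp ((b θ - b 0) / φ) :=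
    h.mgf_expLaw θ
  rw [Measure.tilted, h1, h.expLaw_eq_withDensity θ]
  simp only [Real.exp_sub, id]

theorem contDiff_cgf (h : IsExpFamily b φ ν c) {k : WithTop ℕ∞} :
    ContDiff ℝ k (cgf id (expLaw b φ ν c 0)) := by
  have := (analyticOn_cgf (X := id) (μ := expLaw b φ ν c 0)).contDiffOn (n := k)
    isOpen_interior.uniqueDiffOn
  rw [h.interior_integrableExpSet] at this
  exact contDiffOn_univ.1 this

theorem contDiff (h : IsExpFamily b φ ν c) {k : WithTop ℕ∞} : ContDiff ℝ k b := by
  rw [h.eq_cgf]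
  exact contDiff_const.add (contDiff_const.mul (h.contDiff_cgf.comp (contDiff_id.div_const _)))

theorem deriv_eq (h : IsExpFamily b φ ν c) :
    deriv b = fun θ => deriv (cgf id (expLaw b φ ν c 0)) (θ / φ) := by
  funext θ
  have hd : HasDerivAt (cgf id (expLaw b φ ν c 0))
      (deriv (cgf id (expLaw b φ ν c 0)) (θ / φ)) (θ / φ) :=
    ((h.contDiff_cgf (k := 1)).differentiable one_ne_zero _).hasDerivAt
  have h1 := ((hd.comp θ ((hasDerivAt_id θ).div_const φ)).const_mul φ).const_add (b 0)
  have h2 : deriv (fun θ => b 0 + φ * cgf id (expLaw b φ ν c 0) (θ / φ)) θ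
      = φ * (deriv (cgf id (expLaw b φ ν c 0)) (θ / φ) * (1 / φ)) := h1.deriv
  rw [← h.eq_cgf] at h2
  rw [h2]
  field_simp [h.phi_pos.ne']

theorem iteratedDeriv_two_eq (h : IsExpFamily b φ ν c) (θ : ℝ) :
    φ * iteratedDeriv 2 b θ = iteratedDeriv 2 (cgf id (expLaw b φ ν c 0)) (θ / φ) := by
  have hd : HasDerivAt (deriv (cgf id (expLaw b φ ν c 0)))
      (iteratedDeriv 2 (cgf id (expLaw b φ ν c 0)) (θ / φ)) (θ / φ) := by
    rw [iteratedDeriv_succ, iteratedDeriv_one]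
    have h2 : ContDiff ℝ 1 (deriv (cgf id (expLaw b φ ν c 0))) :=
      ((contDiff_succ_iff_deriv (n := 1)).1 (h.contDiff_cgf)).2.2
    exact (h2.differentiable one_ne_zero _).hasDerivAt
  have h1 := (hd.comp θ ((hasDerivAt_id θ).div_const φ)).deriv
  rw [iteratedDeriv_succ, iteratedDeriv_one, h.deriv_eq]
  simp only [Function.comp_def, id] at h1
  rw [h1]
  field_simp [h.phi_pos.ne']

theorem integral_id (h : IsExpFamily b φ ν c) (θ : ℝ) :
    ∫ y, y ∂(expLaw b φ ν c θ) = deriv b θ := by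
  have := integral_tilted_mul_self (X := id) (μ := expLaw b φ ν c 0) (t := θ / φ)
    (by rw [h.interior_integrableExpSet]; trivial)
  rw [← h.expLaw_eq_tilted] at this
  rw [h.deriv_eq]
  exact this

theorem variance_id (h : IsExpFamily b φ ν c) (θ : ℝ) :
    variance id (expLaw b φ ν c θ) = φ * iteratedDeriv 2 b θ := by
  have := variance_tilted_mul (X := id) (μ := expLaw b φ ν c 0) (t := θ / φ)
    (by rw [h.interior_integrableExpSet]; trivial)
  rw [← h.expLaw_eq_tilted] at this
  rw [this, h.iteratedDeriv_two_eq]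

theorem memLp_id (h : IsExpFamily b φ ν c) (θ : ℝ) : MemLp id 2 (expLaw b φ ν c θ) := by
  have := memLp_tilted_mul (X := id) (μ := expLaw b φ ν c 0) (t := θ / φ)
    (by rw [h.interior_integrableExpSet]; trivial) 2
  rw [← h.expLaw_eq_tilted] at this
  exact_mod_cast this

end IsExpFamily

/-! ### Taylor bounds along lines -/

/-- The constant is the integral of `(1 - t) (k₀ - k₁ t)` over `[0, 1]`. The case `k₁ = 0` serves
strong convexity, and `k₁ = k₀` serves a curvature that may decay linearly along the segment, as
under self-concordance. -/
theorem taylor_lower {f f' f'' : ℝ → ℝ} (hf : ∀ t, HasDerivAt f (f' t) t)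
    (hf' : ∀ t, HasDerivAt f' (f'' t) t) {k₀ k₁ : ℝ}
    (h : ∀ t, 0 ≤ t → t ≤ 1 → k₀ - k₁ * t ≤ f'' t) :
    f 0 + f' 0 + (k₀ / 2 - k₁ / 6) ≤ f 1 := by
  have hg' : ∀ t, HasDerivAt (fun t => f' t - f' 0 - (k₀ * t - k₁ / 2 * t ^ 2))
      (f'' t - (k₀ - k₁ * t)) t := fun t => by
    have h1 := ((hasDerivAt_id t).const_mul k₀).sub ((hasDerivAt_pow 2 t).const_mul (k₁ / 2))
    exact (((hf' t).sub_const (f' 0)).sub h1).congr_deriv (by simp; ring)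
  have hg : ∀ t, HasDerivAt (fun t => f t - f' 0 * t - (k₀ / 2 * t ^ 2 - k₁ / 6 * t ^ 3))
      (f' t - f' 0 - (k₀ * t - k₁ / 2 * t ^ 2)) t := fun t => by
    have h1 := ((hasDerivAt_pow 2 t).const_mul (k₀ / 2)).sub
      ((hasDerivAt_pow 3 t).const_mul (k₁ / 6))
    exact (((hf t).sub ((hasDerivAt_id t).const_mul (f' 0))).sub h1).congr_deriv
      (by simp; ring)
  have m1 : MonotoneOn (fun t => f' t - f' 0 - (k₀ * t - k₁ / 2 * t ^ 2)) (Set.Icc 0 1) := by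
    refine monotoneOn_of_deriv_nonneg (convex_Icc 0 1)
      (fun t _ => (hg' t).continuousAt.continuousWithinAt)
      (fun t _ => (hg' t).differentiableAt.differentiableWithinAt) fun t ht => ?_
    rw [interior_Icc] at ht
    rw [(hg' t).deriv]
    linarith [h t ht.1.le ht.2.le]
  have m2 : MonotoneOn (fun t => f t - f' 0 * t - (k₀ / 2 * t ^ 2 - k₁ / 6 * t ^ 3))
      (Set.Icc 0 1) := by
    refine monotoneOn_of_deriv_nonneg (convex_Icc 0 1)
      (fun t _ => (hg t).continuousAt.continuousWithinAt)
      (fun t _ => (hg t).differentiableAt.differentiableWithinAt) fun t ht => ?_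
    rw [interior_Icc] at ht
    rw [(hg t).deriv]
    have := m1 (Set.left_mem_Icc.2 zero_le_one) ⟨ht.1.le, ht.2.le⟩ ht.1.le
    simp only [mul_zero] at this
    linarith
  have := m2 (Set.left_mem_Icc.2 zero_le_one) (Set.right_mem_Icc.2 zero_le_one) zero_le_one
  simp only [mul_zero] at this
  norm_num at this
  linarith

theorem taylor_abs {f f' f'' : ℝ → ℝ} (hf : ∀ t, HasDerivAt f (f' t) t)
    (hf' : ∀ t, HasDerivAt f' (f'' t) t) {k : ℝ} (h : ∀ t, 0 ≤ t → t ≤ 1 → |f'' t| ≤ k) :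
    |f 1 - f 0 - f' 0| ≤ k / 2 := by
  have h1 := taylor_lower hf hf' (k₀ := -k) (k₁ := 0)
    fun t h0 h1 => by linarith [neg_le_of_abs_le (h t h0 h1)]
  have h2 := taylor_lower (fun t => (hf t).neg) (fun t => (hf' t).neg) (k₀ := -k) (k₁ := 0)
    fun t h0 h1 => by linarith [le_of_abs_le (h t h0 h1)]
  simp only [Pi.neg_apply] at h2
  rw [abs_le]
  constructor <;> linarith

/-! ### The loss along a line -/

section Line

variable {n p : ℕ} {b : ℝ → ℝ} (X : Matrix (Fin n) (Fin p) ℝ) (y : Fin n → ℝ)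
  (β v : Fin p → ℝ)

theorem mulVec_line (t : ℝ) (i : Fin n) :
    (X *ᵥ (β + t • v)) i = (X *ᵥ β) i + t * (X *ᵥ v) i := by
  simp [Matrix.mulVec_add, Matrix.mulVec_smul]

theorem hasDerivAt_comp_line {g : ℝ → ℝ} (hg : Differentiable ℝ g) (i : Fin n) (t : ℝ) :
    HasDerivAt (fun t : ℝ => g ((X *ᵥ (β + t • v)) i))
      (deriv g ((X *ᵥ (β + t • v)) i) * (X *ᵥ v) i) t := by
  simp only [mulVec_line]
  have h1 : HasDerivAt (fun t : ℝ => (X *ᵥ β) i + t * (X *ᵥ v) i) ((X *ᵥ v) i) t := by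
    simpa using ((hasDerivAt_id t).mul_const ((X *ᵥ v) i)).const_add ((X *ᵥ β) i)
  exact (hg _).hasDerivAt.comp t h1

theorem grad_apply (j : Fin p) :
    grad b X y β j = -(1 / (n : ℝ)) * ∑ i, X i j * (y i - deriv b ((X *ᵥ β) i)) := by
  simp [grad, Matrix.mulVec, dotProduct]

theorem grad_dotProduct :
    grad b X y β ⬝ᵥ v
      = -(1 / (n : ℝ)) * ∑ i, (X *ᵥ v) i * (y i - deriv b ((X *ᵥ β) i)) := by
  rw [grad, smul_dotProduct, smul_eq_mul, Matrix.mulVec_transpose, ← Matrix.dotProduct_mulVec,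
    dotProduct]
  simp_rw [mul_comm]

theorem hess_mulVec_apply (j : Fin p) :
    (hess b X β *ᵥ v) j
      = 1 / (n : ℝ) * ∑ i, X i j * (iteratedDeriv 2 b ((X *ᵥ β) i) * (X *ᵥ v) i) := by
  rw [hess, Matrix.smul_mulVec, ← Matrix.mulVec_mulVec, ← Matrix.mulVec_mulVec, Pi.smul_apply,
    smul_eq_mul]
  congr 1
  rw [Matrix.mulVec, dotProduct]
  exact Finset.sum_congr rfl fun i _ => by rw [Sig, Matrix.mulVec_diagonal, Matrix.transpose_apply]

theorem dotProduct_hess_mulVec :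
    v ⬝ᵥ (hess b X β *ᵥ v)
      = 1 / (n : ℝ) * ∑ i, iteratedDeriv 2 b ((X *ᵥ β) i) * (X *ᵥ v) i ^ 2 := by
  rw [hess, Matrix.smul_mulVec, ← Matrix.mulVec_mulVec, ← Matrix.mulVec_mulVec, dotProduct_smul,
    smul_eq_mul, Matrix.dotProduct_mulVec, Matrix.vecMul_transpose, Sig]
  congr 1
  rw [dotProduct]
  refine Finset.sum_congr rfl fun i _ => ?_
  rw [Matrix.mulVec_diagonal]
  ring

variable (hb : ContDiff ℝ 3 b)
include hb

theorem hasDerivAt_loss_line (t : ℝ) :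
    HasDerivAt (fun t : ℝ => loss b X y (β + t • v)) (grad b X y (β + t • v) ⬝ᵥ v) t := by
  have hd : Differentiable ℝ b := hb.differentiable (by norm_num)
  have key : ∀ i, HasDerivAt (fun t : ℝ => y i * (X *ᵥ (β + t • v)) i
      - b ((X *ᵥ (β + t • v)) i))
      ((X *ᵥ v) i * (y i - deriv b ((X *ᵥ (β + t • v)) i))) t := fun i => by
    have h1 := hasDerivAt_comp_line X β v hd i t
    have h2 := (hasDerivAt_comp_line X β v differentiable_id i t).const_mul (y i)
    refine (h2.sub h1).congr_deriv ?_
    rw [deriv_id]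
    ring
  rw [grad_dotProduct]
  exact (HasDerivAt.fun_sum (u := Finset.univ) fun i _ => key i).const_mul (-(1 / (n : ℝ)))

theorem differentiable_deriv : Differentiable ℝ (deriv b) := by
  have : ContDiff ℝ 2 (deriv b) := ((contDiff_succ_iff_deriv (n := 2)).1 (by exact_mod_cast hb)).2.2
  exact this.differentiable (by norm_num)

theorem differentiable_iteratedDeriv_two : Differentiable ℝ (iteratedDeriv 2 b) :=
  hb.differentiable_iteratedDeriv 2 (by norm_num)

theorem hasDerivAt_grad_line (j : Fin p) (t : ℝ) :
    HasDerivAt (fun t : ℝ => grad b X y (β + t • v) j) ((hess b X (β + t • v) *ᵥ v) j) t := by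
  have key : ∀ i, HasDerivAt
      (fun t : ℝ => X i j * (y i - deriv b ((X *ᵥ (β + t • v)) i)))
      (-(X i j * (iteratedDeriv 2 b ((X *ᵥ (β + t • v)) i) * (X *ᵥ v) i))) t := fun i => by
    have h1 := hasDerivAt_comp_line X β v (differentiable_deriv hb) i t
    refine ((h1.const_sub (y i)).const_mul (X i j)).congr_deriv ?_
    rw [iteratedDeriv_succ, iteratedDeriv_one]
    ring
  simp only [grad_apply, hess_mulVec_apply]
  refine ((HasDerivAt.fun_sum (u := Finset.univ) fun i _ => key i).const_mul
    (-(1 / (n : ℝ)))).congr_deriv ?_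
  rw [Finset.sum_neg_distrib]
  ring

theorem hasDerivAt_grad_line_dotProduct (t : ℝ) :
    HasDerivAt (fun t : ℝ => grad b X y (β + t • v) ⬝ᵥ v)
      (v ⬝ᵥ (hess b X (β + t • v) *ᵥ v)) t := by
  refine (HasDerivAt.fun_sum (u := Finset.univ) fun j _ =>
    (hasDerivAt_grad_line X y β v hb j t).mul_const (v j)).congr_deriv ?_
  simp [dotProduct, mul_comm]

theorem hasDerivAt_hess_line (j : Fin p) (t : ℝ) :
    HasDerivAt (fun t : ℝ => (hess b X (β + t • v) *ᵥ v) j)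
      (1 / (n : ℝ) * ∑ i, X i j * (iteratedDeriv 3 b ((X *ᵥ (β + t • v)) i) * (X *ᵥ v) i ^ 2))
      t := by
  have key : ∀ i, HasDerivAt
      (fun t : ℝ => X i j * (iteratedDeriv 2 b ((X *ᵥ (β + t • v)) i) * (X *ᵥ v) i))
      (X i j * (iteratedDeriv 3 b ((X *ᵥ (β + t • v)) i) * (X *ᵥ v) i ^ 2)) t := fun i => by
    have h1 := hasDerivAt_comp_line X β v (differentiable_iteratedDeriv_two hb) i t
    refine ((h1.mul_const _).const_mul (X i j)).congr_deriv ?_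
    rw [← iteratedDeriv_succ]
    ring
  simp only [hess_mulVec_apply]
  exact (HasDerivAt.fun_sum (u := Finset.univ) fun i _ => key i).const_mul (1 / (n : ℝ))

/-- Second order lower bound for the loss. -/
theorem loss_lower {k₀ k₁ : ℝ}
    (h : ∀ t : ℝ, 0 ≤ t → t ≤ 1 → k₀ - k₁ * t ≤ v ⬝ᵥ (hess b X (β + t • v) *ᵥ v)) :
    loss b X y β + grad b X y β ⬝ᵥ v + (k₀ / 2 - k₁ / 6) ≤ loss b X y (β + v) := by
  have := taylor_lower (hasDerivAt_loss_line X y β v hb)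
    (hasDerivAt_grad_line_dotProduct X y β v hb) h
  simpa using this

theorem loss_gradient_ineq (hb2 : ∀ x, 0 ≤ iteratedDeriv 2 b x) :
    loss b X y β + grad b X y β ⬝ᵥ v ≤ loss b X y (β + v) := by
  have := loss_lower X y β v hb (k₀ := 0) (k₁ := 0) fun t _ _ => by
    rw [dotProduct_hess_mulVec]
    simp only [zero_mul, sub_zero]
    exact mul_nonneg (by positivity) (Finset.sum_nonneg fun i _ => mul_nonneg (hb2 _) (sq_nonneg _))
  linarith

/-- First order expansion of the gradient. -/
theorem grad_taylor (j : Fin p) {k : ℝ}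
    (h : ∀ t : ℝ, 0 ≤ t → t ≤ 1 →
      1 / (n : ℝ) * ∑ i, |X i j| * |iteratedDeriv 3 b ((X *ᵥ (β + t • v)) i)| * (X *ᵥ v) i ^ 2
        ≤ k) :
    |grad b X y (β + v) j - grad b X y β j - (hess b X β *ᵥ v) j| ≤ k / 2 := by
  have := taylor_abs (hasDerivAt_grad_line X y β v hb j) (hasDerivAt_hess_line X β v hb j)
    (k := k) fun t h0 h1 => by
      refine le_trans ?_ (h t h0 h1)
      rw [abs_mul, abs_of_nonneg (by positivity : (0 : ℝ) ≤ 1 / n)]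
      refine mul_le_mul_of_nonneg_left ((Finset.abs_sum_le_sum_abs _ _).trans
        (Finset.sum_le_sum fun i _ => ?_)) (by positivity)
      rw [abs_mul, abs_mul, abs_of_nonneg (sq_nonneg ((X *ᵥ v) i)), mul_assoc]
  simpa using this

/-- The tangent inequality at the intermediate point is applied towards both endpoints; the weighted
gradient terms cancel. -/
theorem convexOn_loss (hb2 : ∀ x, 0 ≤ iteratedDeriv 2 b x) :
    ConvexOn ℝ Set.univ (loss b X y) := by
  refine ⟨convex_univ, fun β₁ _ β₂ _ s t hs ht hst => ?_⟩
  set β₀ := s • β₁ + t • β₂ with hβ₀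
  have h1 := loss_gradient_ineq X y β₀ (β₁ - β₀) hb hb2
  have h2 := loss_gradient_ineq X y β₀ (β₂ - β₀) hb hb2
  rw [add_sub_cancel] at h1 h2
  have h3 : s * (grad b X y β₀ ⬝ᵥ (β₁ - β₀)) + t * (grad b X y β₀ ⬝ᵥ (β₂ - β₀)) = 0 := by
    rw [← smul_eq_mul, ← smul_eq_mul, ← dotProduct_smul, ← dotProduct_smul, ← dotProduct_add]
    have : s • (β₁ - β₀) + t • (β₂ - β₀) = β₀ - (s + t) • β₀ := by
      rw [hβ₀]; module
    rw [this, hst, one_smul, sub_self, dotProduct_zero]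
  have h4 : loss b X y β₀ = s * loss b X y β₀ + t * loss b X y β₀ := by
    rw [← add_mul, hst, one_mul]
  simp only [smul_eq_mul]
  nlinarith [mul_le_mul_of_nonneg_left h1 hs, mul_le_mul_of_nonneg_left h2 ht]

end Line

/-! ### Euclidean norm and quadratic forms -/

section Forms

variable {ι : Type*} [Fintype ι]

theorem l2norm_nonneg (v : ι → ℝ) : 0 ≤ l2norm v := norm_nonneg _

theorem l2norm_sq (v : ι → ℝ) : l2norm v ^ 2 = v ⬝ᵥ v := by
  rw [l2norm, EuclideanSpace.norm_sq_eq, dotProduct]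
  simp [sq]

theorem l2norm_sq_sum (v : ι → ℝ) : l2norm v ^ 2 = ∑ i, v i ^ 2 := by
  rw [l2norm_sq, dotProduct]
  simp [sq]

@[simp] theorem l2norm_zero : l2norm (0 : ι → ℝ) = 0 := by simp [l2norm]

theorem l2norm_add_le (v w : ι → ℝ) : l2norm (v + w) ≤ l2norm v + l2norm w :=
  norm_add_le (WithLp.toLp 2 v) (WithLp.toLp 2 w)

theorem l2norm_neg (v : ι → ℝ) : l2norm (-v) = l2norm v := norm_neg (WithLp.toLp 2 v)

theorem l2norm_smul (t : ℝ) (v : ι → ℝ) : l2norm (t • v) = |t| * l2norm v :=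
  norm_smul t (WithLp.toLp 2 v)

theorem l2norm_eq_zero {v : ι → ℝ} : l2norm v = 0 ↔ v = 0 := by
  simp [l2norm]

theorem abs_le_l2norm (v : ι → ℝ) (i : ι) : |v i| ≤ l2norm v := by
  refine abs_le_of_sq_le_sq ?_ (l2norm_nonneg v)
  rw [l2norm_sq_sum]
  exact Finset.single_le_sum (f := fun i => v i ^ 2) (fun i _ => sq_nonneg _) (Finset.mem_univ i)

theorem abs_dotProduct_le (v w : ι → ℝ) : |v ⬝ᵥ w| ≤ l2norm v * l2norm w := by
  have := abs_real_inner_le_norm (WithLp.toLp 2 w) (WithLp.toLp 2 v)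
  rw [EuclideanSpace.inner_eq_star_dotProduct] at this
  simpa [l2norm, mul_comm] using this

theorem l2norm_le_of_abs_le {v : ι → ℝ} {k : ℝ} (h : ∀ i, |v i| ≤ k) :
    l2norm v ≤ √(Fintype.card ι) * k := by
  rcases isEmpty_or_nonempty ι with hι | ⟨⟨i₀⟩⟩
  · have : v = 0 := Subsingleton.elim _ _
    simp [this]
  have hk : 0 ≤ k := (abs_nonneg _).trans (h i₀)
  refine abs_le_of_sq_le_sq' ?_ (by positivity) |>.2
  rw [l2norm_sq_sum, mul_pow, Real.sq_sqrt (by positivity)]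
  refine (Finset.sum_le_sum fun i _ => (sq_le_sq' (neg_le_of_abs_le (h i))
    (le_of_abs_le (h i)))).trans ?_
  simp

variable [DecidableEq ι]

/-- The spectrum of `K • 1 - A` is `K` minus the spectrum of `A`, hence nonnegative, so this
Hermitian matrix is positive semidefinite. -/
theorem EigLE.dotProduct_le {A : Matrix ι ι ℝ} {K : ℝ} (h : EigLE A K) (hA : A.IsHermitian)
    (v : ι → ℝ) : v ⬝ᵥ (A *ᵥ v) ≤ K * l2norm v ^ 2 := by
  have h1 : (algebraMap ℝ _ K - A).PosSemidef := by
    rw [Matrix.posSemidef_iff_isHermitian_and_spectrum_nonneg]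
    refine ⟨(IsSelfAdjoint.algebraMap _ (IsSelfAdjoint.all K)).sub hA, fun μ hμ => ?_⟩
    rw [← spectrum.singleton_sub_eq, Set.singleton_sub] at hμ
    obtain ⟨z, hz, rfl⟩ := hμ
    exact sub_nonneg.2 (h z hz)
  have h2 := h1.dotProduct_mulVec_nonneg v
  rw [Matrix.sub_mulVec, Matrix.algebraMap_eq_diagonal, dotProduct_sub] at h2
  have h3 : (Matrix.diagonal (algebraMap ℝ (ι → ℝ) K)) *ᵥ v = K • v := by
    ext i; simp [Matrix.mulVec_diagonal]
  rw [h3, dotProduct_smul, star_trivial, smul_eq_mul, ← l2norm_sq] at h2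
  linarith

theorem EigGE.le_dotProduct {A : Matrix ι ι ℝ} {K : ℝ} (h : EigGE A K) (hA : A.IsHermitian)
    (v : ι → ℝ) : K * l2norm v ^ 2 ≤ v ⬝ᵥ (A *ᵥ v) := by
  have h1 : EigLE (-A) (-K) := fun μ hμ => by
    rw [← spectrum.neg_eq] at hμ
    linarith [h _ hμ]
  have h2 := h1.dotProduct_le hA.neg v
  rw [Matrix.neg_mulVec, dotProduct_neg] at h2
  linarith

end Forms

/-! ### Bernstein's inequality -/

/-- With `u` replaced by `t u`, right side minus left side vanishes to first order at `t = 0` and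
has second derivative `τ² u² (exp (t u) - exp (t τ u)) ≥ 0`. Extracting `τ²` lets one exponential
moment at scale `M` control all smaller arguments of the moment generating function. -/
theorem exp_sub_le_sq_mul {τ u : ℝ} (hτ1 : τ ≤ 1) (hu : 0 ≤ u) :
    Real.exp (τ * u) - 1 - τ * u ≤ τ ^ 2 * (Real.exp u - 1 - u) := by
  have he : ∀ k t : ℝ, HasDerivAt (fun t => Real.exp (t * k)) (Real.exp (t * k) * k) t :=
    fun k t => by simpa using ((hasDerivAt_id t).mul_const k).exp
  have h1 : ∀ t, HasDerivAt (fun t => τ ^ 2 * (Real.exp (t * u) - 1 - t * u)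
      - (Real.exp (t * (τ * u)) - 1 - t * (τ * u)))
      (τ ^ 2 * (Real.exp (t * u) * u - u) - (Real.exp (t * (τ * u)) * (τ * u) - τ * u)) t :=
    fun t => by
      have := fun k => ((he k t).sub_const 1).sub ((hasDerivAt_id t).mul_const k)
      exact (((this u).const_mul (τ ^ 2)).sub (this (τ * u))).congr_deriv (by simp)
  have h2 : ∀ t, HasDerivAt
      (fun t => τ ^ 2 * (Real.exp (t * u) * u - u) - (Real.exp (t * (τ * u)) * (τ * u) - τ * u))
      (τ ^ 2 * (Real.exp (t * u) * u * u) - Real.exp (t * (τ * u)) * (τ * u) * (τ * u)) t :=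
    fun t => by
      have := fun k => ((he k t).mul_const k).sub_const k
      exact ((this u).const_mul (τ ^ 2)).sub (this (τ * u))
  have := taylor_lower h1 h2 (k₀ := 0) (k₁ := 0) fun t ht0 _ => by
    have h3 : Real.exp (t * (τ * u)) ≤ Real.exp (t * u) :=
      Real.exp_le_exp.2 (mul_le_mul_of_nonneg_left (mul_le_of_le_one_left hu hτ1) ht0)
    have h4 : 0 ≤ τ ^ 2 * u * u := by positivity
    nlinarith [mul_le_mul_of_nonneg_left h3 h4]
  norm_num at this
  linarith

theorem exp_le_one_add_add {M s x : ℝ} (hM : 0 < M) (hs : |s| * M ≤ 1) :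
    Real.exp (s * x) ≤ 1 + s * x + s ^ 2 * ((Real.exp (|x| / M) - 1 - |x| / M) * M ^ 2) := by
  have h1 : Real.exp (s * x) - 1 - s * x ≤ Real.exp |s * x| - 1 - |s * x| := by
    rcases le_total 0 (s * x) with h | h
    · rw [abs_of_nonneg h]
    · rw [abs_of_nonpos h]
      -- For a negative argument `-z` the claim reads `z ≤ sinh z`.
      have := Real.self_le_sinh_iff.2 (neg_nonneg.2 h)
      rw [Real.sinh_eq, neg_neg] at this
      linarith
  have h2 := exp_sub_le_sq_mul hs
    (div_nonneg (abs_nonneg x) hM.le)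
  have h3 : |s| * M * (|x| / M) = |s * x| := by
    rw [abs_mul]; field_simp
  rw [h3, mul_pow, sq_abs] at h2
  linarith

section Bernstein

variable {Ω : Type*} [MeasurableSpace Ω] {P : Measure Ω} [IsProbabilityMeasure P] {M v : ℝ}

omit [IsProbabilityMeasure P] in
theorem exp_tail_nonneg (x : ℝ) :
    0 ≤ (Real.exp (|x| / M) - 1 - |x| / M) * M ^ 2 :=
  mul_nonneg (by linarith [Real.add_one_le_exp (|x| / M)]) (sq_nonneg _)

variable {Z : Ω → ℝ} (hM : 0 < M) (hZ : Measurable Z) (hint : Integrable Z P)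
  (hmean : ∫ ω, Z ω ∂P = 0) (hv : 0 < v)
  (htail : ∫⁻ ω, ENNReal.ofReal ((Real.exp (|Z ω| / M) - 1 - |Z ω| / M) * M ^ 2) ∂P
    ≤ ENNReal.ofReal (v / 2))

include hZ htail

omit [IsProbabilityMeasure P] in
theorem integrable_exp_tail :
    Integrable (fun ω => (Real.exp (|Z ω| / M) - 1 - |Z ω| / M) * M ^ 2) P := by
  refine ⟨by fun_prop, ?_⟩
  rw [hasFiniteIntegral_iff_ofReal (ae_of_all _ fun ω => exp_tail_nonneg _)]
  exact htail.trans_lt ENNReal.ofReal_lt_top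

include hM hint

theorem integrable_exp_mul_of_tail {s : ℝ} (hs : |s| * M ≤ 1) :
    Integrable (fun ω => Real.exp (s * Z ω)) P := by
  refine Integrable.mono' (((integrable_const 1).add (hint.const_mul s)).add
    ((integrable_exp_tail hZ htail).const_mul (s ^ 2))) (by fun_prop)
    (ae_of_all _ fun ω => ?_)
  rw [Real.norm_eq_abs, abs_of_pos (Real.exp_pos _)]
  exact exp_le_one_add_add hM hs

include hmean hv

/-- Taking expectations in `exp_le_one_add_add` removes the linear term, since `Z` is centred. The
result is a Gaussian bound restricted to `|s| ≤ 1 / M`. -/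
theorem mgf_le_of_tail {s : ℝ} (hs : |s| * M ≤ 1) : mgf Z P s ≤ Real.exp (s ^ 2 * v / 2) := by
  have hT := integrable_exp_tail hZ htail
  have h1 : ∫ ω, (Real.exp (|Z ω| / M) - 1 - |Z ω| / M) * M ^ 2 ∂P ≤ v / 2 := by
    rw [integral_eq_lintegral_of_nonneg_ae (ae_of_all _ fun ω => exp_tail_nonneg _)
      hT.aestronglyMeasurable]
    exact ENNReal.toReal_le_of_le_ofReal (by positivity) htail
  have hA : Integrable (fun ω => 1 + s * Z ω) P := (integrable_const 1).add (hint.const_mul s)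
  calc mgf Z P s
      ≤ ∫ ω, (1 + s * Z ω + s ^ 2 * ((Real.exp (|Z ω| / M) - 1 - |Z ω| / M) * M ^ 2)) ∂P :=
        integral_mono (integrable_exp_mul_of_tail hM hZ hint htail hs)
          (hA.add (hT.const_mul _)) fun ω => exp_le_one_add_add hM hs
    _ = 1 + s ^ 2 * ∫ ω, (Real.exp (|Z ω| / M) - 1 - |Z ω| / M) * M ^ 2 ∂P := by
        rw [integral_add hA (hT.const_mul _), integral_const_mul,
          integral_add (integrable_const 1) (hint.const_mul s), integral_const_mul, hmean]
        simp
    _ ≤ 1 + s ^ 2 * v / 2 := by nlinarith [mul_le_mul_of_nonneg_left h1 (sq_nonneg s)]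
    _ ≤ Real.exp (s ^ 2 * v / 2) := by linarith [Real.add_one_le_exp (s ^ 2 * v / 2)]

end Bernstein

theorem bernstein {Ω : Type*} [MeasurableSpace Ω] {P : Measure Ω} [IsProbabilityMeasure P]
    {M v : ℝ} (hM : 0 < M) (hv : 0 < v) {n : ℕ} {Z : Fin n → Ω → ℝ}
    (hZ : ∀ i, Measurable (Z i)) (hind : iIndepFun Z P) (hint : ∀ i, Integrable (Z i) P)
    (hmean : ∀ i, ∫ ω, Z i ω ∂P = 0)
    (htail : ∀ i, ∫⁻ ω, ENNReal.ofReal ((Real.exp (|Z i ω| / M) - 1 - |Z i ω| / M) * M ^ 2) ∂P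
      ≤ ENNReal.ofReal (v / 2))
    (w : Fin n → ℝ) {V W x : ℝ} (hV : 0 < V) (hW : 0 ≤ W) (hx : 0 ≤ x)
    (hwV : ∑ i, w i ^ 2 ≤ V) (hwW : ∀ i, |w i| ≤ W) :
    P {ω | x ≤ ∑ i, w i * Z i ω}
      ≤ ENNReal.ofReal (Real.exp (-(1 / 2) * (x ^ 2 / (V * v + M * W * x)))) := by
  set D := V * v + M * W * x with hD
  have hDpos : 0 < D := by positivity
  -- Chernoff parameter: the term `M * W * x` in `D` keeps `|t * w i| * M ≤ 1`, and the term `V * v`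
  -- gives `t * V * v ≤ x`, so the exponent `-t x + t² V v / 2` is at most `-t x / 2`.
  set t := x / D with ht
  have ht0 : 0 ≤ t := by positivity
  have htD : t * D = x := div_mul_cancel₀ _ hDpos.ne'
  have htW : t * W * M ≤ 1 := by
    rw [ht, div_mul_eq_mul_div, div_mul_eq_mul_div, div_le_one hDpos]
    nlinarith [mul_pos hV hv]
  have hsi : ∀ i, |t * w i| * M ≤ 1 := fun i => by
    rw [abs_mul, abs_of_nonneg ht0]
    exact (mul_le_mul_of_nonneg_right (mul_le_mul_of_nonneg_left (hwW i) ht0) hM.le).trans htW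
  have hind' : iIndepFun (fun i ω => w i * Z i ω) P :=
    hind.comp (fun i z => w i * z) fun i => measurable_const_mul _
  have hmeas : ∀ i, Measurable fun ω => w i * Z i ω := fun i => (hZ i).const_mul _
  have hei : ∀ i, Integrable (fun ω => Real.exp (t * (w i * Z i ω))) P := fun i => by
    simp_rw [← mul_assoc]
    exact integrable_exp_mul_of_tail hM (hZ i) (hint i) (htail i) (hsi i)
  have hes := hind'.integrable_exp_mul_sum hmeas (s := Finset.univ) (t := t) fun i _ => hei i
  have h1 := measure_ge_le_exp_mul_mgf (μ := P) x ht0 hes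
  have h2 : mgf (∑ i, fun ω => w i * Z i ω) P t ≤ Real.exp (t ^ 2 * V * v / 2) := by
    rw [hind'.mgf_sum hmeas]
    calc ∏ i, mgf (fun ω => w i * Z i ω) P t
        ≤ ∏ i, Real.exp ((t * w i) ^ 2 * v / 2) := by
          refine Finset.prod_le_prod (fun i _ => mgf_nonneg) fun i _ => ?_
          have := mgf_le_of_tail hM (hZ i) (hint i) (hmean i) hv (htail i) (hsi i)
          simpa only [mgf, mul_assoc] using this
      _ = Real.exp (t ^ 2 * v / 2 * ∑ i, w i ^ 2) := by
          rw [← Real.exp_sum, Finset.mul_sum]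
          congr 1
          exact Finset.sum_congr rfl fun i _ => by ring
      _ ≤ _ := by
          refine Real.exp_le_exp.2 ?_
          have h3 : 0 ≤ t ^ 2 * v / 2 := by positivity
          linarith [mul_le_mul_of_nonneg_left hwV h3]
  have h3 : P.real {ω | x ≤ ∑ i, w i * Z i ω} ≤ Real.exp (-(1 / 2) * (x ^ 2 / D)) := by
    have h4 : {ω | x ≤ ∑ i, w i * Z i ω} = {ω | x ≤ (∑ i, fun ω => w i * Z i ω) ω} := by
      simp [Finset.sum_apply]
    rw [h4]
    refine h1.trans ((mul_le_mul_of_nonneg_left h2 (Real.exp_pos _).le).trans ?_)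
    rw [← Real.exp_add]
    refine Real.exp_le_exp.2 ?_
    have h5 : x ^ 2 / D = t * x := by rw [ht]; ring
    have h6 : t * V * v ≤ x := by
      have : 0 ≤ t * (M * W * x) := by positivity
      rw [hD] at htD
      nlinarith
    rw [h5]
    nlinarith [mul_le_mul_of_nonneg_left h6 ht0]
  rw [← ENNReal.ofReal_toReal (measure_ne_top P _)]
  exact ENNReal.ofReal_le_ofReal h3

/-! ### The gradient at the true parameter -/

/-- Responses of a generalized linear model at linear predictor `θ`. -/
structure IsGLMResponse (b : ℝ → ℝ) (φ : ℝ) (ν : Measure ℝ) (c : ℝ → ℝ) {n : ℕ}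
    (θ : Fin n → ℝ) {Ω : Type*} [MeasurableSpace Ω] (P : Measure Ω) (y : Ω → Fin n → ℝ) :
    Prop where
  measurable : ∀ i, Measurable fun ω => y ω i
  indep : iIndepFun (fun i ω => y ω i) P
  law : ∀ i, P.map (fun ω => y ω i) = expLaw b φ ν c (θ i)

namespace IsGLMResponse

variable {b : ℝ → ℝ} {φ : ℝ} {ν : Measure ℝ} {c : ℝ → ℝ} {n : ℕ} {θ : Fin n → ℝ}
  {Ω : Type*} [MeasurableSpace Ω] {P : Measure Ω} {y : Ω → Fin n → ℝ}

theorem memLp (hy : IsGLMResponse b φ ν c θ P y) (h : IsExpFamily b φ ν c) (i : Fin n) :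
    MemLp (fun ω => y ω i) 2 P := by
  have := h.memLp_id (θ i)
  rw [← hy.law i] at this
  exact (memLp_map_measure_iff (by fun_prop) (hy.measurable i).aemeasurable).1 this

theorem integral_eq (hy : IsGLMResponse b φ ν c θ P y) (h : IsExpFamily b φ ν c) (i : Fin n) :
    ∫ ω, y ω i ∂P = deriv b (θ i) := by
  rw [← h.integral_id, ← hy.law i, integral_map (hy.measurable i).aemeasurable (by fun_prop)]

theorem variance_eq (hy : IsGLMResponse b φ ν c θ P y) (h : IsExpFamily b φ ν c) (i : Fin n) :
    variance (fun ω => y ω i) P = φ * iteratedDeriv 2 b (θ i) := by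
  rw [← h.variance_id, ← hy.law i, variance_id_map (hy.measurable i).aemeasurable]

variable [IsProbabilityMeasure P]

/-- The errors are centred. -/
theorem integral_error (hy : IsGLMResponse b φ ν c θ P y) (h : IsExpFamily b φ ν c)
    (i : Fin n) : ∫ ω, (y ω i - deriv b (θ i)) ∂P = 0 := by
  rw [integral_sub ((hy.memLp h i).integrable (by norm_num)) (integrable_const _),
    hy.integral_eq h]
  simp

omit [IsProbabilityMeasure P] in
theorem indep_error (hy : IsGLMResponse b φ ν c θ P y) :
    iIndepFun (fun i ω => y ω i - deriv b (θ i)) P :=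
  hy.indep.comp (fun i z => z - deriv b (θ i)) fun _ => measurable_id.sub_const _

/-- The sum is centred, so its second moment is a sum of variances. For `θ = Xβ*` and `w = Xv` the
right side is `φ n` times the Hessian form at `v`; this is how the noise level is governed by `K_n`.
-/
theorem integral_sq_sum (hy : IsGLMResponse b φ ν c θ P y) (h : IsExpFamily b φ ν c)
    (w : Fin n → ℝ) :
    Integrable (fun ω => (∑ i, w i * (y ω i - deriv b (θ i))) ^ 2) P ∧
    ∫ ω, (∑ i, w i * (y ω i - deriv b (θ i))) ^ 2 ∂P
      = φ * ∑ i, iteratedDeriv 2 b (θ i) * w i ^ 2 := by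
  have hL : ∀ i, MemLp (fun ω => w i * (y ω i - deriv b (θ i))) 2 P := fun i =>
    ((hy.memLp h i).sub (memLp_const _)).const_mul _
  have hS : MemLp (fun ω => ∑ i, w i * (y ω i - deriv b (θ i))) 2 P :=
    memLp_finsetSum _ fun i _ => hL i
  refine ⟨hS.integrable_sq, ?_⟩
  have hmean : ∫ ω, ∑ i, w i * (y ω i - deriv b (θ i)) ∂P = 0 := by
    rw [integral_finsetSum _ fun i _ => (hL i).integrable (by norm_num)]
    refine Finset.sum_eq_zero fun i _ => ?_
    rw [integral_const_mul, hy.integral_error h, mul_zero]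
  rw [← variance_of_integral_eq_zero hS.aestronglyMeasurable.aemeasurable hmean]
  have hind : iIndepFun (fun i ω => w i * (y ω i - deriv b (θ i))) P :=
    hy.indep.comp (fun i z => w i * (z - deriv b (θ i))) fun i => by fun_prop
  have h1 := IndepFun.variance_sum (s := Finset.univ) (fun i _ => hL i)
    (fun i _ j _ hij => hind.indepFun hij)
  have h2 : (∑ i, fun ω => w i * (y ω i - deriv b (θ i)))
      = fun ω => ∑ i, w i * (y ω i - deriv b (θ i)) := by
    ext ω; simp
  rw [h2] at h1
  rw [h1, Finset.mul_sum]
  refine Finset.sum_congr rfl fun i _ => ?_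
  rw [variance_const_mul, variance_sub_const (hy.measurable i).aestronglyMeasurable,
    hy.variance_eq h]
  ring

end IsGLMResponse

/-- Bernstein's inequality at level `n x`, with each column of `X` and its negative as weights,
followed by a union bound over the `2p` events. -/
theorem Model.measure_grad_gt_le {b : ℝ → ℝ} {φ : ℝ} {ν : Measure ℝ} {c : ℝ → ℝ}
    (h : IsExpFamily b φ ν c) {n : ℕ} (hn : 0 < n) (D : Model n)
    {Ω : Type*} [MeasurableSpace Ω] {P : Measure Ω} [IsProbabilityMeasure P]
    {y : Ω → Fin n → ℝ} (hy : IsGLMResponse b φ ν c (D.X *ᵥ D.beta) P y)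
    {B₁ B₂ M₀ v₀ : ℝ} (hB₁ : 0 < B₁) (hB₂ : 0 < B₂) (hM₀ : 0 < M₀) (hv₀ : 0 < v₀)
    (hcol : D.DesignColumns B₁ B₂)
    (htail : ∀ i, ∫⁻ ω, ENNReal.ofReal
        ((Real.exp (|y ω i - deriv b ((D.X *ᵥ D.beta) i)| / M₀) - 1
          - |y ω i - deriv b ((D.X *ᵥ D.beta) i)| / M₀) * M₀ ^ 2) ∂P
        ≤ ENNReal.ofReal (v₀ / 2)) {x : ℝ} (hx : 0 ≤ x) :
    P {ω | ¬ ∀ j, |grad b D.X (y ω) D.beta j| ≤ x}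
      ≤ ENNReal.ofReal (2 * (D.p : ℝ) * Real.exp (-(1 / 2) *
        (n * x ^ 2 / (B₁ * v₀ + B₂ * M₀ * √(n / Real.log D.p) * x)))) := by
  have hn' : (0 : ℝ) < n := by exact_mod_cast hn
  set B := Real.exp (-(1 / 2) *
        (n * x ^ 2 / (B₁ * v₀ + B₂ * M₀ * √(n / Real.log D.p) * x))) with hB
  have key : ∀ w : Fin n → ℝ, ∑ i, w i ^ 2 ≤ B₁ * n → (∀ i, |w i| ≤ B₂ * √(n / Real.log D.p)) →
      P {ω | n * x ≤ ∑ i, w i * (y ω i - deriv b ((D.X *ᵥ D.beta) i))} ≤ ENNReal.ofReal B := by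
    intro w hw1 hw2
    have := bernstein hM₀ hv₀ (Z := fun i ω => y ω i - deriv b ((D.X *ᵥ D.beta) i))
      (fun i => (hy.measurable i).sub_const _) hy.indep_error
      (fun i => ((hy.memLp h i).integrable (by norm_num)).sub (integrable_const _))
      (hy.integral_error h) htail w (V := B₁ * n) (W := B₂ * √(n / Real.log D.p)) (x := n * x)
      (by positivity) (by positivity) (by positivity) hw1 hw2
    convert this using 3
    congr 1
    rw [show B₁ * n * v₀ + M₀ * (B₂ * √(n / Real.log D.p)) * (n * x)
      = n * (B₁ * v₀ + B₂ * M₀ * √(n / Real.log D.p) * x) by ring, mul_pow, sq (n : ℝ),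
      mul_assoc (n : ℝ) n, mul_div_mul_left _ _ hn'.ne']
  have hsub : {ω | ¬ ∀ j, |grad b D.X (y ω) D.beta j| ≤ x} ⊆
      ⋃ j, ({ω | n * x ≤ ∑ i, D.X i j * (y ω i - deriv b ((D.X *ᵥ D.beta) i))} ∪
        {ω | n * x ≤ ∑ i, (-D.X i j) * (y ω i - deriv b ((D.X *ᵥ D.beta) i))}) := by
    intro ω hω
    simp only [Set.mem_ofPred_eq, not_forall, not_le] at hω
    obtain ⟨j, hj⟩ := hω
    refine Set.mem_iUnion.2 ⟨j, ?_⟩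
    simp only [Set.mem_union, Set.mem_ofPred_eq, neg_mul, Finset.sum_neg_distrib]
    rw [grad_apply, abs_mul, abs_neg, abs_of_pos (by positivity), one_div, inv_mul_eq_div,
      lt_div_iff₀ hn', mul_comm] at hj
    rcases lt_abs.1 hj with h1 | h1
    · exact Or.inl h1.le
    · exact Or.inr h1.le
  calc P {ω | ¬ ∀ j, |grad b D.X (y ω) D.beta j| ≤ x}
      ≤ ∑ j, P ({ω | n * x ≤ ∑ i, D.X i j * (y ω i - deriv b ((D.X *ᵥ D.beta) i))} ∪
        {ω | n * x ≤ ∑ i, (-D.X i j) * (y ω i - deriv b ((D.X *ᵥ D.beta) i))}) :=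
        (measure_mono hsub).trans (measure_iUnion_fintype_le _ _)
    _ ≤ ∑ _j : Fin D.p, (ENNReal.ofReal B + ENNReal.ofReal B) := by
        refine Finset.sum_le_sum fun j _ => (measure_union_le _ _).trans (add_le_add ?_ ?_)
        · exact key _ (hcol j).1 (hcol j).2
        · exact key _ (by simpa using (hcol j).1) (by simpa using (hcol j).2)
    _ = _ := by
        rw [Finset.sum_const, Finset.card_univ, Fintype.card_fin, nsmul_eq_mul,
          ← ENNReal.ofReal_add (Real.exp_pos _).le (Real.exp_pos _).le,
          ← ENNReal.ofReal_natCast, ← ENNReal.ofReal_mul (by positivity)]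
        congr 1
        ring

/-! ### The lasso -/

theorem sum_abs_le_sqrt_card_mul_l2norm {ι : Type*} [Fintype ι] (s : Finset ι) (v : ι → ℝ) :
    ∑ j ∈ s, |v j| ≤ √(s.card : ℝ) * l2norm v := by
  refine abs_le_of_sq_le_sq' ?_ (mul_nonneg (Real.sqrt_nonneg _) (l2norm_nonneg v)) |>.2
  rw [mul_pow, Real.sq_sqrt (by positivity), l2norm_sq_sum]
  refine sq_sum_le_card_mul_sum_sq.trans (mul_le_mul_of_nonneg_left ?_ (by positivity))
  simp only [sq_abs]
  exact Finset.sum_le_univ_sum_of_nonneg fun i => sq_nonneg _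

/-- The bound on `b'''` makes `b''(θ + s x) exp (s K₀ |x|)` nondecreasing in `s`. Comparing `s = 0`
with `s = 1` and using `exp (-z) ≥ 1 - z` gives the claim. -/
theorem self_concordant_lower {b : ℝ → ℝ} (hb : ContDiff ℝ 3 b) {K₀ : ℝ}
    (hself : ∀ x, |iteratedDeriv 3 b x| ≤ K₀ * iteratedDeriv 2 b x) (θ x : ℝ)
    (hb2 : 0 ≤ iteratedDeriv 2 b θ) :
    iteratedDeriv 2 b θ * (1 - K₀ * |x|) ≤ iteratedDeriv 2 b (θ + x) := by
  have hd : ∀ s : ℝ, HasDerivAt (fun s => iteratedDeriv 2 b (θ + s * x) * Real.exp (s * (K₀ * |x|)))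
      (iteratedDeriv 3 b (θ + s * x) * x * Real.exp (s * (K₀ * |x|))
        + iteratedDeriv 2 b (θ + s * x) * (Real.exp (s * (K₀ * |x|)) * (K₀ * |x|))) s := by
    intro s
    have h0 : HasDerivAt (fun s : ℝ => θ + s * x) x s := by
      simpa using ((hasDerivAt_id s).mul_const x).const_add θ
    have h1 := ((differentiable_iteratedDeriv_two hb) (θ + s * x)).hasDerivAt.comp s h0
    have h2 : HasDerivAt (fun s => Real.exp (s * (K₀ * |x|)))
        (Real.exp (s * (K₀ * |x|)) * (K₀ * |x|)) s := by
      simpa using ((hasDerivAt_id s).mul_const (K₀ * |x|)).exp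
    have h3 : iteratedDeriv 3 b = deriv (iteratedDeriv 2 b) := iteratedDeriv_succ
    rw [h3]
    exact h1.mul h2
  have hmono : Monotone fun s => iteratedDeriv 2 b (θ + s * x) * Real.exp (s * (K₀ * |x|)) := by
    refine monotone_of_deriv_nonneg (fun s => (hd s).differentiableAt) fun s => ?_
    rw [(hd s).deriv]
    have h1 := hself (θ + s * x)
    have h2 : -(iteratedDeriv 3 b (θ + s * x) * x) ≤ K₀ * iteratedDeriv 2 b (θ + s * x) * |x| := by
      refine (neg_le_abs _).trans ?_
      rw [abs_mul]
      exact mul_le_mul_of_nonneg_right h1 (abs_nonneg x)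
    have h3 := Real.exp_pos (s * (K₀ * |x|))
    nlinarith
  have h := hmono zero_le_one
  simp only [zero_mul, add_zero, Real.exp_zero, mul_one, one_mul] at h
  have h1 := Real.one_sub_le_exp_neg (K₀ * |x|)
  have h2 : iteratedDeriv 2 b θ * Real.exp (-(K₀ * |x|)) ≤ iteratedDeriv 2 b (θ + x) := by
    rw [Real.exp_neg, ← div_eq_mul_inv, div_le_iff₀ (Real.exp_pos _)]
    exact h
  exact (mul_le_mul_of_nonneg_left h1 hb2).trans h2

theorem abs_mulVec_le_entryMax {n p : ℕ} (X : Matrix (Fin n) (Fin p) ℝ) (u : Fin p → ℝ)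
    (i : Fin n) : |(X *ᵥ u) i| ≤ entryMax X * ∑ j, |u j| := by
  rw [Matrix.mulVec, dotProduct, Finset.mul_sum]
  refine (Finset.abs_sum_le_sum_abs _ _).trans (Finset.sum_le_sum fun j _ => ?_)
  rw [abs_mul]
  exact mul_le_mul_of_nonneg_right
    (le_ciSup (f := fun ij : Fin n × Fin p => |X ij.1 ij.2|) (Set.finite_range _).bddAbove (i, j))
    (abs_nonneg _)

theorem continuous_loss {n p : ℕ} {b : ℝ → ℝ} (hb : Continuous b)
    (X : Matrix (Fin n) (Fin p) ℝ) (y : Fin n → ℝ) : Continuous (loss b X y) := by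
  have h : ∀ i, Continuous fun β => (X *ᵥ β) i := fun i => by
    simp only [Matrix.mulVec, dotProduct]
    fun_prop
  unfold loss
  fun_prop

namespace Model

variable {n : ℕ} (D : Model n) {b : ℝ → ℝ} {lamL : ℝ} {y : Fin n → ℝ}

/-- A computed argmin carries information only when a minimiser exists. The tangent inequality at
`β*` costs at most `lamL / 2` times `‖β‖₁ + ‖β*‖₁`, so the objective is at least its value at `β*`
as soon as `‖β‖₁ ≥ 3 ‖β*‖₁`. -/
theorem exists_lasso (hb : ContDiff ℝ 3 b) (hb2 : ∀ x, 0 ≤ iteratedDeriv 2 b x)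
    (hlamL : 0 < lamL) (hgrad : ∀ j, |grad b D.X y D.beta j| ≤ lamL / 2) :
    (argminOn (D.lassoObj b lamL y) Set.univ).Nonempty := by
  have hc : Continuous (D.lassoObj b lamL y) := by
    have := continuous_loss hb.continuous D.X y
    unfold lassoObj
    fun_prop
  obtain ⟨x, hx⟩ := hc.exists_forall_le' D.beta (by
    filter_upwards [(tendsto_norm_cocompact_atTop (E := Fin D.p → ℝ)).eventually_ge_atTop
      (3 * ∑ j, |D.beta j|)] with β hβ
    have h1 : ‖β‖ ≤ ∑ j, |β j| := by
      refine (pi_norm_le_iff_of_nonneg (Finset.sum_nonneg fun j _ => abs_nonneg _)).2 fun j => ?_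
      exact Finset.single_le_sum (f := fun j => |β j|) (fun j _ => abs_nonneg _)
        (Finset.mem_univ j)
    have h2 := loss_gradient_ineq D.X y D.beta (β - D.beta) hb hb2
    rw [add_sub_cancel] at h2
    have h3 : -(lamL / 2 * (∑ j, |β j| + ∑ j, |D.beta j|))
        ≤ grad b D.X y D.beta ⬝ᵥ (β - D.beta) := by
      rw [← Finset.sum_add_distrib, Finset.mul_sum, ← Finset.sum_neg_distrib]
      refine Finset.sum_le_sum fun j _ => ?_
      refine (neg_le_neg ?_).trans (neg_abs_le _)
      rw [abs_mul]
      exact mul_le_mul (hgrad j) (abs_sub _ _) (abs_nonneg _) (by positivity)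
    unfold lassoObj
    nlinarith)
  exact ⟨x, trivial, fun z _ => hx z⟩

/-- A direction in which the lasso objective decreases satisfies the cone condition and the basic
inequality. -/
theorem lasso_basic {u : Fin D.p → ℝ}
    {e : ℝ} (hgrad : ∀ j, |grad b D.X y D.beta j| ≤ lamL / 2)
    (he : loss b D.X y D.beta + grad b D.X y D.beta ⬝ᵥ u + e ≤ loss b D.X y (D.beta + u))
    (hu : D.lassoObj b lamL y (D.beta + u) ≤ D.lassoObj b lamL y D.beta) :
    e + lamL / 2 * ∑ j ∈ D.Aᶜ, |u j| ≤ 3 / 2 * lamL * ∑ j ∈ D.A, |u j| := by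
  have h1 : -(lamL / 2 * ∑ j, |u j|) ≤ grad b D.X y D.beta ⬝ᵥ u := by
    rw [Finset.mul_sum, ← Finset.sum_neg_distrib]
    refine Finset.sum_le_sum fun j _ => (neg_le_neg ?_).trans (neg_abs_le _)
    rw [abs_mul]
    exact mul_le_mul_of_nonneg_right (hgrad j) (abs_nonneg _)
  unfold lassoObj at hu
  have hsplit : ∀ f : Fin D.p → ℝ, ∑ j, f j = ∑ j ∈ D.A, f j + ∑ j ∈ D.Aᶜ, f j := fun f =>
    (Finset.sum_add_sum_compl D.A f).symm
  have hz : ∀ j ∈ D.Aᶜ, D.beta j = 0 := fun j hj => by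
    simpa [A] using hj
  have h2 : ∑ j ∈ D.Aᶜ, |(D.beta + u) j| = ∑ j ∈ D.Aᶜ, |u j| :=
    Finset.sum_congr rfl fun j hj => by simp [hz j hj]
  have h3 : ∑ j ∈ D.Aᶜ, |D.beta j| = 0 := Finset.sum_eq_zero fun j hj => by simp [hz j hj]
  have h4 : ∑ j ∈ D.A, |D.beta j| - ∑ j ∈ D.A, |u j| ≤ ∑ j ∈ D.A, |(D.beta + u) j| := by
    rw [← Finset.sum_sub_distrib]
    refine Finset.sum_le_sum fun j _ => ?_
    have := abs_sub_abs_le_abs_sub (D.beta j) (-u j)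
    simpa using this
  -- The sign of `lamL` follows from `hgrad` as soon as there is a coordinate; without coordinates
  -- all sums are empty.
  have hnn : 0 ≤ lamL / 2 ∨ D.p = 0 := by
    rcases Nat.eq_zero_or_pos D.p with h | h
    · exact Or.inr h
    · exact Or.inl ((abs_nonneg _).trans (hgrad ⟨0, h⟩))
  rw [hsplit, h2, hsplit (fun j => |D.beta j|), h3] at hu
  rw [hsplit] at h1
  rcases hnn with h0 | h0
  · nlinarith [mul_le_mul_of_nonneg_left h4 h0]
  · have : IsEmpty (Fin D.p) := by rw [h0]; infer_instance
    simp only [Finset.eq_empty_of_isEmpty, Finset.sum_empty] at *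
    nlinarith

/-- A localisation argument. By convexity the whole segment from `β*` to the lasso has objective at
most that at `β*`, so its points satisfy the cone condition. Inside the ball of radius `ρ`
self-concordance keeps enough curvature to improve `ρ` to `9/10 ρ`; hence no point of the segment
lies at distance exactly `ρ > 0`, and the lasso cannot lie outside the ball. -/
theorem lasso_bound (hb : ContDiff ℝ 3 b) (hb2 : ∀ x, 0 ≤ iteratedDeriv 2 b x) {K₀ κ : ℝ}
    (hK₀ : 0 < K₀) (hκ : 0 < κ)
    (hself : ∀ x, |iteratedDeriv 3 b x| ≤ K₀ * iteratedDeriv 2 b x)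
    (hRE : D.RestrictedEig b κ) (hlamL : 0 < lamL)
    (hub : 20 * K₀ * entryMax D.X * D.suppSize * lamL ≤ κ)
    (hgrad : ∀ j, |grad b D.X y D.beta j| ≤ lamL / 2) {βL : Fin D.p → ℝ}
    (hβL : IsComputedArgmin (D.lassoObj b lamL y) Set.univ βL) :
    l2norm (βL - D.beta) ≤ 5 * √(D.suppSize : ℝ) * lamL / κ := by
  have hmin := (hβL (D.exists_lasso hb hb2 hlamL hgrad)).2 D.beta trivial
  set Δ := βL - D.beta with hΔ
  have hβL' : βL = D.beta + Δ := by rw [hΔ, add_sub_cancel]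
  rw [hβL'] at hmin
  have hconv : ConvexOn ℝ Set.univ (D.lassoObj b lamL y) := by
    refine (convexOn_loss D.X y hb hb2).add ⟨convex_univ, fun x _ z _ s t hs ht _ => ?_⟩
    simp only [smul_eq_mul, Pi.add_apply, Pi.smul_apply]
    have : ∑ j, |s * x j + t * z j| ≤ s * ∑ j, |x j| + t * ∑ j, |z j| := by
      rw [Finset.mul_sum, Finset.mul_sum, ← Finset.sum_add_distrib]
      refine Finset.sum_le_sum fun j _ => (abs_add_le _ _).trans ?_
      rw [abs_mul, abs_mul, abs_of_nonneg hs, abs_of_nonneg ht]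
    nlinarith [mul_le_mul_of_nonneg_left this hlamL.le]
  have hscale : ∀ τ : ℝ, 0 ≤ τ → τ ≤ 1 →
      D.lassoObj b lamL y (D.beta + τ • Δ) ≤ D.lassoObj b lamL y D.beta := fun τ h0 h1 => by
    have := hconv.2 (Set.mem_univ D.beta) (Set.mem_univ (D.beta + Δ)) (sub_nonneg.2 h1) h0
      (sub_add_cancel 1 τ)
    rw [show (1 - τ) • D.beta + τ • (D.beta + Δ) = D.beta + τ • Δ by module] at this
    simp only [smul_eq_mul] at this
    nlinarith
  have hcone : ∀ u : Fin D.p → ℝ, D.lassoObj b lamL y (D.beta + u) ≤ D.lassoObj b lamL y D.beta →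
      ∑ j ∈ D.Aᶜ, |u j| ≤ 3 * ∑ j ∈ D.A, |u j| := fun u hu => by
    have := D.lasso_basic (e := 0) hgrad (by
      simpa using loss_gradient_ineq D.X y D.beta u hb hb2) hu
    nlinarith
  set ρ := 5 * √(D.suppSize : ℝ) * lamL / κ with hρ
  have hρ0 : 0 ≤ ρ := by positivity
  have hsmall : ∀ u : Fin D.p → ℝ, D.lassoObj b lamL y (D.beta + u) ≤ D.lassoObj b lamL y D.beta →
      l2norm u ≤ ρ → l2norm u ≤ 9 / 10 * ρ := by
    intro u hu hur
    by_cases hu0 : u = 0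
    · rw [hu0, l2norm_zero]; positivity
    have hc := hcone u hu
    have hA := sum_abs_le_sqrt_card_mul_l2norm D.A u
    have hre := hRE u hu0 hc
    rw [← l2norm_sq] at hre
    -- The factor `20` in `hub` is `4 * 5`: the cone gives `‖u‖₁ ≤ 4 ‖u_A‖₁`, and `5` is the
    -- constant in `ρ`.
    have hw : ∀ i, K₀ * |(D.X *ᵥ u) i| ≤ 1 := by
      intro i
      have h1 := abs_mulVec_le_entryMax D.X u i
      have hE : 0 ≤ entryMax D.X := Real.iSup_nonneg fun _ => abs_nonneg _
      have h2 : ∑ j, |u j| ≤ 4 * (√(D.suppSize : ℝ) * ρ) := by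
        rw [← Finset.sum_add_sum_compl D.A]
        have : √(D.A.card : ℝ) * l2norm u ≤ √(D.suppSize : ℝ) * ρ :=
          mul_le_mul_of_nonneg_left hur (Real.sqrt_nonneg _)
        linarith
      have h3 : √(D.suppSize : ℝ) * ρ = 5 * D.suppSize * lamL / κ := by
        rw [hρ]
        have := Real.mul_self_sqrt (Nat.cast_nonneg (α := ℝ) D.suppSize)
        field_simp
        nlinarith
      have h4 : K₀ * |(D.X *ᵥ u) i| ≤ K₀ * (entryMax D.X * (4 * (√(D.suppSize : ℝ) * ρ))) :=
        mul_le_mul_of_nonneg_left (h1.trans (mul_le_mul_of_nonneg_left h2 hE)) hK₀.le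
      refine h4.trans ?_
      rw [h3, show K₀ * (entryMax D.X * (4 * (5 * (D.suppSize : ℝ) * lamL / κ)))
        = 20 * K₀ * entryMax D.X * D.suppSize * lamL / κ by ring, div_le_one hκ]
      exact hub
    set q := u ⬝ᵥ (hess b D.X D.beta *ᵥ u) with hq
    -- Along the segment the Hessian form is at least `(1 - t) q`, which yields `q / 2 - q / 6 = q /
    -- 3`. Together with `lasso_basic` this gives the constant `3 * (3 / 2) = 9 / 2`, strictly below
    -- `5`.
    have hlow := loss_lower D.X y D.beta u hb (k₀ := q) (k₁ := q) fun t h0 h1 => by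
      rw [hq, dotProduct_hess_mulVec, dotProduct_hess_mulVec, ← mul_one_sub, mul_assoc,
        Finset.sum_mul]
      refine mul_le_mul_of_nonneg_left (Finset.sum_le_sum fun i _ => ?_) (by positivity)
      have h2 := self_concordant_lower hb hself ((D.X *ᵥ D.beta) i) (t * (D.X *ᵥ u) i) (hb2 _)
      rw [← mulVec_line, abs_mul, abs_of_nonneg h0] at h2
      have h3 : iteratedDeriv 2 b ((D.X *ᵥ D.beta) i) * (1 - t)
          ≤ iteratedDeriv 2 b ((D.X *ᵥ (D.beta + t • u)) i) := by
        refine le_trans (mul_le_mul_of_nonneg_left ?_ (hb2 _)) h2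
        nlinarith [mul_le_mul_of_nonneg_left (hw i) h0]
      nlinarith [mul_le_mul_of_nonneg_right h3 (sq_nonneg ((D.X *ᵥ u) i))]
    have hbasic := D.lasso_basic hgrad hlow hu
    have hupos : 0 < l2norm u :=
      lt_of_le_of_ne (l2norm_nonneg u) fun h => hu0 (l2norm_eq_zero.1 h.symm)
    have hnn : 0 ≤ lamL / 2 * ∑ j ∈ D.Aᶜ, |u j| :=
      mul_nonneg (by positivity) (Finset.sum_nonneg fun j _ => abs_nonneg _)
    have h5 : κ * l2norm u ^ 2 ≤ 9 / 2 * lamL * (√(D.suppSize : ℝ) * l2norm u) := by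
      have := mul_le_mul_of_nonneg_left hA (by positivity : 0 ≤ 3 / 2 * lamL)
      change _ ≤ 3 / 2 * lamL * (√(D.suppSize : ℝ) * l2norm u) at this
      linarith
    have h6 : κ * l2norm u ≤ 9 / 2 * lamL * √(D.suppSize : ℝ) := by
      refine le_of_mul_le_mul_right ?_ hupos
      linarith
    rw [hρ, show 9 / 10 * (5 * √(D.suppSize : ℝ) * lamL / κ)
      = 9 / 2 * lamL * √(D.suppSize : ℝ) / κ by ring, le_div_iff₀ hκ]
    linarith
  by_contra hcon
  rw [not_le] at hcon
  have hΔpos : 0 < l2norm Δ := hρ0.trans_lt hcon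
  have hτ : l2norm ((ρ / l2norm Δ) • Δ) = ρ := by
    rw [l2norm_smul, abs_of_nonneg (by positivity), div_mul_cancel₀ _ hΔpos.ne']
  have h1 := hsmall _ (hscale (ρ / l2norm Δ) (by positivity) ((div_le_one hΔpos).2 hcon.le)) hτ.le
  rw [hτ] at h1
  -- Only the degenerate radius is left: then `A` is empty and the cone condition forces `Δ = 0`.
  have hρz : ρ = 0 := by linarith
  have hs0 : D.suppSize = 0 := by
    by_contra h
    have : 0 < (D.suppSize : ℝ) := by exact_mod_cast Nat.pos_of_ne_zero h
    have : 0 < ρ := by positivity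
    linarith
  have hA0 : D.A = ∅ := Finset.card_eq_zero.1 hs0
  have hc := hcone Δ hmin
  rw [hA0] at hc
  simp only [Finset.compl_empty, Finset.sum_empty, mul_zero] at hc
  have hΔ0 : Δ = 0 := by
    ext j
    have := Finset.single_le_sum (f := fun j => |Δ j|) (fun j _ => abs_nonneg _)
      (Finset.mem_univ j)
    exact abs_nonpos_iff.1 (this.trans hc)
  rw [hΔ0, l2norm_zero] at hΔpos
  exact lt_irrefl _ hΔpos

end Model

/-! ### Weighted Gram matrices. -/

theorem isHermitian_transpose_mul_diagonal_mul {m ι : Type*} [Fintype m] [DecidableEq m]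
    (A : Matrix m ι ℝ) (w : m → ℝ) : (Aᵀ * Matrix.diagonal w * A).IsHermitian := by
  rw [Matrix.IsHermitian, Matrix.conjTranspose_eq_transpose_of_trivial, Matrix.transpose_mul,
    Matrix.transpose_mul, Matrix.transpose_transpose, Matrix.diagonal_transpose, Matrix.mul_assoc]

theorem dotProduct_transpose_mul_diagonal_mul {m ι : Type*} [Fintype m] [DecidableEq m] [Fintype ι]
    (A : Matrix m ι ℝ) (w : m → ℝ) (v : ι → ℝ) :
    v ⬝ᵥ ((Aᵀ * Matrix.diagonal w * A) *ᵥ v) = ∑ i, w i * (A *ᵥ v) i ^ 2 := by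
  rw [← Matrix.mulVec_mulVec, ← Matrix.mulVec_mulVec, Matrix.dotProduct_mulVec,
    Matrix.vecMul_transpose, dotProduct]
  exact Finset.sum_congr rfl fun i _ => by rw [Matrix.mulVec_diagonal]; ring

theorem EigLE.mono {ι : Type*} [Fintype ι] [DecidableEq ι] {A : Matrix ι ι ℝ} {K L : ℝ}
    (h : EigLE A K) (hKL : K ≤ L) : EigLE A L := fun μ hμ => (h μ hμ).trans hKL

namespace Model

variable {n : ℕ} (D : Model n)

theorem DesignEig.mono {D : Model n} {b : ℝ → ℝ} {c K L : ℝ} (h : D.DesignEig b c K)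
    (hKL : K ≤ L) : D.DesignEig b c L := by
  have h1 : K * n ≤ L * n := mul_le_mul_of_nonneg_right hKL (Nat.cast_nonneg n)
  exact ⟨h.min_hess, fun β hβ j => (h.third β hβ j).mono h1, h.max_hess.mono h1,
    fun j hj => (h.cross j hj).trans h1⟩

/-! ### Vectors supported on `M ∪ S` -/

/-- Extension by zero of a vector indexed by `M ∪ S`. -/
noncomputable def ext (v : {j // j ∈ D.MS} → ℝ) : Fin D.p → ℝ :=
  fun j => if h : j ∈ D.MS then v ⟨j, h⟩ else 0

theorem ext_apply_mem (v : {j // j ∈ D.MS} → ℝ) (j : {j // j ∈ D.MS}) : D.ext v j = v j := by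
  simp [ext]

theorem ext_apply_notMem (v : {j // j ∈ D.MS} → ℝ) {j : Fin D.p} (hj : j ∉ D.MS) :
    D.ext v j = 0 := by
  simp [ext, hj]

theorem ext_add (v w : {j // j ∈ D.MS} → ℝ) : D.ext (v + w) = D.ext v + D.ext w := by
  funext j
  by_cases hj : j ∈ D.MS <;> simp [ext, hj]

theorem ext_smul (t : ℝ) (v : {j // j ∈ D.MS} → ℝ) : D.ext (t • v) = t • D.ext v := by
  funext j
  by_cases hj : j ∈ D.MS <;> simp [ext, hj]

theorem subMS_add (β γ : Fin D.p → ℝ) : D.subMS (β + γ) = D.subMS β + D.subMS γ := rfl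

theorem subMS_sub (β γ : Fin D.p → ℝ) : D.subMS (β - γ) = D.subMS β - D.subMS γ := rfl

theorem subMS_ext (v : {j // j ∈ D.MS} → ℝ) : D.subMS (D.ext v) = v :=
  funext fun j => D.ext_apply_mem v j

theorem M_subset_MS : D.M ⊆ D.MS := Finset.subset_union_left

theorem A_subset_MS : D.A ⊆ D.MS := by
  intro j hj
  by_cases hM : j ∈ D.M
  · exact D.M_subset_MS hM
  · exact Finset.mem_union_right _ (Finset.mem_sdiff.2 ⟨hj, hM⟩)

theorem beta_eq_zero {j : Fin D.p} (hj : j ∉ D.MS) : D.beta j = 0 := by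
  by_contra h
  exact hj (D.A_subset_MS (by simpa [A] using h))

theorem beta_add_ext {β : Fin D.p → ℝ} (hβ : β ∈ D.oracleSet) :
    D.beta + D.ext (D.subMS β - D.subMS D.beta) = β := by
  funext j
  by_cases hj : j ∈ D.MS
  · simp [ext, hj, subMS]
  · simp [ext, hj, D.beta_eq_zero hj, hβ j hj]

theorem beta_add_ext_mem_oracleSet (v : {j // j ∈ D.MS} → ℝ) :
    D.beta + D.ext v ∈ D.oracleSet := fun j hj => by
  simp [D.beta_eq_zero hj, D.ext_apply_notMem v hj]

theorem dotProduct_eq_subMS (g w : Fin D.p → ℝ) (hw : ∀ j, j ∉ D.MS → g j * w j = 0) :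
    g ⬝ᵥ w = D.subMS g ⬝ᵥ D.subMS w := by
  rw [dotProduct, dotProduct, ← Finset.sum_subset (Finset.subset_univ D.MS)
    (fun j _ hj => hw j hj), ← Finset.sum_coe_sort D.MS]
  rfl

theorem dotProduct_ext (g : Fin D.p → ℝ) (v : {j // j ∈ D.MS} → ℝ) :
    g ⬝ᵥ D.ext v = D.subMS g ⬝ᵥ v := by
  rw [D.dotProduct_eq_subMS g (D.ext v) fun j hj => by rw [D.ext_apply_notMem v hj, mul_zero],
    D.subMS_ext]

theorem mulVec_ext (v : {j // j ∈ D.MS} → ℝ) : D.X *ᵥ D.ext v = D.XMS *ᵥ v := by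
  funext i
  exact D.dotProduct_ext (D.X i) v

theorem subMS_hess_mulVec_ext (b : ℝ → ℝ) (v : {j // j ∈ D.MS} → ℝ) :
    D.subMS (hess b D.X D.beta *ᵥ D.ext v) = D.K b *ᵥ v := by
  funext j
  exact D.dotProduct_ext (hess b D.X D.beta j) v

theorem card_MS : D.MS.card = D.s + D.m := by
  rw [MS, Finset.card_union_of_disjoint, m, s, add_comm]
  exact Finset.disjoint_sdiff

theorem C0_mulVec_subMS (β : Fin D.p → ℝ) : D.C0 *ᵥ D.subMS β = D.C *ᵥ D.subM β := by
  funext i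
  simp only [Matrix.mulVec, dotProduct]
  have h1 : ∑ j : {j // j ∈ D.MS}, D.C0 i j * D.subMS β j
      = ∑ j ∈ D.MS, if hj : j ∈ D.M then D.C i ⟨j, hj⟩ * β j else 0 := by
    rw [← Finset.sum_coe_sort D.MS]
    refine Finset.sum_congr rfl fun j _ => ?_
    by_cases hj : (j : Fin D.p) ∈ D.M <;> simp [C0, hj, subMS]
  rw [h1, ← Finset.sum_subset D.M_subset_MS fun j _ hj => by simp [hj],
    ← Finset.sum_coe_sort D.M]
  exact Finset.sum_congr rfl fun j _ => by simp [subM]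

theorem beta_add_ext_mem_constrained (v : {j // j ∈ D.MS} → ℝ) :
    D.beta + D.ext v ∈ D.constrained ↔ D.C0 *ᵥ v = -D.h := by
  rw [constrained, Set.mem_ofPred_eq, ← D.C0_mulVec_subMS, subMS_add, subMS_ext,
    Matrix.mulVec_add, D.C0_mulVec_subMS, h, neg_sub, eq_sub_iff_add_eq, add_comm]

/-! ### Consequences of the design conditions -/

section Design

variable {b : ℝ → ℝ} {c K : ℝ}

theorem beta_add_ext_mem_N0 {v : {j // j ∈ D.MS} → ℝ}
    (hv : l2norm v ≤ √(((D.s : ℝ) + D.m) * Real.log n / n)) : D.beta + D.ext v ∈ D.N0 := by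
  refine ⟨?_, D.beta_add_ext_mem_oracleSet v⟩
  rwa [subMS_add, subMS_ext, add_sub_cancel_left]

theorem beta_mem_N0 : D.beta ∈ D.N0 := by
  have := D.beta_add_ext_mem_N0 (v := 0) (by rw [l2norm_zero]; positivity)
  rwa [show D.ext 0 = 0 from funext fun j => by simp [ext], add_zero] at this

variable {D} (hD : D.DesignEig b c K) (hn : 0 < n)
include hD hn

theorem DesignEig.le_hess {β : Fin D.p → ℝ} (hβ : β ∈ D.N0) (v : {j // j ∈ D.MS} → ℝ) :
    c * l2norm v ^ 2 ≤ D.ext v ⬝ᵥ (hess b D.X β *ᵥ D.ext v) := by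
  have hn' : (0 : ℝ) < n := by exact_mod_cast hn
  have h1 := (hD.min_hess β hβ).le_dotProduct (isHermitian_transpose_mul_diagonal_mul _ _) v
  rw [Sig, dotProduct_transpose_mul_diagonal_mul] at h1
  rw [dotProduct_hess_mulVec, mulVec_ext, one_div, inv_mul_eq_div, le_div_iff₀ hn']
  linarith

theorem DesignEig.third_le {β : Fin D.p → ℝ} (hβ : β ∈ D.N0) (v : {j // j ∈ D.MS} → ℝ)
    (j : Fin D.p) :
    1 / (n : ℝ) * ∑ i, |D.X i j| * |iteratedDeriv 3 b ((D.X *ᵥ β) i)| * (D.X *ᵥ D.ext v) i ^ 2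
      ≤ K * l2norm v ^ 2 := by
  have hn' : (0 : ℝ) < n := by exact_mod_cast hn
  have h1 := (hD.third β hβ j).dotProduct_le (isHermitian_transpose_mul_diagonal_mul _ _) v
  rw [dotProduct_transpose_mul_diagonal_mul] at h1
  rw [mulVec_ext, one_div, inv_mul_eq_div, div_le_iff₀ hn']
  linarith

theorem DesignEig.K_le (v : {j // j ∈ D.MS} → ℝ) : v ⬝ᵥ (D.K b *ᵥ v) ≤ K * l2norm v ^ 2 := by
  have hn' : (0 : ℝ) < n := by exact_mod_cast hn
  have h1 := hD.max_hess.dotProduct_le (isHermitian_transpose_mul_diagonal_mul _ _) v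
  rw [Sig, dotProduct_transpose_mul_diagonal_mul] at h1
  rw [← subMS_hess_mulVec_ext, dotProduct_comm, ← dotProduct_ext, dotProduct_comm,
    dotProduct_hess_mulVec, mulVec_ext, one_div, inv_mul_eq_div, div_le_iff₀ hn']
  linarith

theorem DesignEig.le_K (v : {j // j ∈ D.MS} → ℝ) : c * l2norm v ^ 2 ≤ v ⬝ᵥ (D.K b *ᵥ v) := by
  have h1 := hD.le_hess hn D.beta_mem_N0 v
  rwa [dotProduct_comm, dotProduct_ext, subMS_hess_mulVec_ext, dotProduct_comm] at h1

omit hD hn in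
theorem K_isHermitian (D : Model n) (b : ℝ → ℝ) : (D.K b).IsHermitian := by
  have : (hess b D.X D.beta).IsHermitian := by
    rw [hess, Matrix.IsHermitian, Matrix.conjTranspose_smul, star_trivial,
      Sig, (isHermitian_transpose_mul_diagonal_mul D.X _).eq]
  exact this.submatrix _

/-- Cauchy–Schwarz for the form of `K_n`: positivity at the sum of `‖w‖ v` and `‖v‖ w`, which have
equal norms, bounds the cross term by the two diagonal ones. -/
theorem DesignEig.neg_dotProduct_K_le (hc : 0 ≤ c) (v w : {j // j ∈ D.MS} → ℝ) :
    -(v ⬝ᵥ (D.K b *ᵥ w)) ≤ K * l2norm v * l2norm w := by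
  have hsymm : ∀ a e : {j // j ∈ D.MS} → ℝ, e ⬝ᵥ (D.K b *ᵥ a) = a ⬝ᵥ (D.K b *ᵥ e) := fun a e => by
    have hK := K_isHermitian D b
    rw [Matrix.IsHermitian, Matrix.conjTranspose_eq_transpose_of_trivial] at hK
    rw [Matrix.dotProduct_mulVec, dotProduct_comm, ← Matrix.mulVec_transpose, hK]
  have hpoly : ∀ a e : {j // j ∈ D.MS} → ℝ,
      -(2 * (a ⬝ᵥ (D.K b *ᵥ e))) ≤ a ⬝ᵥ (D.K b *ᵥ a) + e ⬝ᵥ (D.K b *ᵥ e) := fun a e => by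
    have h1 := hD.le_K hn (a + e)
    have h2 : 0 ≤ c * l2norm (a + e) ^ 2 := by positivity
    rw [Matrix.mulVec_add, add_dotProduct, dotProduct_add, dotProduct_add, hsymm a e] at h1
    linarith
  rcases (l2norm_nonneg v).eq_or_lt with hv | hv
  · rw [← hv, l2norm_eq_zero.1 hv.symm, zero_dotProduct]; simp
  rcases (l2norm_nonneg w).eq_or_lt with hw | hw
  · rw [← hw, l2norm_eq_zero.1 hw.symm, Matrix.mulVec_zero, dotProduct_zero]; simp
  have h1 := hpoly (l2norm w • v) (l2norm v • w)
  have h2 := hD.K_le hn (l2norm w • v)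
  have h3 := hD.K_le hn (l2norm v • w)
  rw [l2norm_smul, abs_of_pos hw] at h2
  rw [l2norm_smul, abs_of_pos hv] at h3
  have h4 : (l2norm w • v) ⬝ᵥ (D.K b *ᵥ (l2norm v • w))
      = l2norm v * l2norm w * (v ⬝ᵥ (D.K b *ᵥ w)) := by
    rw [Matrix.mulVec_smul, dotProduct_smul, smul_dotProduct, smul_eq_mul, smul_eq_mul, mul_assoc]
  rw [h4] at h1
  refine le_of_mul_le_mul_left ?_ (mul_pos hv hw)
  nlinarith

/-- Expansion of the gradient at a vector supported on `M ∪ S`. -/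
theorem DesignEig.abs_grad_sub_le (hb : ContDiff ℝ 3 b) (y : Fin n → ℝ)
    {v : {j // j ∈ D.MS} → ℝ} (hv : l2norm v ≤ √(((D.s : ℝ) + D.m) * Real.log n / n))
    (j : Fin D.p) :
    |grad b D.X y (D.beta + D.ext v) j - grad b D.X y D.beta j
      - (hess b D.X D.beta *ᵥ D.ext v) j| ≤ K * l2norm v ^ 2 / 2 := by
  refine grad_taylor D.X y D.beta (D.ext v) hb j fun t h0 h1 => ?_
  refine hD.third_le hn ?_ v j
  rw [← ext_smul]
  refine D.beta_add_ext_mem_N0 (le_trans ?_ hv)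
  rw [l2norm_smul, abs_of_nonneg h0]
  exact mul_le_of_le_one_left (l2norm_nonneg v) h1

/-- The factor `√(s + m)` is the price of passing from coordinates to the Euclidean norm. It is the
source of the condition `s + m = o(n^{1/3})` in the expansions. -/
theorem DesignEig.l2norm_grad_sub_le (hb : ContDiff ℝ 3 b) (y : Fin n → ℝ)
    {v : {j // j ∈ D.MS} → ℝ} (hv : l2norm v ≤ √(((D.s : ℝ) + D.m) * Real.log n / n)) :
    l2norm (D.subMS (grad b D.X y (D.beta + D.ext v)) - D.subMS (grad b D.X y D.beta)
      - D.K b *ᵥ v) ≤ √((D.s : ℝ) + D.m) * (K * l2norm v ^ 2 / 2) := by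
  have := l2norm_le_of_abs_le (v := D.subMS (grad b D.X y (D.beta + D.ext v))
    - D.subMS (grad b D.X y D.beta) - D.K b *ᵥ v) (k := K * l2norm v ^ 2 / 2) fun j => by
      rw [← subMS_hess_mulVec_ext]
      exact hD.abs_grad_sub_le hn hb y hv j
  rwa [Fintype.card_coe, card_MS, Nat.cast_add] at this

/-- In the linear term the row sums of `cross` meet the largest entry of `v`, so off `M ∪ S` the
gradient changes by `O(‖v‖)` without a dimension factor. -/
theorem DesignEig.abs_grad_le_of_notMem (hb : ContDiff ℝ 3 b) (y : Fin n → ℝ)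
    {v : {j // j ∈ D.MS} → ℝ} (hv : l2norm v ≤ √(((D.s : ℝ) + D.m) * Real.log n / n))
    {j : Fin D.p} (hj : j ∉ D.MS) :
    |grad b D.X y (D.beta + D.ext v) j|
      ≤ |grad b D.X y D.beta j| + K * l2norm v + K * l2norm v ^ 2 / 2 := by
  have hn' : (0 : ℝ) < n := by exact_mod_cast hn
  have h1 := hD.abs_grad_sub_le hn hb y hv j
  have h2 : |(hess b D.X D.beta *ᵥ D.ext v) j| ≤ K * l2norm v := by
    have h3 : (hess b D.X D.beta *ᵥ D.ext v) j
        = 1 / (n : ℝ) * ∑ k : {k // k ∈ D.MS}, (D.Xᵀ * Sig b D.X D.beta * D.X) j k * v k := by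
      rw [hess, Matrix.smul_mulVec, Pi.smul_apply, smul_eq_mul]
      congr 1
      exact D.dotProduct_ext _ v
    rw [h3, abs_mul, abs_of_pos (by positivity), one_div, inv_mul_eq_div, div_le_iff₀ hn']
    calc |∑ k : {k // k ∈ D.MS}, (D.Xᵀ * Sig b D.X D.beta * D.X) j k * v k|
        ≤ ∑ k : {k // k ∈ D.MS}, |(D.Xᵀ * Sig b D.X D.beta * D.X) j k| * l2norm v := by
          refine (Finset.abs_sum_le_sum_abs _ _).trans (Finset.sum_le_sum fun k _ => ?_)
          rw [abs_mul]
          exact mul_le_mul_of_nonneg_left (abs_le_l2norm v k) (abs_nonneg _)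
      _ = (∑ k ∈ D.MS, |(D.Xᵀ * Sig b D.X D.beta * D.X) j k|) * l2norm v := by
          rw [← Finset.sum_mul, Finset.sum_coe_sort D.MS
            fun k => |(D.Xᵀ * Sig b D.X D.beta * D.X) j k|]
      _ ≤ K * n * l2norm v := mul_le_mul_of_nonneg_right (hD.cross j hj) (l2norm_nonneg v)
      _ = K * l2norm v * n := by ring
  have h4 := abs_sub_abs_le_abs_sub (grad b D.X y (D.beta + D.ext v) j)
    (grad b D.X y D.beta j + (hess b D.X D.beta *ᵥ D.ext v) j)
  have h5 := abs_add_le (grad b D.X y D.beta j) ((hess b D.X D.beta *ᵥ D.ext v) j)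
  rw [← sub_sub] at h4
  linarith

/-- Distance between a point of low loss and the centre `β* + d`. -/
theorem DesignEig.l2norm_le_of_loss_le (hb : ContDiff ℝ 3 b)
    (hb2 : ∀ x, 0 ≤ iteratedDeriv 2 b x) (hc : 0 < c) (hK : 0 ≤ K) {y : Fin n → ℝ}
    {d v : {j // j ∈ D.MS} → ℝ} {G ρ : ℝ} (hG0 : 0 ≤ G)
    (hG : -(D.subMS (grad b D.X y D.beta) ⬝ᵥ v) ≤ G * l2norm v)
    (hmin : loss b D.X y (D.beta + D.ext (d + v)) ≤ loss b D.X y (D.beta + D.ext d))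
    (hρ0 : 0 < ρ) (hdρ : l2norm d ≤ ρ) (hρ : 2 * ρ ≤ √(((D.s : ℝ) + D.m) * Real.log n / n))
    (hd : √((D.s : ℝ) + D.m) * l2norm d ≤ 1)
    (hsmall : 2 / c * (G + 3 / 2 * K * l2norm d) ≤ ρ / 2) :
    l2norm v ≤ 2 / c * (G + 3 / 2 * K * l2norm d) := by
  set g := D.subMS (grad b D.X y D.beta) with hg
  -- Localisation: strong convexity is available only in `N0`, so the bound is first shown for
  -- points of the segment within `ρ` of the centre. As the bound is at most `ρ / 2`, the segment
  -- cannot reach distance `ρ`.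
  have main : ∀ τ : ℝ, 0 < τ → τ ≤ 1 → τ * l2norm v ≤ ρ →
      τ * l2norm v ≤ 2 / c * (G + 3 / 2 * K * l2norm d) := by
    intro τ hτ0 hτ1 hτ
    set u := τ • v with hu
    have hnu : l2norm u = τ * l2norm v := by rw [hu, l2norm_smul, abs_of_pos hτ0]
    rw [← hnu] at hτ ⊢
    have hminu : loss b D.X y (D.beta + D.ext d + D.ext u) ≤ loss b D.X y (D.beta + D.ext d) := by
      have := (convexOn_loss D.X y hb hb2).2 (Set.mem_univ (D.beta + D.ext d))
        (Set.mem_univ (D.beta + D.ext (d + v))) (sub_nonneg.2 hτ1) hτ0.le (sub_add_cancel 1 τ)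
      rw [show (1 - τ) • (D.beta + D.ext d) + τ • (D.beta + D.ext (d + v))
        = D.beta + D.ext d + D.ext u by rw [ext_add, hu, ext_smul]; module] at this
      simp only [smul_eq_mul] at this
      nlinarith
    have hlow := loss_lower D.X y (D.beta + D.ext d) (D.ext u) hb (k₀ := c * l2norm u ^ 2)
      (k₁ := 0) fun t h0 h1 => by
        rw [zero_mul, sub_zero]
        refine hD.le_hess hn ?_ u
        rw [add_assoc, ← ext_smul, ← ext_add]
        refine D.beta_add_ext_mem_N0 ((l2norm_add_le _ _).trans ?_)
        rw [l2norm_smul, abs_of_nonneg h0]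
        have := mul_le_of_le_one_left (l2norm_nonneg u) h1
        linarith
    rw [dotProduct_ext] at hlow
    have hdN : l2norm d ≤ √(((D.s : ℝ) + D.m) * Real.log n / n) := by linarith
    set R := D.subMS (grad b D.X y (D.beta + D.ext d)) - g - D.K b *ᵥ d with hR
    -- Condition `hd` absorbs the dimension factor. This `1/2 K`, together with `K` from the linear
    -- term `K_n d`, gives the `3/2 K` of the statement.
    have hRn : l2norm R ≤ 1 / 2 * K * l2norm d := by
      refine (hD.l2norm_grad_sub_le hn hb y hdN).trans ?_
      have : 0 ≤ K * l2norm d / 2 := div_nonneg (mul_nonneg hK (l2norm_nonneg d)) zero_le_two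
      nlinarith [mul_le_mul_of_nonneg_left hd this]
    have hdec : D.subMS (grad b D.X y (D.beta + D.ext d)) ⬝ᵥ u
        = g ⬝ᵥ u + u ⬝ᵥ (D.K b *ᵥ d) + R ⬝ᵥ u := by
      rw [dotProduct_comm u, ← add_dotProduct, ← add_dotProduct, hR]
      congr 1
      abel
    have h1 : -(g ⬝ᵥ u) ≤ G * l2norm u := by
      rw [hnu, hu, dotProduct_smul, smul_eq_mul]
      nlinarith [mul_le_mul_of_nonneg_left hG hτ0.le]
    have h2 := hD.neg_dotProduct_K_le hn hc.le u d
    have h3 := (neg_le_abs _).trans (abs_dotProduct_le R u)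
    have h4 := mul_le_mul_of_nonneg_right hRn (l2norm_nonneg u)
    have h5 : c * l2norm u ^ 2 / 2 ≤ (G + 3 / 2 * K * l2norm d) * l2norm u := by
      rw [hdec] at hlow
      linarith
    rcases (l2norm_nonneg u).eq_or_lt with h0 | h0
    · rw [← h0]
      have := l2norm_nonneg d
      positivity
    · have h6 : c * l2norm u / 2 ≤ G + 3 / 2 * K * l2norm d := by
        refine le_of_mul_le_mul_right ?_ h0
        linarith
      rw [div_mul_eq_mul_div, le_div_iff₀ hc]
      linarith
  rcases le_or_gt (l2norm v) ρ with h | h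
  · simpa using main 1 one_pos le_rfl (by simpa using h)
  · have hv : 0 < l2norm v := hρ0.trans h
    have := main (ρ / l2norm v) (by positivity) ((div_le_one hv).2 h.le)
      (by rw [div_mul_cancel₀ _ hv.ne'])
    rw [div_mul_cancel₀ _ hv.ne'] at this
    linarith

end Design

end Model

/-! ### Square roots of positive definite matrices -/

section SqrtMat

variable {ι : Type*} [Fintype ι] [DecidableEq ι] {A : Matrix ι ι ℝ}

theorem _root_.Matrix.PosDef.pos_of_mem_spectrum (hA : A.PosDef) {x : ℝ}
    (hx : x ∈ spectrum ℝ A) : 0 < x := by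
  rw [hA.isHermitian.spectrum_real_eq_range_eigenvalues] at hx
  obtain ⟨i, rfl⟩ := hx
  exact hA.eigenvalues_pos i

theorem continuousOn_inv_sqrt (hA : A.PosDef) :
    ContinuousOn (fun x : ℝ => (√x)⁻¹) (spectrum ℝ A) :=
  Real.continuous_sqrt.continuousOn.inv₀ fun _ hx =>
    (Real.sqrt_pos.2 (hA.pos_of_mem_spectrum hx)).ne'

theorem invSqrtMat_mul_sqrtMat (hA : A.PosDef) : invSqrtMat A * sqrtMat A = 1 := by
  have hsa : IsSelfAdjoint A := hA.isHermitian
  rw [invSqrtMat, sqrtMat, ← cfc_mul _ _ A (continuousOn_inv_sqrt hA)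
    Real.continuous_sqrt.continuousOn, ← cfc_one ℝ A]
  refine cfc_congr fun x hx => ?_
  exact inv_mul_cancel₀ (Real.sqrt_pos.2 (hA.pos_of_mem_spectrum hx)).ne'

theorem sqrtMat_mul_sqrtMat (hA : A.PosDef) : sqrtMat A * sqrtMat A = A := by
  have hsa : IsSelfAdjoint A := hA.isHermitian
  rw [sqrtMat, ← cfc_mul _ _ A Real.continuous_sqrt.continuousOn
    Real.continuous_sqrt.continuousOn]
  conv_rhs => rw [← cfc_id' ℝ A]
  exact cfc_congr fun x hx => Real.mul_self_sqrt (hA.pos_of_mem_spectrum hx).le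

theorem invSqrtMat_mul_invSqrtMat (hA : A.PosDef) : invSqrtMat A * invSqrtMat A = A⁻¹ := by
  refine (Matrix.inv_eq_left_inv ?_).symm
  have h := invSqrtMat_mul_sqrtMat hA
  calc invSqrtMat A * invSqrtMat A * A
      = invSqrtMat A * (invSqrtMat A * sqrtMat A) * sqrtMat A := by
        conv_lhs => rw [← sqrtMat_mul_sqrtMat hA]
        simp only [Matrix.mul_assoc, sqrtMat_mul_sqrtMat hA]
    _ = 1 := by rw [h, Matrix.mul_one, h]

end SqrtMat

namespace Model

variable {n : ℕ} (D : Model n)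

/-! ### The constraint matrix -/

theorem C0_mulVec (w : {j // j ∈ D.MS} → ℝ) :
    D.C0 *ᵥ w = D.C *ᵥ fun j => w ⟨j, D.M_subset_MS j.2⟩ := by
  rw [← D.subMS_ext w, C0_mulVec_subMS]
  rw [subMS_ext]
  congr 1
  funext j
  exact D.ext_apply_mem w ⟨j, D.M_subset_MS j.2⟩

theorem C0_apply (i : Fin D.r) (j : {j // j ∈ D.M}) :
    D.C0 i ⟨j, D.M_subset_MS j.2⟩ = D.C i j := by
  simp [C0]

theorem C0_mul_transpose : D.C0 * D.C0ᵀ = D.C * D.Cᵀ := by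
  ext i k
  have := congrFun (D.C0_mulVec (D.C0 k)) i
  simp only [C0_apply] at this
  exact this

variable {D} (hrank : D.C.rank = D.r)
include hrank

theorem C_vecMul_injective : Function.Injective D.C.vecMul := by
  have h1 : Module.finrank ℝ (LinearMap.ker D.Cᵀ.mulVecLin) = 0 := by
    have h2 := LinearMap.finrank_range_add_finrank_ker D.Cᵀ.mulVecLin
    have h3 : Module.finrank ℝ (LinearMap.range D.Cᵀ.mulVecLin) = D.r :=
      (Matrix.rank_transpose D.C).trans hrank
    rw [h3, Module.finrank_fin_fun] at h2
    omega
  have h4 := LinearMap.ker_eq_bot.1 (Submodule.finrank_eq_zero.1 h1)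
  intro x z hxz
  refine h4 ?_
  simpa [Matrix.mulVec_transpose] using hxz

theorem C_mul_transpose_posDef : (D.C * D.Cᵀ).PosDef := by
  rw [← Matrix.conjTranspose_eq_transpose_of_trivial]
  exact Matrix.PosDef.mul_conjTranspose_self _ (C_vecMul_injective hrank)

theorem C0_rank : D.C0.rank = D.r := by
  rw [← Matrix.rank_self_mul_transpose, C0_mul_transpose, Matrix.rank_self_mul_transpose, hrank]

theorem C0_vecMul_injective : Function.Injective D.C0.vecMul := by
  intro x z hxz
  refine C_vecMul_injective hrank (funext fun j => ?_)
  have := congrFun hxz ⟨j, D.M_subset_MS j.2⟩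
  simpa [Matrix.vecMul, dotProduct, C0_apply] using this

/-- Differences of feasible points lie in this kernel, so this is the dimension in the reduced rate.
The subtraction takes place in `ℝ`. -/
theorem finrank_ker_C0 :
    (Module.finrank ℝ (LinearMap.ker D.C0.mulVecLin) : ℝ) = (D.s : ℝ) + D.m - D.r := by
  have h1 := LinearMap.finrank_range_add_finrank_ker D.C0.mulVecLin
  have h2 : Module.finrank ℝ (LinearMap.range D.C0.mulVecLin) = D.r := C0_rank hrank
  rw [h2, Module.finrank_fintype_fun_eq_card, Fintype.card_coe, card_MS] at h1
  rw [← Nat.cast_add, ← h1]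
  push_cast
  ring

/-- The shift from `β*` to the constraint set. -/
noncomputable def shift (D : Model n) : {j // j ∈ D.MS} → ℝ :=
  -(D.C0ᵀ *ᵥ ((D.C * D.Cᵀ)⁻¹ *ᵥ D.h))

theorem C0_mulVec_transpose_mulVec (x : Fin D.r → ℝ) :
    D.C0 *ᵥ (D.C0ᵀ *ᵥ ((D.C * D.Cᵀ)⁻¹ *ᵥ x)) = x := by
  rw [Matrix.mulVec_mulVec, Matrix.mulVec_mulVec, C0_mul_transpose, Matrix.mul_nonsing_inv _
    ((Matrix.isUnit_iff_isUnit_det _).1 (C_mul_transpose_posDef hrank).isUnit), Matrix.one_mulVec]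

theorem C0_mulVec_shift : D.C0 *ᵥ D.shift = -D.h := by
  rw [shift, Matrix.mulVec_neg, C0_mulVec_transpose_mulVec hrank]

/-- The squared norm of `C'(CC')⁻¹h` is the quadratic form `h'(CC')⁻¹h`. -/
theorem l2norm_shift_le {L : ℝ} (hL : 0 ≤ L) (hC : EigLE (D.C * D.Cᵀ)⁻¹ L) :
    l2norm D.shift ≤ √L * l2norm D.h := by
  refine abs_le_of_sq_le_sq' ?_ (mul_nonneg (Real.sqrt_nonneg _) (l2norm_nonneg _)) |>.2
  have h1 := hC.dotProduct_le (C_mul_transpose_posDef hrank).inv.isHermitian D.h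
  rw [mul_pow, Real.sq_sqrt hL, shift, l2norm_neg, l2norm_sq, Matrix.dotProduct_mulVec,
    Matrix.vecMul_transpose, C0_mulVec_transpose_mulVec hrank]
  exact h1

/-! ### The linear expansion -/

variable {b : ℝ → ℝ} {c K : ℝ} (hD : D.DesignEig b c K) (hn : 0 < n) (hc : 0 < c)

omit hrank in
include hD hn hc in
theorem DesignEig.K_posDef : (D.K b).PosDef := by
  refine Matrix.PosDef.of_dotProduct_mulVec_pos (D.K_isHermitian b) fun x hx => ?_
  have h1 : 0 < l2norm x :=
    lt_of_le_of_ne (l2norm_nonneg x) fun h => hx (l2norm_eq_zero.1 h.symm)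
  rw [star_trivial]
  exact lt_of_lt_of_le (by positivity) (hD.le_K hn x)

theorem Psi_posDef (hK : (D.K b).PosDef) : (D.Psi b).PosDef := by
  rw [Psi, ← Matrix.conjTranspose_eq_transpose_of_trivial]
  exact hK.inv.mul_mul_conjTranspose_same (C0_vecMul_injective hrank)

include hD hn hc in
/-- A solution of perturbed stationarity equations is close to the leading term of the
expansion. -/
theorem DesignEig.l2norm_sub_leading_le {δ g R : {j // j ∈ D.MS} → ℝ} {μ : Fin D.r → ℝ}
    (h1 : g + D.K b *ᵥ δ + R = D.C0ᵀ *ᵥ μ) (h2 : D.C0 *ᵥ δ = -D.h) :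
    l2norm (δ - ((invSqrtMat (D.K b) * (D.Pn b - 1) * invSqrtMat (D.K b)) *ᵥ g
      - (invSqrtMat (D.K b) * D.Pn b * sqrtMat (D.K b)) *ᵥ
        (D.C0ᵀ *ᵥ ((D.C * D.Cᵀ)⁻¹ *ᵥ D.h)))) ≤ l2norm R / c := by
  have hK := hD.K_posDef hn hc
  have hPsi := Psi_posDef hrank hK
  have hKu := (Matrix.isUnit_iff_isUnit_det _).1 hK.isUnit
  have hPu := (Matrix.isUnit_iff_isUnit_det _).1 hPsi.isUnit
  have e1 : invSqrtMat (D.K b) * (D.Pn b - 1) * invSqrtMat (D.K b)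
      = (D.K b)⁻¹ * D.C0ᵀ * (D.Psi b)⁻¹ * D.C0 * (D.K b)⁻¹ - (D.K b)⁻¹ := by
    rw [Matrix.mul_sub, Matrix.sub_mul, Matrix.mul_one, invSqrtMat_mul_invSqrtMat hK, Pn,
      ← invSqrtMat_mul_invSqrtMat hK]
    simp only [Matrix.mul_assoc]
  have e2 : invSqrtMat (D.K b) * D.Pn b * sqrtMat (D.K b)
      = (D.K b)⁻¹ * D.C0ᵀ * (D.Psi b)⁻¹ * D.C0 := by
    rw [Pn, ← invSqrtMat_mul_invSqrtMat hK]
    simp only [Matrix.mul_assoc]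
    rw [invSqrtMat_mul_sqrtMat hK, Matrix.mul_one]
  rw [e1, e2]
  set lead := ((D.K b)⁻¹ * D.C0ᵀ * (D.Psi b)⁻¹ * D.C0 * (D.K b)⁻¹ - (D.K b)⁻¹) *ᵥ g
      - ((D.K b)⁻¹ * D.C0ᵀ * (D.Psi b)⁻¹ * D.C0) *ᵥ (D.C0ᵀ *ᵥ ((D.C * D.Cᵀ)⁻¹ *ᵥ D.h))
    with hlead
  have hlead' : lead = (D.K b)⁻¹ *ᵥ (D.C0ᵀ *ᵥ ((D.Psi b)⁻¹ *ᵥ (D.C0 *ᵥ ((D.K b)⁻¹ *ᵥ g) - D.h))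
      - g) := by
    rw [hlead, Matrix.sub_mulVec]
    simp only [← Matrix.mulVec_mulVec, C0_mulVec_transpose_mulVec hrank, Matrix.mulVec_sub]
    abel
  -- `lead` solves the unperturbed Lagrange system: `K_n lead + g` lies in the range of `[C 0]'`,
  -- and `[C 0] lead = -h`.
  have hKl : D.K b *ᵥ lead
      = D.C0ᵀ *ᵥ ((D.Psi b)⁻¹ *ᵥ (D.C0 *ᵥ ((D.K b)⁻¹ *ᵥ g) - D.h)) - g := by
    rw [hlead', Matrix.mulVec_mulVec, Matrix.mul_nonsing_inv _ hKu, Matrix.one_mulVec]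
  have hCl : D.C0 *ᵥ lead = -D.h := by
    have h3 : ∀ x, D.C0 *ᵥ ((D.K b)⁻¹ *ᵥ (D.C0ᵀ *ᵥ ((D.Psi b)⁻¹ *ᵥ x))) = x := fun x => by
      rw [Matrix.mulVec_mulVec, Matrix.mulVec_mulVec, Matrix.mulVec_mulVec, ← Psi,
        Matrix.mul_nonsing_inv _ hPu, Matrix.one_mulVec]
    rw [hlead', Matrix.mulVec_sub, Matrix.mulVec_sub, h3]
    abel
  set w := δ - lead with hw
  have hCw : D.C0 *ᵥ w = 0 := by rw [hw, Matrix.mulVec_sub, h2, hCl, sub_self]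
  have hKw : D.K b *ᵥ w
      = D.C0ᵀ *ᵥ (μ - (D.Psi b)⁻¹ *ᵥ (D.C0 *ᵥ ((D.K b)⁻¹ *ᵥ g) - D.h)) - R := by
    rw [hw, Matrix.mulVec_sub, hKl, Matrix.mulVec_sub D.C0ᵀ, ← h1]
    abel
  -- Since `w` is in the kernel of `[C 0]`, pairing with `w` removes the multiplier and leaves
  -- `w'K_n w = -w'R`.
  have h4 := hD.le_K hn w
  rw [hKw, dotProduct_sub, Matrix.dotProduct_mulVec, Matrix.vecMul_transpose, hCw,
    zero_dotProduct, zero_sub] at h4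
  have h5 := (neg_le_abs _).trans (abs_dotProduct_le w R)
  rw [le_div_iff₀ hc]
  rcases (l2norm_nonneg w).eq_or_lt with h0 | h0
  · rw [← h0, zero_mul]; exact l2norm_nonneg R
  · refine le_of_mul_le_mul_left ?_ h0
    nlinarith

end Model

/-! ### Local linear approximation -/

namespace Model

variable {n : ℕ} (D : Model n) {b q : ℝ → ℝ} {y : Fin n → ℝ} {βo : Fin D.p → ℝ}

/-- In the tangent inequality at `βo`, the part of the gradient on `M ∪ S` is orthogonal to feasible
differences, and the rest is dominated by the penalty weights. A feasible `z` thus exceeds `βo` by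
at least `∑ (k - |∂_j|) |z_j|` over `j ∉ M ∪ S`. So `βo` is a minimiser and every minimiser vanishes
off `M ∪ S`. As the weights vanish on `S`, it also solves the oracle problem, whose solution is
unique. -/
theorem lla_step (hb : ContDiff ℝ 3 b) (hb2 : ∀ x, 0 ≤ iteratedDeriv 2 b x) {k : ℝ}
    (ho : IsUniqueArgmin (loss b D.X y) (D.oracleSet ∩ D.constrained) βo)
    {μ : Fin D.r → ℝ} (hkkt : D.subMS (grad b D.X y βo) = D.C0ᵀ *ᵥ μ)
    (hgrad : ∀ j, j ∉ D.MS → |grad b D.X y βo j| < k) {β0 β1 : Fin D.p → ℝ}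
    (hS : ∀ j ∈ D.S, penDeriv q |β0 j| = 0) (hMS : ∀ j, j ∉ D.MS → k ≤ penDeriv q |β0 j|)
    (h1 : IsComputedArgmin (D.llaObj b q y β0) D.constrained β1) : β1 = βo := by
  have hmem : βo ∈ argminOn (loss b D.X y) (D.oracleSet ∩ D.constrained) := by
    rw [ho]; rfl
  obtain ⟨⟨hoz, hoc⟩, homin⟩ := hmem
  have hpen : ∀ z : Fin D.p → ℝ, ∑ j ∈ D.Mᶜ, penDeriv q |β0 j| * |z j|
      = ∑ j ∈ D.MSᶜ, penDeriv q |β0 j| * |z j| := fun z => by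
    refine (Finset.sum_subset (Finset.compl_subset_compl.2 D.M_subset_MS) fun j hj hj' => ?_).symm
    rw [hS j, zero_mul]
    simp only [Finset.mem_compl, not_not, MS, Finset.mem_union] at hj hj'
    exact hj'.resolve_left hj
  have hlow : ∀ z ∈ D.constrained, D.llaObj b q y β0 βo
      + ∑ j ∈ D.MSᶜ, (k - |grad b D.X y βo j|) * |z j| ≤ D.llaObj b q y β0 z := by
    intro z hz
    have h2 := loss_gradient_ineq D.X y βo (z - βo) hb hb2
    rw [add_sub_cancel] at h2
    have h3 : grad b D.X y βo ⬝ᵥ (z - βo) = ∑ j ∈ D.MSᶜ, grad b D.X y βo j * z j := by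
      rw [dotProduct, ← Finset.sum_add_sum_compl D.MS]
      have h4 : ∑ j ∈ D.MS, grad b D.X y βo j * (z - βo) j
          = D.subMS (grad b D.X y βo) ⬝ᵥ D.subMS (z - βo) := by
        rw [← Finset.sum_coe_sort D.MS]; rfl
      have h5 : D.C0 *ᵥ D.subMS (z - βo) = 0 := by
        rw [subMS_sub, Matrix.mulVec_sub, C0_mulVec_subMS, C0_mulVec_subMS]
        exact sub_eq_zero.2 (Eq.trans hz hoc.symm)
      rw [h4, hkkt, dotProduct_comm, Matrix.dotProduct_mulVec, Matrix.vecMul_transpose, h5,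
        zero_dotProduct, zero_add]
      refine Finset.sum_congr rfl fun j hj => ?_
      rw [Pi.sub_apply, hoz j (Finset.mem_compl.1 hj), sub_zero]
    have h6 : ∑ j ∈ D.MSᶜ, penDeriv q |β0 j| * |βo j| = 0 := Finset.sum_eq_zero fun j hj => by
      rw [hoz j (Finset.mem_compl.1 hj), abs_zero, mul_zero]
    rw [llaObj, llaObj, hpen, hpen, h6]
    rw [h3] at h2
    have h7 : ∑ j ∈ D.MSᶜ, (k - |grad b D.X y βo j|) * |z j|
        ≤ ∑ j ∈ D.MSᶜ, grad b D.X y βo j * z j + ∑ j ∈ D.MSᶜ, penDeriv q |β0 j| * |z j| := by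
      rw [← Finset.sum_add_distrib]
      refine Finset.sum_le_sum fun j hj => ?_
      have h8 := neg_abs_le (grad b D.X y βo j * z j)
      rw [abs_mul] at h8
      have h9 := mul_le_mul_of_nonneg_right (hMS j (Finset.mem_compl.1 hj)) (abs_nonneg (z j))
      linarith
    linarith
  have hterm : ∀ z : Fin D.p → ℝ, ∀ j ∈ D.MSᶜ, 0 ≤ (k - |grad b D.X y βo j|) * |z j| :=
    fun z j hj => mul_nonneg (sub_nonneg.2 (hgrad j (Finset.mem_compl.1 hj)).le) (abs_nonneg _)
  have h1' := h1 ⟨βo, hoc, fun z hz => by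
    linarith [hlow z hz, Finset.sum_nonneg (hterm z)]⟩
  have h2 := hlow β1 h1'.1
  have h3 := h1'.2 βo hoc
  have h4 : ∑ j ∈ D.MSᶜ, (k - |grad b D.X y βo j|) * |β1 j| = 0 :=
    le_antisymm (by linarith) (Finset.sum_nonneg (hterm β1))
  have h5 : β1 ∈ D.oracleSet := fun j hj => by
    have := (Finset.sum_eq_zero_iff_of_nonneg (hterm β1)).1 h4 j (Finset.mem_compl.2 hj)
    rcases mul_eq_zero.1 this with h | h
    · exact absurd h (sub_pos.2 (hgrad j hj)).ne'
    · exact abs_eq_zero.1 h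
  have h6 : β1 ∈ argminOn (loss b D.X y) (D.oracleSet ∩ D.constrained) := by
    refine ⟨⟨h5, h1'.1⟩, fun z hz => le_trans ?_ (homin z hz)⟩
    rw [llaObj, llaObj, hpen, hpen] at h3
    rw [Finset.sum_eq_zero fun j hj => by rw [h5 j (Finset.mem_compl.1 hj), abs_zero, mul_zero],
      Finset.sum_eq_zero fun j hj => by rw [hoz j (Finset.mem_compl.1 hj), abs_zero, mul_zero]] at h3
    linarith
  rw [ho] at h6
  exact h6

/-- The first step reaches `βo` from the lasso and the second stays there. An error of at most `lam`
leaves `|z j| ≥ a * lam` on `S`, where the weight is zero; off `M ∪ S` the lasso is at most `a₂ *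
lam`, where the weight is at least `a₁ * lam`. This is the role of `min 1 a₂`. -/
theorem lla_two_step (hb : ContDiff ℝ 3 b) (hb2 : ∀ x, 0 ≤ iteratedDeriv 2 b x)
    {lam a a₁ a₂ : ℝ} (hq : IsFoldedConcave q lam a a₁ a₂)
    (hsignal : ∀ j ∈ D.S, (a + 1) * lam < |D.beta j|)
    (ho : IsUniqueArgmin (loss b D.X y) (D.oracleSet ∩ D.constrained) βo)
    {μ : Fin D.r → ℝ} (hkkt : D.subMS (grad b D.X y βo) = D.C0ᵀ *ᵥ μ)
    (hgrad : ∀ j, j ∉ D.MS → |grad b D.X y βo j| < a₁ * lam)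
    (hclose : ∀ j ∈ D.S, |βo j - D.beta j| ≤ lam) {βL β2 : Fin D.p → ℝ}
    (hL : ∀ j, |βL j - D.beta j| ≤ min 1 a₂ * lam) (hlam : 0 < lam)
    (h2 : D.IsTwoStepLLA b q y D.constrained βL β2) : β2 = βo := by
  obtain ⟨β1, h11, h12⟩ := h2
  have hlarge : ∀ z : Fin D.p → ℝ, ∀ j ∈ D.S, |z j - D.beta j| ≤ lam → penDeriv q |z j| = 0 := by
    intro z j hj hz
    refine hq.deriv_large _ ?_
    have h3 := hsignal j hj
    have h4 := abs_sub_abs_le_abs_sub (D.beta j) (z j)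
    rw [abs_sub_comm] at h4
    linarith
  have hβ1 : β1 = βo := by
    refine D.lla_step hb hb2 ho hkkt hgrad (fun j hj => hlarge βL j hj ((hL j).trans ?_))
      (fun j hj => ?_) h11
    · exact mul_le_of_le_one_left hlam.le (min_le_left _ _)
    · have h3 := hL j
      rw [D.beta_eq_zero hj, sub_zero] at h3
      rcases (abs_nonneg (βL j)).eq_or_lt with h0 | h0
      · rw [← h0]; exact hq.deriv_zero
      · exact hq.deriv_small _ h0
          (h3.trans (mul_le_mul_of_nonneg_right (min_le_right _ _) hlam.le))
  rw [hβ1] at h12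
  have hmem : βo ∈ argminOn (loss b D.X y) (D.oracleSet ∩ D.constrained) := by
    rw [ho]; rfl
  refine D.lla_step hb hb2 ho hkkt hgrad (fun j hj => hlarge βo j hj (hclose j hj))
    (fun j hj => ?_) h12
  rw [hmem.1.1 j hj, abs_zero]
  exact hq.deriv_zero

end Model

/-- The gradient at `β*`, projected to a subspace, has second moment of the order of the
dimension of the subspace. -/
theorem Model.exists_projection_bound {b : ℝ → ℝ} {φ : ℝ} {ν : Measure ℝ} {c : ℝ → ℝ}
    (h : IsExpFamily b φ ν c) {n : ℕ} (hn : 0 < n) {D : Model n} {c₀ K : ℝ}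
    (hD : D.DesignEig b c₀ K) {Ω : Type*} [MeasurableSpace Ω] {P : Measure Ω}
    [IsProbabilityMeasure P] {y : Ω → Fin n → ℝ}
    (hy : IsGLMResponse b φ ν c (D.X *ᵥ D.beta) P y)
    (V : Submodule ℝ ({j // j ∈ D.MS} → ℝ)) :
    ∃ G : Ω → ℝ, (∀ ω, 0 ≤ G ω) ∧
      (∀ ω, ∀ v ∈ V, |D.subMS (grad b D.X (y ω) D.beta) ⬝ᵥ v| ≤ G ω * l2norm v) ∧
      ∀ L : ℝ, 0 < L → P {ω | L * √(Module.finrank ℝ V / n) < G ω}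
        ≤ ENNReal.ofReal (φ * K / L ^ 2) := by
  have hn' : (0 : ℝ) < n := by exact_mod_cast hn
  -- `V` is moved to Euclidean space to have orthonormal bases and projections; `G` will be the norm
  -- of the projected gradient.
  set W : Submodule ℝ (EuclideanSpace ℝ {j // j ∈ D.MS}) :=
    V.map (WithLp.linearEquiv 2 ℝ ({j // j ∈ D.MS} → ℝ)).symm.toLinearMap with hW
  have hfin : Module.finrank ℝ W = Module.finrank ℝ V := LinearEquiv.finrank_map_eq _ V
  set g : Ω → EuclideanSpace ℝ {j // j ∈ D.MS} :=
    fun ω => WithLp.toLp 2 (D.subMS (grad b D.X (y ω) D.beta)) with hg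
  have hinner : ∀ ω (e : EuclideanSpace ℝ {j // j ∈ D.MS}),
      inner ℝ e (g ω) = D.subMS (grad b D.X (y ω) D.beta) ⬝ᵥ e.ofLp := fun ω e => by
    rw [EuclideanSpace.inner_eq_star_dotProduct]
    simp [hg]
  set e := stdOrthonormalBasis ℝ W with he
  -- Each unit direction contributes at most `φ K / n` to the second moment; summing over an
  -- orthonormal basis produces the dimension of `V`.
  have hsecond : ∀ l, Integrable (fun ω => (inner ℝ (e l : EuclideanSpace ℝ _) (g ω)) ^ 2) P ∧
      ∫ ω, (inner ℝ (e l : EuclideanSpace ℝ _) (g ω)) ^ 2 ∂P ≤ φ * K / n := by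
    intro l
    set v := (e l : EuclideanSpace ℝ {j // j ∈ D.MS}).ofLp with hv
    have hvn : l2norm v = 1 := by
      have := e.orthonormal.1 l
      exact this
    have h1 : (fun ω => (inner ℝ (e l : EuclideanSpace ℝ _) (g ω)) ^ 2)
        = fun ω => (1 / (n : ℝ)) ^ 2 * (∑ i, (D.X *ᵥ D.ext v) i
          * (y ω i - deriv b ((D.X *ᵥ D.beta) i))) ^ 2 := by
      funext ω
      rw [hinner, ← dotProduct_ext, grad_dotProduct, mul_pow, neg_sq]
    obtain ⟨h2, h3⟩ := hy.integral_sq_sum h (D.X *ᵥ D.ext v)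
    rw [h1]
    refine ⟨h2.const_mul _, ?_⟩
    rw [integral_const_mul, h3]
    have h4 := hD.K_le hn v
    rw [← subMS_hess_mulVec_ext, dotProduct_comm, ← dotProduct_ext, dotProduct_comm,
      dotProduct_hess_mulVec, hvn] at h4
    calc (1 / (n : ℝ)) ^ 2 * (φ * ∑ i, iteratedDeriv 2 b ((D.X *ᵥ D.beta) i)
          * (D.X *ᵥ D.ext v) i ^ 2)
        = φ / n * (1 / (n : ℝ) * ∑ i, iteratedDeriv 2 b ((D.X *ᵥ D.beta) i)
          * (D.X *ᵥ D.ext v) i ^ 2) := by ring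
      _ ≤ φ / n * (K * 1 ^ 2) :=
          mul_le_mul_of_nonneg_left h4 (div_nonneg h.phi_pos.le hn'.le)
      _ = φ * K / n := by ring
  have hsq : ∀ ω, ‖W.orthogonalProjectionOnto (g ω)‖ ^ 2
      = ∑ l, (inner ℝ (e l : EuclideanSpace ℝ _) (g ω)) ^ 2 := fun ω => by
    rw [← e.sum_sq_norm_inner_right]
    refine Finset.sum_congr rfl fun l _ => ?_
    rw [Real.norm_eq_abs, sq_abs, ← Submodule.inner_orthogonalProjectionOnto_eq_of_mem_left]
  refine ⟨fun ω => ‖W.orthogonalProjectionOnto (g ω)‖, fun ω => norm_nonneg _, fun ω v hv => ?_,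
    fun L hL => ?_⟩
  · have hvW : WithLp.toLp 2 v ∈ W := ⟨v, hv, rfl⟩
    have h1 := hinner ω (WithLp.toLp 2 v)
    rw [← Submodule.inner_orthogonalProjectionOnto_eq_of_mem_left ⟨WithLp.toLp 2 v, hvW⟩] at h1
    have h2 := abs_real_inner_le_norm (⟨WithLp.toLp 2 v, hvW⟩ : W)
      (W.orthogonalProjectionOnto (g ω))
    rw [mul_comm]
    refine le_trans (le_of_eq ?_) h2
    rw [h1]
  · have hint : Integrable (fun ω => ‖W.orthogonalProjectionOnto (g ω)‖ ^ 2) P := by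
      simp_rw [hsq]
      exact integrable_finsetSum _ fun l _ => (hsecond l).1
    have hE : ∫ ω, ‖W.orthogonalProjectionOnto (g ω)‖ ^ 2 ∂P
        ≤ φ * K * (Module.finrank ℝ V / n) := by
      simp_rw [hsq]
      rw [integral_finsetSum _ fun l _ => (hsecond l).1]
      refine (Finset.sum_le_sum fun l _ => (hsecond l).2).trans (le_of_eq ?_)
      rw [Finset.sum_const, Finset.card_univ, Fintype.card_fin, nsmul_eq_mul, hfin]
      ring
    set q : ℝ := Module.finrank ℝ V / n with hq
    -- Markov's inequality below divides by `q`; in dimension zero the projection vanishes and the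
    -- event is empty.
    rcases Nat.eq_zero_or_pos (Module.finrank ℝ V) with h0 | h0
    · have : {ω | L * √q < ‖W.orthogonalProjectionOnto (g ω)‖} = ∅ := by
        refine Set.eq_empty_of_forall_notMem fun ω hω => ?_
        have hWsub : Subsingleton W := Module.finrank_zero_iff.1 (hfin.trans h0)
        have h1 : W.orthogonalProjectionOnto (g ω) = 0 := Subsingleton.elim _ _
        rw [Set.mem_ofPred_eq, h1, norm_zero] at hω
        exact absurd hω (not_lt.2 (by positivity))
      rw [this, measure_empty]
      exact zero_le
    · have hqpos : 0 < q := div_pos (by exact_mod_cast h0) hn'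
      have h1 := mul_meas_ge_le_integral_of_nonneg
        (ae_of_all P fun ω => sq_nonneg ‖W.orthogonalProjectionOnto (g ω)‖) hint (L ^ 2 * q)
      have h2 : P.real {ω | L ^ 2 * q ≤ ‖W.orthogonalProjectionOnto (g ω)‖ ^ 2}
          ≤ φ * K / L ^ 2 := by
        rw [le_div_iff₀ (by positivity)]
        refine le_of_mul_le_mul_right ?_ hqpos
        linarith
      have h3 : {ω | L * √q < ‖W.orthogonalProjectionOnto (g ω)‖}
          ⊆ {ω | L ^ 2 * q ≤ ‖W.orthogonalProjectionOnto (g ω)‖ ^ 2} := fun ω hω => by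
        rw [Set.mem_ofPred_eq] at hω ⊢
        have := pow_le_pow_left₀ (by positivity) hω.le 2
        rwa [mul_pow, Real.sq_sqrt hqpos.le] at this
      refine (measure_mono h3).trans ?_
      rw [← ENNReal.ofReal_toReal (measure_ne_top P _)]
      exact ENNReal.ofReal_le_ofReal h2

/-! ### Events of probability tending to one -/

section Events

variable {Ω : ℕ → Type*} [∀ n, MeasurableSpace (Ω n)] {P : ∀ n, Measure (Ω n)}

theorem tendsto_zero_of_ofReal {f : ℕ → ENNReal}
    (h : ∀ ε : ℝ, 0 < ε → ∀ᶠ n in atTop, f n ≤ ENNReal.ofReal ε) : Tendsto f atTop (𝓝 0) := by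
  rw [ENNReal.tendsto_nhds_zero]
  intro ε hε
  obtain ⟨ε', h0, h1⟩ := ENNReal.lt_iff_exists_nnreal_btwn.1 hε
  have := h ε' (by exact_mod_cast h0)
  filter_upwards [this] with n hn
  rw [ENNReal.ofReal_coe_nnreal] at hn
  exact hn.trans h1.le

theorem WithProbToOne.eventually_le {E : ∀ n, Ω n → Prop} (h : WithProbToOne P E) {ε : ℝ}
    (hε : 0 < ε) : ∀ᶠ n in atTop, P n {ω | ¬ E n ω} ≤ ENNReal.ofReal ε :=
  ENNReal.tendsto_nhds_zero.1 h _ (ENNReal.ofReal_pos.2 hε)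

theorem WithProbToOne.mono {E F : ∀ n, Ω n → Prop} (h : WithProbToOne P E)
    (hEF : ∀ᶠ n in atTop, ∀ ω, E n ω → F n ω) : WithProbToOne P F := by
  refine tendsto_of_tendsto_of_tendsto_of_le_of_le' tendsto_const_nhds h
    (Eventually.of_forall fun n => zero_le) ?_
  filter_upwards [hEF] with n hn
  exact measure_mono fun ω hω hE => hω (hn ω hE)

theorem WithProbToOne.and {E F : ∀ n, Ω n → Prop} (hE : WithProbToOne P E)
    (hF : WithProbToOne P F) : WithProbToOne P fun n ω => E n ω ∧ F n ω := by
  have := hE.add hF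
  rw [add_zero] at this
  refine tendsto_of_tendsto_of_tendsto_of_le_of_le tendsto_const_nhds this
    (fun n => zero_le) fun n => ?_
  refine le_trans (measure_mono fun ω hω => ?_) (measure_union_le _ _)
  by_cases h : E n ω
  · exact Or.inr fun h' => hω ⟨h, h'⟩
  · exact Or.inl h

/-- `E n ω L` holds with a bound `L` that is stochastically bounded. -/
def WithBoundedConst (P : ∀ n, Measure (Ω n)) (E : ∀ n, Ω n → ℝ → Prop) : Prop :=
  ∀ ε : ℝ, 0 < ε → ∃ L : ℝ, 0 ≤ L ∧ ∀ᶠ n in atTop, P n {ω | ¬ E n ω L} ≤ ENNReal.ofReal ε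

theorem WithBoundedConst.mono {E F : ∀ n, Ω n → ℝ → Prop} (h : WithBoundedConst P E)
    (hEF : ∀ L, 0 ≤ L → ∃ L', 0 ≤ L' ∧ ∀ᶠ n in atTop, ∀ ω, E n ω L → F n ω L') :
    WithBoundedConst P F := by
  intro ε hε
  obtain ⟨L, hL, hE⟩ := h ε hε
  obtain ⟨L', hL', hF⟩ := hEF L hL
  refine ⟨L', hL', ?_⟩
  filter_upwards [hE, hF] with n h1 h2
  exact le_trans (measure_mono fun ω hω hE => hω (h2 ω hE)) h1

theorem WithBoundedConst.and {E : ∀ n, Ω n → ℝ → Prop} {F : ∀ n, Ω n → Prop}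
    (hE : WithBoundedConst P E) (hF : WithProbToOne P F) :
    WithBoundedConst P fun n ω L => E n ω L ∧ F n ω := by
  intro ε hε
  obtain ⟨L, hL, h1⟩ := hE (ε / 2) (by positivity)
  refine ⟨L, hL, ?_⟩
  filter_upwards [h1, hF.eventually_le (ε := ε / 2) (by positivity)] with n h1 h2
  calc P n {ω | ¬ (E n ω L ∧ F n ω)}
      ≤ P n ({ω | ¬ E n ω L} ∪ {ω | ¬ F n ω}) := measure_mono fun ω hω => by
        by_cases h : E n ω L
        · exact Or.inr fun h' => hω ⟨h, h'⟩
        · exact Or.inl h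
    _ ≤ ENNReal.ofReal (ε / 2) + ENNReal.ofReal (ε / 2) :=
        (measure_union_le _ _).trans (add_le_add h1 h2)
    _ = ENNReal.ofReal ε := by
        rw [← ENNReal.ofReal_add (by positivity) (by positivity), add_halves]

/-- No uniformity in `L` is needed, because `ε` fixes `L` before `n` grows. -/
theorem WithBoundedConst.withProbToOne {E : ∀ n, Ω n → ℝ → Prop} {F : ∀ n, Ω n → Prop}
    (hE : WithBoundedConst P E)
    (hEF : ∀ L, 0 ≤ L → ∀ᶠ n in atTop, ∀ ω, E n ω L → F n ω) : WithProbToOne P F := by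
  refine tendsto_zero_of_ofReal fun ε hε => ?_
  obtain ⟨L, hL, h1⟩ := hE ε hε
  filter_upwards [h1, hEF L hL] with n h1 h2
  exact le_trans (measure_mono fun ω hω hE => hω (h2 ω hE)) h1

end Events

/-! ### The rate of the reduced oracle estimator. -/

namespace Model

variable {n : ℕ} (D : Model n)

/-- `β` satisfies the constraint and the stationarity condition of the reduced oracle problem and
is within `L √((s + m - r) / n)` of `β*`. -/
def NearOracle (b : ℝ → ℝ) (y : Fin n → ℝ) (β : Fin D.p → ℝ) (L : ℝ) : Prop :=
  (∃ δ, β = D.beta + D.ext δ ∧ D.C0 *ᵥ δ = -D.h ∧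
    l2norm δ ≤ L * √(((D.s : ℝ) + D.m - D.r) / n)) ∧
  ∃ μ : Fin D.r → ℝ, D.subMS (grad b D.X y β) = D.C0ᵀ *ᵥ μ

variable {D}

theorem sqrt_dim_le : √(((D.s : ℝ) + D.m - D.r) / n) ≤ √(((D.s : ℝ) + D.m) / n) := by
  refine Real.sqrt_le_sqrt (div_le_div_of_nonneg_right ?_ (Nat.cast_nonneg n))
  linarith [Nat.cast_nonneg (α := ℝ) D.r]

theorem sqrt_radius_eq :
    √(((D.s : ℝ) + D.m) * Real.log n / n) = √(((D.s : ℝ) + D.m) / n) * √(Real.log n) := by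
  rw [← Real.sqrt_mul (by positivity)]
  congr 1
  ring

/-- The centre `β* + shift` is feasible, so the oracle differs from it by a vector in the kernel of
`[C 0]`, where the score bound `hG` applies; the norm of `shift` is then added. The radius of `N0`
exceeds `√((s + m) / n)` by the factor `√(log n)`, which leaves room for any constant. -/
theorem DesignEig.oracle_near {b : ℝ → ℝ} {c K : ℝ} (hD : D.DesignEig b c K) (hn : 1 < n)
    (hb : ContDiff ℝ 3 b) (hb2 : ∀ x, 0 ≤ iteratedDeriv 2 b x) (hc : 0 < c) (hK : 0 ≤ K)
    (hrank : D.C.rank = D.r) {y : Fin n → ℝ} {βo : Fin D.p → ℝ}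
    (ho : IsUniqueArgmin (loss b D.X y) (D.oracleSet ∩ D.constrained) βo) {L L' : ℝ}
    (hL : 0 ≤ L) (hL' : 0 ≤ L')
    (hG : ∀ v, D.C0 *ᵥ v = 0 → |D.subMS (grad b D.X y D.beta) ⬝ᵥ v|
      ≤ L * √(((D.s : ℝ) + D.m - D.r) / n) * l2norm v)
    (hd : l2norm D.shift ≤ L' * √(((D.s : ℝ) + D.m - D.r) / n))
    (hlog : 4 * (L' + 2 / c * (L + 3 / 2 * K * L')) ≤ √(Real.log n))
    (hsm : L' * (((D.s : ℝ) + D.m) / √(n : ℝ)) ≤ 1) :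
    ∃ δ, βo = D.beta + D.ext δ ∧ D.C0 *ᵥ δ = -D.h ∧
      l2norm δ ≤ (L' + 2 / c * (L + 3 / 2 * K * L')) * √(((D.s : ℝ) + D.m - D.r) / n) := by
  have hmem : βo ∈ argminOn (loss b D.X y) (D.oracleSet ∩ D.constrained) := by
    rw [ho]; rfl
  obtain ⟨⟨hoz, hoc⟩, homin⟩ := hmem
  have hβ := D.beta_add_ext hoz
  set δ := D.subMS βo - D.subMS D.beta with hδ
  have hCδ : D.C0 *ᵥ δ = -D.h := (D.beta_add_ext_mem_constrained δ).1 (hβ.symm ▸ hoc)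
  refine ⟨δ, hβ.symm, hCδ, ?_⟩
  set κ := √(((D.s : ℝ) + D.m - D.r) / n) with hκ
  have hκ0 : 0 ≤ κ := Real.sqrt_nonneg _
  set T := 2 / c * (L + 3 / 2 * K * L') with hT
  have hT0 : 0 ≤ T := by positivity
  -- For empty `M ∪ S` the radius of `N0` is zero and cannot serve the localisation, which needs `ρ
  -- > 0`.
  rcases Nat.eq_zero_or_pos (D.s + D.m) with h0 | hpos
  · have hempty : IsEmpty {j // j ∈ D.MS} := by
      rw [← D.card_MS, Finset.card_eq_zero] at h0
      rw [h0]
      infer_instance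
    rw [Subsingleton.elim δ 0, l2norm_zero]
    positivity
  have hn0 : (0 : ℝ) < n := by exact_mod_cast (by omega : 0 < n)
  have hσ : (0 : ℝ) < (D.s : ℝ) + D.m := by exact_mod_cast hpos
  set σ := √(((D.s : ℝ) + D.m) / n) with hσdef
  have hσ0 : 0 < σ := Real.sqrt_pos.2 (by positivity)
  have hκσ : κ ≤ σ := sqrt_dim_le
  have hlogpos : 0 < Real.log n := Real.log_pos (by exact_mod_cast hn)
  have hrad := sqrt_radius_eq (D := D)
  rw [← hσdef] at hrad
  have hTσ : (L' + T) * κ ≤ σ * √(Real.log n) / 4 := by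
    have h1 : (L' + T) * κ ≤ (L' + T) * σ := mul_le_mul_of_nonneg_left hκσ (by positivity)
    nlinarith [mul_le_mul_of_nonneg_left hlog hσ0.le]
  have h1 : L' * κ ≤ (L' + T) * κ := by nlinarith
  have h2 : T * κ ≤ (L' + T) * κ := by nlinarith
  have hbound : 2 / c * (L * κ + 3 / 2 * K * l2norm D.shift) ≤ T * κ := by
    have : 3 / 2 * K * l2norm D.shift ≤ 3 / 2 * K * (L' * κ) :=
      mul_le_mul_of_nonneg_left hd (by positivity)
    rw [hT, mul_assoc (2 / c)]
    refine mul_le_mul_of_nonneg_left ?_ (by positivity)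
    linarith
  -- `ρ` is half the radius of `N0`. The factor `4` in `hlog` arises from this half and the half in
  -- the smallness condition.
  have hv := hD.l2norm_le_of_loss_le (by omega) hb hb2 hc hK (y := y) (d := D.shift)
    (v := δ - D.shift) (G := L * κ) (ρ := σ * √(Real.log n) / 2) (by positivity)
    ((neg_le_abs _).trans (hG _ (by
      rw [Matrix.mulVec_sub, hCδ, C0_mulVec_shift hrank, sub_self])))
    (by
      rw [add_sub_cancel, hβ]
      exact homin _ ⟨D.beta_add_ext_mem_oracleSet _,
        (D.beta_add_ext_mem_constrained _).2 (C0_mulVec_shift hrank)⟩)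
    (by have := Real.sqrt_pos.2 hlogpos; positivity)
    (by
      have := mul_nonneg hσ0.le (Real.sqrt_nonneg (Real.log n))
      linarith)
    (by rw [hrad]; linarith)
    (by
      refine le_trans ?_ hsm
      have h3 : l2norm D.shift ≤ L' * σ := hd.trans (mul_le_mul_of_nonneg_left hκσ hL')
      refine (mul_le_mul_of_nonneg_left h3 (Real.sqrt_nonneg _)).trans (le_of_eq ?_)
      rw [hσdef, Real.sqrt_div hσ.le, mul_left_comm, mul_div_assoc',
        Real.mul_self_sqrt hσ.le])
    (by linarith)
  have h4 := l2norm_add_le D.shift (δ - D.shift)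
  rw [add_sub_cancel] at h4
  linarith

end Model

/-! ### Sequences of experiments: from deterministic bounds to stochastic orders. -/

section Sequence

variable {b : ℝ → ℝ} {D : ∀ n, Model n} {Ω : ℕ → Type*} [∀ n, MeasurableSpace (Ω n)]
  {P : ∀ n, Measure (Ω n)} {y : ∀ n, Ω n → Fin n → ℝ}

theorem tendsto_dim_div_sqrt
    (hsm : (fun n => ((D n).s : ℝ) + (D n).m) =o[atTop] fun n : ℕ => (n : ℝ) ^ (1 / 2 : ℝ)) :
    Tendsto (fun n : ℕ => (((D n).s : ℝ) + (D n).m) / √(n : ℝ)) atTop (𝓝 0) := by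
  simpa only [Real.sqrt_eq_rpow] using hsm.tendsto_div_nhds_zero

theorem eventually_mul_le_one
    (hsm : (fun n => ((D n).s : ℝ) + (D n).m) =o[atTop] fun n : ℕ => (n : ℝ) ^ (1 / 2 : ℝ))
    (L : ℝ) : ∀ᶠ n : ℕ in atTop, L * ((((D n).s : ℝ) + (D n).m) / √(n : ℝ)) ≤ 1 := by
  have := (tendsto_dim_div_sqrt hsm).const_mul L
  rw [mul_zero] at this
  exact this.eventually_le_const zero_lt_one

theorem eventually_le_sqrt_log (L : ℝ) : ∀ᶠ n : ℕ in atTop, L ≤ √(Real.log n) :=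
  ((Real.tendsto_sqrt_atTop.comp Real.tendsto_log_atTop).comp
    tendsto_natCast_atTop_atTop).eventually_ge_atTop L

theorem eventually_rate_le {lam : ℕ → ℝ} (hlam : ∀ n, 0 < lam n)
    (hlamrate : (fun n : ℕ => max (√(((D n).s : ℝ) + (D n).m)) (√(Real.log (D n).p)) / √(n : ℝ))
      =o[atTop] lam) (L : ℝ) :
    ∀ᶠ n : ℕ in atTop, L * (max (√(((D n).s : ℝ) + (D n).m)) (√(Real.log (D n).p)) / √(n : ℝ))
      ≤ lam n := by
  filter_upwards [hlamrate.def (c := 1 / (|L| + 1)) (by positivity)] with n hn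
  rw [Real.norm_eq_abs, Real.norm_eq_abs, abs_of_pos (hlam n)] at hn
  set R := max (√(((D n).s : ℝ) + (D n).m)) (√(Real.log (D n).p)) / √(n : ℝ)
  have h1 : (|L| + 1) * |R| ≤ lam n := by
    rw [div_mul_eq_mul_div, one_mul, le_div_iff₀ (by positivity)] at hn
    linarith
  have h2 : L * R ≤ |L| * |R| := by rw [← abs_mul]; exact le_abs_self _
  have := abs_nonneg R
  linarith

theorem eventually_mul_sqrt_le {lam : ℕ → ℝ} (hlam : ∀ n, 0 < lam n)
    (hlamrate : (fun n : ℕ => max (√(((D n).s : ℝ) + (D n).m)) (√(Real.log (D n).p)) / √(n : ℝ))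
      =o[atTop] lam) {L : ℝ} (hL : 0 ≤ L) :
    ∀ᶠ n : ℕ in atTop, L * √((((D n).s : ℝ) + (D n).m) / n) ≤ lam n := by
  filter_upwards [eventually_rate_le hlam hlamrate L] with n hn
  refine le_trans (mul_le_mul_of_nonneg_left ?_ hL) hn
  rw [Real.sqrt_div (by positivity)]
  exact div_le_div_of_nonneg_right (le_max_left _ _) (Real.sqrt_nonneg _)

/-- The reduced oracle estimator has the rate `√((s + m - r) / n)`. -/
theorem withBoundedConst_oracle {φ : ℝ} {ν : Measure ℝ} {c : ℝ → ℝ} (hfam : IsExpFamily b φ ν c)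
    [∀ n, IsProbabilityMeasure (P n)]
    (hy : ∀ n, IsGLMResponse b φ ν c ((D n).X *ᵥ (D n).beta) (P n) (y n))
    (hb2 : ∀ x, 0 ≤ iteratedDeriv 2 b x)
    (hsm : (fun n => ((D n).s : ℝ) + (D n).m) =o[atTop] fun n : ℕ => (n : ℝ) ^ (1 / 2 : ℝ))
    (hred : WithProbToOne P fun n ω => (D n).ReducedOracle b (y n ω))
    (hCrank : ∀ᶠ n in atTop, (D n).C.rank = (D n).r)
    (hCeig : ∃ K : ℝ, ∀ᶠ n in atTop, EigLE ((D n).C * (D n).Cᵀ)⁻¹ K)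
    (hhrate : (fun n => l2norm (D n).h) =O[atTop]
      fun n : ℕ => √(min (((D n).s : ℝ) + (D n).m - (D n).r) ((D n).r : ℝ) / n))
    {c₀ K : ℝ} (hc₀ : 0 < c₀) (hK : 0 ≤ K) (hdesign : ∀ᶠ n in atTop, (D n).DesignEig b c₀ K) :
    WithBoundedConst P fun n ω L => ∃ βo,
      IsUniqueArgmin (loss b (D n).X (y n ω)) ((D n).oracleSet ∩ (D n).constrained) βo ∧
      (D n).NearOracle b (y n ω) βo L := by
  obtain ⟨Lc, hLc⟩ := hCeig
  obtain ⟨H, hH0, hH⟩ := hhrate.exists_nonneg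
  have hproj : WithBoundedConst P fun n ω L => ∀ v, (D n).C0 *ᵥ v = 0 →
      |(D n).subMS (grad b (D n).X (y n ω) (D n).beta) ⬝ᵥ v|
        ≤ L * √((((D n).s : ℝ) + (D n).m - (D n).r) / n) * l2norm v := by
    intro ε hε
    have hφ := hfam.phi_pos
    -- Chosen so that the Markov bound `φ K / L²` is at most `ε`; adding `1` keeps `L` positive when
    -- `K = 0`.
    refine ⟨√(φ * K / ε) + 1, by positivity, ?_⟩
    filter_upwards [hdesign, hCrank, eventually_gt_atTop 0] with n hDn hrank hn
    obtain ⟨G, hG0, hG, hPG⟩ := Model.exists_projection_bound hfam hn hDn (hy n)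
      (LinearMap.ker (D n).C0.mulVecLin)
    rw [Model.finrank_ker_C0 hrank] at hPG
    refine le_trans (measure_mono fun ω hω => ?_)
      ((hPG (√(φ * K / ε) + 1) (by positivity)).trans (ENNReal.ofReal_le_ofReal ?_))
    · rw [Set.mem_ofPred_eq] at hω ⊢
      by_contra hle
      refine hω fun v hv => (hG ω v hv).trans ?_
      exact mul_le_mul_of_nonneg_right (not_lt.1 hle) (l2norm_nonneg v)
    · rw [div_le_iff₀ (by positivity)]
      have h1 := Real.sq_sqrt (by positivity : 0 ≤ φ * K / ε)
      have h2 : φ * K = ε * (φ * K / ε) := by field_simp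
      nlinarith [Real.sqrt_nonneg (φ * K / ε)]
  set L' := √(max Lc 0) * H with hL'
  have hL'0 : 0 ≤ L' := by positivity
  refine (hproj.and hred).mono fun L hL => ?_
  refine ⟨L' + 2 / c₀ * (L + 3 / 2 * K * L'), by positivity, ?_⟩
  filter_upwards [hdesign, hCrank, hLc, hH.bound, eventually_gt_atTop 1,
    eventually_le_sqrt_log (4 * (L' + 2 / c₀ * (L + 3 / 2 * K * L'))),
    eventually_mul_le_one hsm L'] with n hDn hrank hLcn hHn hn hlog hsmn
  rintro ω ⟨hG, βo, ho, μ, hμ⟩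
  refine ⟨βo, ho, hDn.oracle_near hn hfam.contDiff hb2 hc₀ hK hrank ho hL hL'0 hG ?_ hlog hsmn,
    μ, hμ⟩
  refine (Model.l2norm_shift_le hrank (le_max_right Lc 0) (hLcn.mono (le_max_left _ _))).trans ?_
  rw [hL', mul_assoc]
  refine mul_le_mul_of_nonneg_left ?_ (Real.sqrt_nonneg _)
  rw [Real.norm_eq_abs, Real.norm_eq_abs, abs_of_nonneg (l2norm_nonneg _),
    abs_of_nonneg (Real.sqrt_nonneg _)] at hHn
  refine hHn.trans (mul_le_mul_of_nonneg_left (Real.sqrt_le_sqrt ?_) hH0)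
  exact div_le_div_of_nonneg_right (min_le_left _ _) (Nat.cast_nonneg n)

/-- The two-step solution coincides with the oracle estimator. -/
theorem withBoundedConst_twoStep (hb : ContDiff ℝ 3 b) (hb2 : ∀ x, 0 ≤ iteratedDeriv 2 b x)
    (hsm : (fun n => ((D n).s : ℝ) + (D n).m) =o[atTop] fun n : ℕ => (n : ℝ) ^ (1 / 2 : ℝ))
    {pen : ℝ → ℝ → ℝ} {a a₁ a₂ : ℝ} (ha₁ : 0 < a₁)
    (hpen : ∀ l, 0 < l → IsFoldedConcave (pen l) l a a₁ a₂)
    {lam : ℕ → ℝ} (hlam : ∀ n, 0 < lam n)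
    (hsignal : ∀ᶠ n in atTop, ∀ j ∈ (D n).S, (a + 1) * lam n < |(D n).beta j|)
    (hlamrate : (fun n : ℕ => max (√(((D n).s : ℝ) + (D n).m)) (√(Real.log (D n).p)) / √(n : ℝ))
      =o[atTop] lam)
    {c₀ K : ℝ} (hK : 0 ≤ K) (hdesign : ∀ᶠ n in atTop, (D n).DesignEig b c₀ K)
    (horacle : WithBoundedConst P fun n ω L => ∃ βo,
      IsUniqueArgmin (loss b (D n).X (y n ω)) ((D n).oracleSet ∩ (D n).constrained) βo ∧
      (D n).NearOracle b (y n ω) βo L)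
    {betaL beta0 : ∀ n, Ω n → Fin (D n).p → ℝ}
    (hlasso : WithProbToOne P fun n ω =>
      ∀ j, |betaL n ω j - (D n).beta j| ≤ min 1 a₂ * lam n)
    (hgrad : WithProbToOne P fun n ω =>
      ∀ j, |grad b (D n).X (y n ω) (D n).beta j| ≤ a₁ / 2 * lam n)
    (hbeta0 : ∀ n ω, (D n).IsTwoStepLLA b (pen (lam n)) (y n ω) (D n).constrained
      (betaL n ω) (beta0 n ω)) :
    WithBoundedConst P fun n ω L => (D n).NearOracle b (y n ω) (beta0 n ω) L := by
  refine ((horacle.and hlasso).and hgrad).mono fun L hL => ⟨L, hL, ?_⟩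
  filter_upwards [hdesign, hsignal, eventually_gt_atTop 0, eventually_le_sqrt_log L,
    eventually_mul_le_one hsm (L ^ 2), eventually_mul_sqrt_le hlam hlamrate hL,
    eventually_mul_sqrt_le hlam hlamrate (L := 6 * K * L / a₁) (by positivity)]
    with n hDn hsig hn hlog hone hlam1 hlam2
  rintro ω ⟨⟨⟨βo, ho, hnear⟩, hLn⟩, hgn⟩
  have hn' : (1 : ℝ) ≤ n := by exact_mod_cast hn
  obtain ⟨⟨δ, hδ, -, hδn⟩, μ, hμ⟩ := id hnear
  set σ := √((((D n).s : ℝ) + (D n).m) / n) with hσ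
  have hδσ : l2norm δ ≤ L * σ := hδn.trans (mul_le_mul_of_nonneg_left Model.sqrt_dim_le hL)
  have hδrad : l2norm δ ≤ √((((D n).s : ℝ) + (D n).m) * Real.log n / n) := by
    rw [Model.sqrt_radius_eq, ← hσ]
    nlinarith [mul_le_mul_of_nonneg_left hlog (Real.sqrt_nonneg ((((D n).s : ℝ) + (D n).m) / n))]
  -- This uses `L² (s + m) / n ≤ L² (s + m) / √n ≤ 1`, and lets the quadratic gradient remainder be
  -- absorbed in the linear term.
  have hδ1 : l2norm δ ≤ 1 := by
    refine hδσ.trans (abs_le_of_sq_le_sq' ?_ zero_le_one).2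
    rw [mul_pow, hσ, Real.sq_sqrt (by positivity), one_pow]
    refine le_trans (mul_le_mul_of_nonneg_left ?_ (sq_nonneg L)) hone
    refine div_le_div_of_nonneg_left (by positivity) (Real.sqrt_pos.2 (by linarith)) ?_
    rw [Real.sqrt_le_left (by linarith)]
    nlinarith
  have heq : beta0 n ω = βo := by
    refine (D n).lla_two_step hb hb2 (hpen _ (hlam n)) hsig ho hμ (fun j hj => ?_) (fun j _ => ?_)
      hLn (hlam n) (hbeta0 n ω)
    · have h1 := hDn.abs_grad_le_of_notMem hn hb (y n ω) hδrad hj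
      rw [← hδ] at h1
      have h2 : K * l2norm δ ^ 2 ≤ K * l2norm δ := by
        refine mul_le_mul_of_nonneg_left ?_ hK
        nlinarith [l2norm_nonneg δ]
      have h3 : K * l2norm δ ≤ K * (L * σ) := mul_le_mul_of_nonneg_left hδσ hK
      -- The gradient off `M ∪ S` is at most `a₁ λ / 2 + 3/2 K ‖δ‖`; with the factor `6` this is at
      -- most `3/4 a₁ λ`, which is strictly below `a₁ λ`.
      have h4 : 6 * K * (L * σ) ≤ a₁ * lam n := by
        rw [div_mul_eq_mul_div, div_le_iff₀ ha₁] at hlam2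
        linarith
      have h5 := hgn j
      have h6 : 0 < a₁ * lam n := mul_pos ha₁ (hlam n)
      linarith
    · rw [hδ, Pi.add_apply, add_sub_cancel_left]
      by_cases hj : j ∈ (D n).MS
      · exact ((abs_le_l2norm δ ⟨j, hj⟩).trans_eq' (by
          rw [← (D n).ext_apply_mem δ ⟨j, hj⟩])).trans (hδσ.trans hlam1)
      · rw [(D n).ext_apply_notMem δ hj, abs_zero]
        exact (hlam n).le
  rw [heq]
  exact hnear

/-! ### Consequences of being near the oracle -/

variable {beta0 : ∀ n, Ω n → Fin (D n).p → ℝ}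
  (hnear : WithBoundedConst P fun n ω L => (D n).NearOracle b (y n ω) (beta0 n ω) L)
include hnear

theorem isBigOp_of_nearOracle :
    IsBigOp P (fun n ω => l2norm ((D n).subMS (beta0 n ω) - (D n).subMS (D n).beta))
      (fun n => √((((D n).s : ℝ) + (D n).m - (D n).r) / n)) := by
  intro ε hε
  obtain ⟨L, hL, h⟩ := hnear ε hε
  refine ⟨L + 1, by positivity, ?_⟩
  filter_upwards [h] with n hn
  refine hn.trans' (measure_mono fun ω hω => ?_)
  rintro ⟨⟨δ, hδ, -, hδn⟩, -⟩
  rw [Set.mem_ofPred_eq, hδ, Model.subMS_add, Model.subMS_ext, add_sub_cancel_left,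
    abs_of_nonneg (l2norm_nonneg _)] at hω
  have := Real.sqrt_nonneg ((((D n).s : ℝ) + (D n).m - (D n).r) / n)
  linarith

theorem selection_of_nearOracle :
    WithProbToOne P fun n ω => ∀ j, j ∉ (D n).MS → beta0 n ω j = 0 := by
  refine hnear.withProbToOne fun L _ => Eventually.of_forall fun n ω hN j hj => ?_
  obtain ⟨⟨δ, hδ, -, -⟩, -⟩ := hN
  rw [hδ]
  exact (D n).beta_add_ext_mem_oracleSet δ j hj

/-- With `σ = s + m` and `‖δ‖ ≤ L √(σ / n)`, the gradient remainder is at most `√σ K L² σ / (2 n)`.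
Multiplied by `√n / c₀` it is a constant times `√(σ³ / n)`, which tends to zero exactly under the
cube-root condition. -/
theorem expansion_of_nearOracle (hb : ContDiff ℝ 3 b)
    (hsm : (fun n => ((D n).s : ℝ) + (D n).m) =o[atTop] fun n : ℕ => (n : ℝ) ^ (1 / 3 : ℝ))
    (hCrank : ∀ᶠ n in atTop, (D n).C.rank = (D n).r)
    {c₀ K : ℝ} (hc₀ : 0 < c₀) (hK : 0 ≤ K) (hdesign : ∀ᶠ n in atTop, (D n).DesignEig b c₀ K) :
    IsLittleOpOne P (fun n ω =>
        √(n : ℝ) • ((D n).subMS (beta0 n ω) - (D n).subMS (D n).beta)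
        - (√(n : ℝ) • ((invSqrtMat ((D n).K b) * ((D n).Pn b - 1)
              * invSqrtMat ((D n).K b))
              *ᵥ (D n).subMS (grad b (D n).X (y n ω) (D n).beta))
          - √(n : ℝ) • ((invSqrtMat ((D n).K b) * (D n).Pn b * sqrtMat ((D n).K b))
              *ᵥ ((D n).C0ᵀ *ᵥ (((D n).C * (D n).Cᵀ)⁻¹ *ᵥ (D n).h))))) := by
  intro ε hε
  have hcube : Tendsto (fun n : ℕ => √((((D n).s : ℝ) + (D n).m) ^ 3 / n)) atTop (𝓝 0) := by
    have h1 := (hsm.tendsto_div_nhds_zero.pow 3).sqrt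
    rw [zero_pow three_ne_zero, Real.sqrt_zero] at h1
    refine h1.congr fun n => ?_
    have h2 : ((n : ℝ) ^ (1 / 3 : ℝ)) ^ 3 = n := by
      rw [← Real.rpow_natCast, ← Real.rpow_mul (Nat.cast_nonneg n)]
      norm_num
    rw [div_pow, h2]
  have := hnear.withProbToOne (F := fun n ω => l2norm (
        √(n : ℝ) • ((D n).subMS (beta0 n ω) - (D n).subMS (D n).beta)
        - (√(n : ℝ) • ((invSqrtMat ((D n).K b) * ((D n).Pn b - 1)
              * invSqrtMat ((D n).K b))
              *ᵥ (D n).subMS (grad b (D n).X (y n ω) (D n).beta))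
          - √(n : ℝ) • ((invSqrtMat ((D n).K b) * (D n).Pn b * sqrtMat ((D n).K b))
              *ᵥ ((D n).C0ᵀ *ᵥ (((D n).C * (D n).Cᵀ)⁻¹ *ᵥ (D n).h))))) ≤ ε) fun L hL => ?_
  · simpa only [WithProbToOne, not_le] using this
  have hlim := hcube.const_mul (K * L ^ 2 / (2 * c₀))
  rw [mul_zero] at hlim
  filter_upwards [hdesign, hCrank, eventually_gt_atTop 0, eventually_le_sqrt_log L,
    hlim.eventually_le_const hε] with n hDn hrank hn hlog hlimn
  rintro ω ⟨⟨δ, hδ, hCδ, hδn⟩, μ, hμ⟩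
  have hn' : (0 : ℝ) < n := by exact_mod_cast hn
  rw [hδ] at hμ
  rw [hδ, Model.subMS_add, Model.subMS_ext, add_sub_cancel_left, ← smul_sub, ← smul_sub,
    l2norm_smul, abs_of_nonneg (Real.sqrt_nonneg _)]
  set σ := ((D n).s : ℝ) + (D n).m with hσ
  have hσ0 : 0 ≤ σ := by positivity
  have hδσ : l2norm δ ≤ L * √(σ / n) :=
    hδn.trans (mul_le_mul_of_nonneg_left Model.sqrt_dim_le hL)
  have hδrad : l2norm δ ≤ √(σ * Real.log n / n) := by
    rw [hσ, Model.sqrt_radius_eq, ← hσ]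
    nlinarith [mul_le_mul_of_nonneg_left hlog (Real.sqrt_nonneg (σ / n))]
  set g := (D n).subMS (grad b (D n).X (y n ω) (D n).beta) with hg
  set R := (D n).subMS (grad b (D n).X (y n ω) ((D n).beta + (D n).ext δ)) - g
    - (D n).K b *ᵥ δ with hR
  have h1 : g + (D n).K b *ᵥ δ + R = (D n).C0ᵀ *ᵥ μ := by
    rw [← hμ, hR]
    abel
  have h2 := hDn.l2norm_sub_leading_le hrank hn hc₀ h1 hCδ
  have h3 : l2norm R ≤ √σ * (K * l2norm δ ^ 2 / 2) := hDn.l2norm_grad_sub_le hn hb (y n ω) hδrad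
  have h4 : l2norm δ ^ 2 ≤ L ^ 2 * (σ / n) := by
    have := pow_le_pow_left₀ (l2norm_nonneg δ) hδσ 2
    rwa [mul_pow, Real.sq_sqrt (by positivity)] at this
  have h5 : l2norm R ≤ √σ * (K * (L ^ 2 * (σ / n)) / 2) :=
    h3.trans (mul_le_mul_of_nonneg_left (by
      have := mul_le_mul_of_nonneg_left h4 hK
      linarith) (Real.sqrt_nonneg _))
  refine le_trans (mul_le_mul_of_nonneg_left (h2.trans (div_le_div_of_nonneg_right h5 hc₀.le))
    (Real.sqrt_nonneg _)) (le_trans (le_of_eq ?_) hlimn)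
  have h6 : √(σ ^ 3 / n) = √(n : ℝ) * √σ * (σ / n) := by
    rw [Real.sqrt_eq_iff_mul_self_eq (by positivity) (by positivity)]
    symm
    calc √(n : ℝ) * √σ * (σ / n) * (√(n : ℝ) * √σ * (σ / n))
        = (√(n : ℝ) * √(n : ℝ)) * (√σ * √σ) * (σ / n) ^ 2 := by ring
      _ = σ ^ 3 / n := by
        rw [Real.mul_self_sqrt hn'.le, Real.mul_self_sqrt hσ0]
        field_simp
  rw [h6]
  field_simp

end Sequence

/-! ### Uniform bounds on the gradient at `β*`. -/

section Gradient

variable {b : ℝ → ℝ} {D : ∀ n, Model n} {Ω : ℕ → Type*} [∀ n, MeasurableSpace (Ω n)]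
  {P : ∀ n, Measure (Ω n)} {y : ∀ n, Ω n → Fin n → ℝ} [∀ n, IsProbabilityMeasure (P n)]
  {φ : ℝ} {ν : Measure ℝ} {c : ℝ → ℝ} (hfam : IsExpFamily b φ ν c)
  (hy : ∀ n, IsGLMResponse b φ ν c ((D n).X *ᵥ (D n).beta) (P n) (y n))
  {B₁ B₂ : ℝ} (hB₁ : 0 < B₁) (hB₂ : 0 < B₂)
  (hcol : ∀ᶠ n in atTop, (D n).DesignColumns B₁ B₂)
  {M₀ v₀ : ℝ} (hM₀ : 0 < M₀) (hv₀ : 0 < v₀)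
  (htail : ∀ᶠ n in atTop, ∀ i,
    ∫⁻ ω, ENNReal.ofReal
      ((Real.exp (|y n ω i - deriv b (((D n).X *ᵥ (D n).beta) i)| / M₀) - 1
        - |y n ω i - deriv b (((D n).X *ᵥ (D n).beta) i)| / M₀) * M₀ ^ 2) ∂(P n)
      ≤ ENNReal.ofReal (v₀ / 2))
include hfam hy hB₁ hB₂ hcol hM₀ hv₀ htail

theorem withProbToOne_grad_le {x : ℕ → ℝ} (hx : ∀ n, 0 ≤ x n)
    (hlim : Tendsto (fun n : ℕ => 2 * ((D n).p : ℝ) * Real.exp (-(1 / 2) *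
      (n * x n ^ 2 / (B₁ * v₀ + B₂ * M₀ * √(n / Real.log (D n).p) * x n)))) atTop (𝓝 0)) :
    WithProbToOne P fun n ω => ∀ j, |grad b (D n).X (y n ω) (D n).beta j| ≤ x n := by
  have := ENNReal.tendsto_ofReal hlim
  rw [ENNReal.ofReal_zero] at this
  refine tendsto_of_tendsto_of_tendsto_of_le_of_le' tendsto_const_nhds this
    (Eventually.of_forall fun n => zero_le) ?_
  filter_upwards [hcol, htail, eventually_gt_atTop 0] with n hc ht hn
  exact (D n).measure_grad_gt_le hfam hn (hy n) hB₁ hB₂ hM₀ hv₀ hc ht (hx n)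

/-- Put `w = √(n / log p) x`. Since `√(log p / n) = o(λ)`, `w` eventually exceeds any `T`. For `w ≥
1` the Bernstein exponent is at least `w log p / (2 Q)`, which beats the `log p` of the union bound.
The dimension `p` need not diverge: `log p ≥ log 2` suffices because `T` is arbitrary. -/
theorem withProbToOne_grad_le_lam (hp : ∀ᶠ n in atTop, 2 ≤ (D n).p) {lam : ℕ → ℝ}
    (hlam : ∀ n, 0 < lam n)
    (hlamrate : (fun n : ℕ => max (√(((D n).s : ℝ) + (D n).m)) (√(Real.log (D n).p)) / √(n : ℝ))
      =o[atTop] lam) {k : ℝ} (hk : 0 < k) :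
    WithProbToOne P fun n ω =>
      ∀ j, |grad b (D n).X (y n ω) (D n).beta j| ≤ k * lam n := by
  refine withProbToOne_grad_le hfam hy hB₁ hB₂ hcol hM₀ hv₀ htail
    (fun n => (mul_pos hk (hlam n)).le) ?_
  set Q := B₁ * v₀ + B₂ * M₀ with hQ
  have hQ0 : 0 < Q := by positivity
  have hlog2 : 0 < Real.log 2 := Real.log_pos one_lt_two
  have hmaj : Tendsto (fun T : ℝ => 2 * Real.exp (-((T / (2 * Q) - 1) * Real.log 2))) atTop
      (𝓝 0) := by
    have h1 : Tendsto (fun T : ℝ => (T / (2 * Q) - 1) * Real.log 2) atTop atTop :=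
      (tendsto_atTop_add_const_right _ (-1)
        (tendsto_id.atTop_div_const (by positivity : 0 < 2 * Q))).atTop_mul_const hlog2
    have h2 := (Real.tendsto_exp_neg_atTop_nhds_zero.comp h1).const_mul 2
    simpa using h2
  rw [tendsto_order]
  refine ⟨fun e he => Eventually.of_forall fun n => lt_of_lt_of_le he (by positivity),
    fun e he => ?_⟩
  obtain ⟨T, hTe, hT1, hTQ⟩ := ((hmaj.eventually_lt_const he).and
    ((eventually_ge_atTop 1).and (eventually_ge_atTop (2 * Q)))).exists
  filter_upwards [hp, eventually_gt_atTop 0, eventually_rate_le hlam hlamrate (T / k)]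
    with n hpn hn hrate
  refine lt_of_le_of_lt ?_ hTe
  have hn' : (0 : ℝ) < n := by exact_mod_cast hn
  have hp2 : (2 : ℝ) ≤ (D n).p := by exact_mod_cast hpn
  set ℓ := Real.log (D n).p with hℓ
  have hℓ2 : Real.log 2 ≤ ℓ := Real.log_le_log two_pos hp2
  have hℓ0 : 0 < ℓ := hlog2.trans_le hℓ2
  set x := k * lam n with hx
  have hx0 : 0 < x := mul_pos hk (hlam n)
  set w := √(n / ℓ) * x with hw
  have hwT : T ≤ w := by
    have h1 : T / k * (√ℓ / √(n : ℝ)) ≤ lam n := by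
      refine le_trans (mul_le_mul_of_nonneg_left ?_ (by positivity)) hrate
      exact div_le_div_of_nonneg_right (le_max_right _ _) (Real.sqrt_nonneg _)
    have h2 : T * (√ℓ / √(n : ℝ)) ≤ x := by
      rw [hx]
      have := mul_le_mul_of_nonneg_left h1 hk.le
      rwa [← mul_assoc, mul_div_cancel₀ _ hk.ne'] at this
    have h3 : √(n / ℓ) * (√ℓ / √(n : ℝ)) = 1 := by
      rw [Real.sqrt_div hn'.le]
      have := (Real.sqrt_pos.2 hℓ0).ne'
      have := (Real.sqrt_pos.2 hn').ne'
      field_simp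
    have := mul_le_mul_of_nonneg_left h2 (Real.sqrt_nonneg (n / ℓ))
    calc T = √(n / ℓ) * (T * (√ℓ / √(n : ℝ))) := by rw [mul_left_comm, h3, mul_one]
      _ ≤ w := this
  have hw1 : 1 ≤ w := hT1.trans hwT
  have hnx : n * x ^ 2 = w ^ 2 * ℓ := by
    rw [hw, mul_pow √(n / ℓ) x, Real.sq_sqrt (by positivity)]
    field_simp
  have hden : B₁ * v₀ + B₂ * M₀ * √(n / ℓ) * x ≤ Q * w := by
    rw [mul_assoc, ← hw, hQ]
    nlinarith [mul_pos hB₁ hv₀]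
  have hE : T * ℓ / Q ≤ n * x ^ 2 / (B₁ * v₀ + B₂ * M₀ * √(n / ℓ) * x) := by
    rw [hnx, div_le_div_iff₀ hQ0 (by positivity)]
    calc T * ℓ * (B₁ * v₀ + B₂ * M₀ * √(n / ℓ) * x) ≤ T * ℓ * (Q * w) :=
          mul_le_mul_of_nonneg_left hden (by positivity)
      _ ≤ w * ℓ * (Q * w) := by gcongr
      _ = w ^ 2 * ℓ * Q := by ring
  have hpexp : ((D n).p : ℝ) = Real.exp ℓ := (Real.exp_log (by linarith)).symm
  rw [mul_assoc, hpexp, ← Real.exp_add]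
  refine mul_le_mul_of_nonneg_left (Real.exp_le_exp.2 ?_) zero_le_two
  have h4 : 0 ≤ T / (2 * Q) - 1 := sub_nonneg.2 ((one_le_div (by positivity)).2 hTQ)
  have h5 := mul_le_mul_of_nonneg_left hℓ2 h4
  have h6 : T * ℓ / Q = 2 * (T / (2 * Q) * ℓ) := by field_simp
  linarith

/-- At level `lamL / 2` the Bernstein constant `1/2` becomes `1/2 * 1/4 = 1/8`. -/
theorem withProbToOne_grad_le_lasso {lamL : ℕ → ℝ} (hlamL : ∀ n, 0 < lamL n)
    (hlamLprob : Tendsto (fun n : ℕ => 2 * ((D n).p : ℝ) * Real.exp (-(1 / 8) *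
      ((n : ℝ) * lamL n ^ 2 /
        (B₁ * v₀ + 1 / 2 * B₂ * M₀ * √(n / Real.log (D n).p) * lamL n)))) atTop (𝓝 0)) :
    WithProbToOne P fun n ω =>
      ∀ j, |grad b (D n).X (y n ω) (D n).beta j| ≤ lamL n / 2 := by
  refine withProbToOne_grad_le hfam hy hB₁ hB₂ hcol hM₀ hv₀ htail
    (fun n => (half_pos (hlamL n)).le) (hlamLprob.congr fun n => ?_)
  congr 2
  rw [show B₂ * M₀ * √(n / Real.log (D n).p) * (lamL n / 2)
    = 1 / 2 * B₂ * M₀ * √(n / Real.log (D n).p) * lamL n by ring]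
  ring

end Gradient

/-! ### The full model as a reduced model with no constraints. -/

namespace Model

variable {n : ℕ} (D : Model n)

/-- The model without constraint. -/
def full : Model n where
  p := D.p
  X := D.X
  beta := D.beta
  M := D.M
  r := 0
  C := 0
  t := 0

theorem full_constrained : D.full.constrained = Set.univ :=
  Set.eq_univ_of_forall fun _ => Subsingleton.elim (α := Fin 0 → ℝ) _ _

theorem full_reducedOracle {b : ℝ → ℝ} {y : Fin n → ℝ} (h : D.FullOracle b y) :
    D.full.ReducedOracle b y := by
  obtain ⟨β, h1, h2⟩ := h
  refine ⟨β, ?_, 0, ?_⟩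
  · rw [full_constrained, Set.inter_univ]
    exact h1
  · rw [Matrix.mulVec_zero]
    exact h2

theorem full_rank : D.full.C.rank = D.full.r :=
  Matrix.rank_zero

/-- The product factors through the zero-dimensional constraint space. The reduced expansion then
collapses to `-K_n⁻¹` applied to the score. -/
theorem full_Pn (b : ℝ → ℝ) : D.full.Pn b = 0 := by
  have h : invSqrtMat (D.full.K b) * D.full.C0ᵀ = 0 := by
    ext i j
    exact Fin.elim0 j
  rw [Pn, h, Matrix.zero_mul, Matrix.zero_mul, Matrix.zero_mul]

end Model

end PPGLM

/-! ### Assembly for the reduced and the full model. -/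

theorem mainTheorem8
    -- the exponential family
    (b : ℝ → ℝ) (φ : ℝ) (ν : Measure ℝ) (c : ℝ → ℝ) (hfam : PPGLM.IsExpFamily b φ ν c)
    -- the experiments: fixed design, independent responses from the generalized linear model
    (D : ∀ n, PPGLM.Model n)
    (Ω : ℕ → Type*) [∀ n, MeasurableSpace (Ω n)] (P : ∀ n, Measure (Ω n))
    [∀ n, IsProbabilityMeasure (P n)]
    (y : ∀ n, Ω n → Fin n → ℝ)
    (hymeas : ∀ n i, Measurable fun ω => y n ω i)
    (hyindep : ∀ n, iIndepFun (fun i ω => y n ω i) (P n))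
    (hylaw : ∀ n i, (P n).map (fun ω => y n ω i)
      = PPGLM.expLaw b φ ν c (((D n).X *ᵥ (D n).beta) i))
    -- dimensions
    (hp : ∀ᶠ n in atTop, 2 ≤ (D n).p)
    (hlogp : ∃ η : ℝ, 0 < η ∧ η < 1 ∧
      (fun n => Real.log (D n).p) =O[atTop] fun n : ℕ => (n : ℝ) ^ η)
    (hsm : (fun n => ((D n).s : ℝ) + (D n).m) =o[atTop] fun n : ℕ => (n : ℝ) ^ (1 / 2 : ℝ))
    -- the folded-concave penalties and the penalty parameter
    (pen : ℝ → ℝ → ℝ) (a a₁ a₂ : ℝ) (ha₁ : 0 < a₁) (ha₂ : 0 < a₂) (haa₂ : a₂ < a)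
    (hpen : ∀ l, 0 < l → PPGLM.IsFoldedConcave (pen l) l a a₁ a₂)
    (lam : ℕ → ℝ) (hlam : ∀ n, 0 < lam n)
    -- the oracle estimators are the unique solutions of their problems
    (hred : PPGLM.WithProbToOne P fun n ω => (D n).ReducedOracle b (y n ω))
    (hfull : PPGLM.WithProbToOne P fun n ω => (D n).FullOracle b (y n ω))
    -- minimum signal strength
    (hsignal : ∀ᶠ n in atTop, ∀ j ∈ (D n).S, (a + 1) * lam n < |(D n).beta j|)
    -- the constraint `C β_M = t`: null hypothesis or local alternatives
    (hCrank : ∀ᶠ n in atTop, (D n).C.rank = (D n).r)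
    (hCeig : ∃ K : ℝ, ∀ᶠ n in atTop, PPGLM.EigLE ((D n).C * (D n).Cᵀ)⁻¹ K)
    (hhzero : Tendsto (fun n => PPGLM.l2norm (D n).h) atTop (𝓝 0))
    (hhrate : (fun n => PPGLM.l2norm (D n).h) =O[atTop]
      fun n : ℕ => √(min (((D n).s : ℝ) + (D n).m - (D n).r) ((D n).r : ℝ) / n))
    -- rate of the penalty parameter
    (hlamrate : (fun n : ℕ => max (√(((D n).s : ℝ) + (D n).m)) (√(Real.log (D n).p)) / √(n : ℝ))
      =o[atTop] lam)
    -- eigenvalues and column norms of the design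
    (hdesign : ∃ c₀ K : ℝ, 0 < c₀ ∧ ∀ᶠ n in atTop, (D n).DesignEig b c₀ K)
    (B₁ B₂ : ℝ) (hB₁ : 0 < B₁) (hB₂ : 0 < B₂)
    (hcol : ∀ᶠ n in atTop, (D n).DesignColumns B₁ B₂)
    -- tails of the responses
    (M₀ v₀ : ℝ) (hM₀ : 0 < M₀) (hv₀ : 0 < v₀)
    (htail : ∀ᶠ n in atTop, ∀ i,
      ∫⁻ ω, ENNReal.ofReal
        ((Real.exp (|y n ω i - deriv b (((D n).X *ᵥ (D n).beta) i)| / M₀) - 1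
          - |y n ω i - deriv b (((D n).X *ᵥ (D n).beta) i)| / M₀) * M₀ ^ 2) ∂(P n)
        ≤ ENNReal.ofReal (v₀ / 2))
    -- restricted eigenvalues and self-concordance
    (κ : ℕ → ℝ) (hκ : ∀ n, 0 < κ n) (hRE : ∀ᶠ n in atTop, (D n).RestrictedEig b (κ n))
    (K₀ : ℝ) (hK₀ : 0 < K₀)
    (hself : ∀ x, |iteratedDeriv 3 b x| ≤ K₀ * iteratedDeriv 2 b x)
    -- the lasso penalty parameter
    (lamL : ℕ → ℝ) (hlamL : ∀ n, 0 < lamL n)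
    (hlamLub : ∀ᶠ n in atTop,
      20 * K₀ * PPGLM.entryMax (D n).X * (D n).suppSize * lamL n ≤ κ n)
    (hlamLprob : Tendsto (fun n : ℕ => 2 * ((D n).p : ℝ) * Real.exp (-(1 / 8) *
      ((n : ℝ) * lamL n ^ 2 /
        (B₁ * v₀ + 1 / 2 * B₂ * M₀ * √(n / Real.log (D n).p) * lamL n)))) atTop (𝓝 0))
    (hlamlamL : ∀ᶠ n in atTop,
      5 * √((D n).suppSize : ℝ) * lamL n / (min 1 a₂ * κ n) ≤ lam n)
    -- the lasso and the two-step solutions of the reduced and of the full model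
    (betaL beta0 betaA : ∀ n, Ω n → Fin (D n).p → ℝ)
    (hbetaL : ∀ n ω, PPGLM.IsComputedArgmin
      ((D n).lassoObj b (lamL n) (y n ω)) Set.univ (betaL n ω))
    (hbeta0 : ∀ n ω, (D n).IsTwoStepLLA b (pen (lam n)) (y n ω) (D n).constrained
      (betaL n ω) (beta0 n ω))
    (hbetaA : ∀ n ω, (D n).IsTwoStepLLA b (pen (lam n)) (y n ω) Set.univ
      (betaL n ω) (betaA n ω)) :
    -- rates of convergence
    PPGLM.IsBigOp P
      (fun n ω => PPGLM.l2norm ((D n).subMS (beta0 n ω) - (D n).subMS (D n).beta))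
      (fun n => √((((D n).s : ℝ) + (D n).m - (D n).r) / n)) ∧
    PPGLM.IsBigOp P
      (fun n ω => PPGLM.l2norm ((D n).subMS (betaA n ω) - (D n).subMS (D n).beta))
      (fun n => √((((D n).s : ℝ) + (D n).m) / n)) ∧
    -- selection consistency
    PPGLM.WithProbToOne P (fun n ω => ∀ j, j ∉ (D n).MS → beta0 n ω j = 0) ∧
    PPGLM.WithProbToOne P (fun n ω => ∀ j, j ∉ (D n).MS → betaA n ω j = 0) ∧
    -- linear expansions
    (((fun n => ((D n).s : ℝ) + (D n).m) =o[atTop] fun n : ℕ => (n : ℝ) ^ (1 / 3 : ℝ)) →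
      PPGLM.IsLittleOpOne P (fun n ω =>
        √(n : ℝ) • ((D n).subMS (beta0 n ω) - (D n).subMS (D n).beta)
        - (√(n : ℝ) • ((PPGLM.invSqrtMat ((D n).K b) * ((D n).Pn b - 1)
              * PPGLM.invSqrtMat ((D n).K b))
              *ᵥ (D n).subMS (PPGLM.grad b (D n).X (y n ω) (D n).beta))
          - √(n : ℝ) • ((PPGLM.invSqrtMat ((D n).K b) * (D n).Pn b * PPGLM.sqrtMat ((D n).K b))
              *ᵥ ((D n).C0ᵀ *ᵥ (((D n).C * (D n).Cᵀ)⁻¹ *ᵥ (D n).h))))) ∧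
      PPGLM.IsLittleOpOne P (fun n ω =>
        √(n : ℝ) • ((D n).subMS (betaA n ω) - (D n).subMS (D n).beta)
        - (-(√(n : ℝ) • (((D n).K b)⁻¹
              *ᵥ (D n).subMS (PPGLM.grad b (D n).X (y n ω) (D n).beta)))))) := by
  have hb : ContDiff ℝ 3 b := hfam.contDiff
  -- Convexity of `b` is read off from self-concordance, whose right side bounds an absolute value.
  have hb2 : ∀ x, 0 ≤ iteratedDeriv 2 b x := fun x =>
    (mul_nonneg_iff_of_pos_left hK₀).1 ((abs_nonneg _).trans (hself x))
  have hy : ∀ n, PPGLM.IsGLMResponse b φ ν c ((D n).X *ᵥ (D n).beta) (P n) (y n) := fun n =>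
    ⟨hymeas n, hyindep n, hylaw n⟩
  obtain ⟨c₀, K, hc₀, hdes⟩ := hdesign
  have hdes' : ∀ᶠ n in atTop, (D n).DesignEig b c₀ (max K 0) :=
    hdes.mono fun n h => h.mono (le_max_left _ _)
  have hK : 0 ≤ max K 0 := le_max_right _ _
  have hgrad := PPGLM.withProbToOne_grad_le_lam hfam hy hB₁ hB₂ hcol hM₀ hv₀ htail hp hlam
    hlamrate (half_pos ha₁)
  have hlasso : PPGLM.WithProbToOne P fun n ω =>
      ∀ j, |betaL n ω j - (D n).beta j| ≤ min 1 a₂ * lam n := by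
    refine (PPGLM.withProbToOne_grad_le_lasso hfam hy hB₁ hB₂ hcol hM₀ hv₀ htail hlamL
      hlamLprob).mono ?_
    filter_upwards [hRE, hlamLub, hlamlamL] with n hREn hub hlaml ω hω j
    have h1 := (D n).lasso_bound hb hb2 hK₀ (hκ n) hself hREn (hlamL n) hub hω (hbetaL n ω)
    have h2 : 0 < min 1 a₂ := lt_min one_pos ha₂
    refine (PPGLM.abs_le_l2norm (betaL n ω - (D n).beta) j).trans (h1.trans ?_)
    rw [← div_le_iff₀' h2, div_div, mul_comm (κ n)]
    exact hlaml
  have hnear0 := PPGLM.withBoundedConst_twoStep hb hb2 hsm ha₁ hpen hlam hsignal hlamrate hK hdes'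
    (PPGLM.withBoundedConst_oracle hfam hy hb2 hsm hred hCrank hCeig hhrate hc₀ hK hdes')
    hlasso hgrad hbeta0
  have hdesF : ∀ᶠ n in atTop, (D n).full.DesignEig b c₀ (max K 0) :=
    hdes'.mono fun n h => ⟨h.min_hess, h.third, h.max_hess, h.cross⟩
  have hrankF : ∀ᶠ n in atTop, (D n).full.C.rank = (D n).full.r :=
    Eventually.of_forall fun n => (D n).full_rank
  have hnearF := PPGLM.withBoundedConst_twoStep (D := fun n => (D n).full) hb hb2 hsm ha₁ hpen
    hlam hsignal hlamrate hK hdesF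
    (PPGLM.withBoundedConst_oracle hfam hy hb2 hsm
      (hfull.mono (Eventually.of_forall fun n ω => (D n).full_reducedOracle)) hrankF
      -- Matrices of size `0 × 0` form a trivial ring, so the spectrum is empty and any eigenvalue
      -- bound holds.
      ⟨0, Eventually.of_forall fun n μ hμ => by
        have : Subsingleton (Matrix (Fin (D n).full.r) (Fin (D n).full.r) ℝ) :=
          inferInstanceAs (Subsingleton (Matrix (Fin 0) (Fin 0) ℝ))
        rw [spectrum.of_subsingleton] at hμ
        exact hμ.elim⟩
      (IsBigO.of_bound 1 (Eventually.of_forall fun n => by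
        have : (D n).full.h = 0 := Subsingleton.elim (α := Fin 0 → ℝ) _ _
        rw [this, PPGLM.l2norm_zero, norm_zero]
        positivity)) hc₀ hK hdesF)
    hlasso hgrad (fun n ω => by rw [(D n).full_constrained]; exact hbetaA n ω)
  refine ⟨PPGLM.isBigOp_of_nearOracle hnear0, ?_, PPGLM.selection_of_nearOracle hnear0,
    PPGLM.selection_of_nearOracle (D := fun n => (D n).full) hnearF, fun hsm3 =>
    ⟨PPGLM.expansion_of_nearOracle hnear0 hb hsm3 hCrank hc₀ hK hdes', ?_⟩⟩
  · have h1 : ∀ n, (((D n).full.r : ℕ) : ℝ) = 0 := fun n => Nat.cast_zero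
    have h2 := PPGLM.isBigOp_of_nearOracle (D := fun n => (D n).full) hnearF
    simp only [h1, sub_zero] at h2
    exact h2
  · intro δ hδ
    -- The two expansions agree only eventually: collapsing `K_n^{-1/2} K_n^{-1/2}` to `K_n⁻¹`
    -- requires `K_n` positive definite.
    refine (PPGLM.expansion_of_nearOracle (D := fun n => (D n).full) hnearF hb hsm3 hrankF hc₀ hK hdesF δ hδ).congr' ?_
    filter_upwards [hdesF, eventually_gt_atTop 0] with n hDn hn
    have hpos := hDn.K_posDef hn hc₀
    simp only [PPGLM.Model.full_Pn, zero_sub, Matrix.mul_neg, Matrix.mul_one, Matrix.neg_mul,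
      PPGLM.invSqrtMat_mul_invSqrtMat hpos, Matrix.mul_zero, Matrix.zero_mul, Matrix.zero_mulVec,
      smul_zero, sub_zero, Matrix.neg_mulVec, smul_neg]
    rfl
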